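/- Let $\mathrm{Sp}(2,\mathbb C)$ be the group of the symplectic form $\omega=dz^1\wedge dz^3+dz^2\wedge dz^4$ on $\mathbb C^4$ (with standard basis ${\bf e}_1,\dots,{\bf e}_4$), let $\mathbb Q_3$ be the complex threefold of Lagrangian planes $[{\bf x}\wedge{\bf y}]$ of $\mathbb C^4$, and write $\varphi=A^{-1}dA=(\varphi^j_i)$ ($j$ the row, $i$ the column) for the Maurer--Cartan form. A symplectic frame along a holomorphic map $f:S\to\mathbb Q_3$ from a connected Riemann surface is a local holomorphic map $A=(A_1,A_2,A_3,A_4)$ into $\mathrm{Sp}(2,\mathbb C)$ with $f=[A_1\wedge A_2]$. An isotropic curve is a nonconstant holomorphic $f:S\to\mathbb Q_3$ with $\varphi^3_1\varphi^4_2-(\varphi^4_1)^2=0$ in every symplectic frame, and whose values do not all contain one fixed line of $\mathbb C^4$. Off a discrete set, $f$ has local symplectic frames with $\varphi^3_1=\varphi^4_1=\varphi^2_1-\varphi^4_2=\varphi^1_1-3\varphi^2_2=4\varphi^1_2-3\varphi^2_4=\varphi^1_4=0$ and $\varphi^4_2\ne0$. For these, $\delta=\varphi^1_3(\varphi^4_2)^3$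 is a well-defined meromorphic quartic differential on $S$, and $$\eta=\begin{pmatrix}\varphi^2_2&-(3/32)^{1/3}\varphi^2_4\\-6^{-1/3}\varphi^4_2&-\varphi^2_2\end{pmatrix}$$ is the Cartan connection of a meromorphic projective structure; a local coordinate $z$ is projective if some such frame has $\eta=\begin{pmatrix}0&0\\dz&0\end{pmatrix}$. In projective coordinates put $\mathfrak d(Z\,dz^4)=\big(\tfrac12\tfrac{Z''}{Z}-\tfrac9{16}\tfrac{Z'^2}{Z^2}\big)dz^2$. The curve $f$ is of general type if $\delta\not\equiv0$, and then its conformal bending is the meromorphic function $\mathfrak d(\delta)^2/\delta$. Let $\mathcal D_4$ be the group of transformations of $\dot{\mathbb C}=\mathbb C\setminus\{0\}$ generated by $z\mapsto1/z$ and $z\mapsto-z$. For $\kappa\in\mathbb C\setminus\{1,-16/9\}$ let ${\bf r}(\kappa)\in\dot{\mathbb C}/\mathcal D_4$ be the class of $\sqrt{(5c-4\sqrt{c^2-1})/(5c+4\sqrt{c^2-1})}$, where $c^2=\kappa$ (it does not depend on the choice of $c$ and of the square roots). For a rational $q=m/n>1$ in lowest terms, with $\varepsilon=0$ if $m+n$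 is even and $\varepsilon=1$ if $m+n$ is odd, the isotropic $W$-curve $f_q:\mathbb C\cup\{\infty\}\to\mathbb Q_3$ is given by $f_q(z)=[{\bf v}_q(z)\wedge{\bf w}_q(z)]$, $f_q(\infty)=[{\bf e}_3\wedge{\bf e}_4]$, where $${\bf v}_q(z)=(m-n){\bf e}_1-(m+n)z^{(1+\varepsilon)m}{\bf e}_3-2i\sqrt{mn}\,z^{(m+n)(1+\varepsilon)/2}{\bf e}_4,$$ $${\bf w}_q(z)=(m-n){\bf e}_2-2i\sqrt{mn}\,z^{(m+n)(1+\varepsilon)/2}{\bf e}_3+(m+n)z^{n(1+\varepsilon)}{\bf e}_4.$$ **Theorem E.** Let $S$ be a compact connected Riemann surface and let $f:S\to\mathbb Q_3$ be an isotropic curve of general type whose conformal bending is a constant $\kappa\in\mathbb C$. Then $\kappa\neq1$ and $\kappa\ne-16/9$ (that is, $f$ is of regular type), and ${\bf r}(\kappa)$ lies in the image of $\dot{\mathbb Q}=\mathbb Q\setminus\{0\}$ in $\dot{\mathbb C}/\mathcal D_4$. Moreover ${\bf r}(\kappa)$ contains exactly one real number $q>1$, this $q$ is rational, and $f$ is dominated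 by $f_q$: there are a holomorphic map $h:S\to\mathbb C\cup\{\infty\}$ and $X\in\mathrm{Sp}(2,\mathbb C)$ such that $f=X\cdot(f_q\circ h)$. -/

import Mathlib

open scoped Manifold ContDiff

noncomputable section

/-! ### The Riemann sphere -/

namespace RiemannSphere

open OnePoint Filter Topology

/-- The inversion `z ↦ 1 / z` of `ℂ ∪ {∞}`, exchanging `0` and `OnePoint.infty`. -/
def invFun : OnePoint ℂ → OnePoint ℂ
  | OnePoint.infty => ((0 : ℂ) : OnePoint ℂ)
  | (z : ℂ) => if z = 0 then OnePoint.infty else ((z⁻¹ : ℂ) : OnePoint ℂ)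

lemma invFun_infty : invFun OnePoint.infty = ((0 : ℂ) : OnePoint ℂ) := rfl

lemma invFun_zero : invFun ((0 : ℂ) : OnePoint ℂ) = OnePoint.infty := by
  show (if (0 : ℂ) = 0 then (OnePoint.infty : OnePoint ℂ) else _) = OnePoint.infty
  simp

lemma invFun_coe {z : ℂ} (hz : z ≠ 0) :
    invFun (z : OnePoint ℂ) = ((z⁻¹ : ℂ) : OnePoint ℂ) := by
  show (if z = 0 then (OnePoint.infty : OnePoint ℂ) else _) = _
  simp [hz]

lemma invFun_invFun (x : OnePoint ℂ) : invFun (invFun x) = x := by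
  induction x using OnePoint.rec with
  | infty => rw [invFun_infty, invFun_zero]
  | coe z =>
    by_cases hz : z = 0
    · subst hz; rw [invFun_zero, invFun_infty]
    · rw [invFun_coe hz, invFun_coe (inv_ne_zero hz), inv_inv]

lemma continuous_invFun : Continuous invFun := by
  rw [continuous_iff_continuousAt]
  intro x
  induction x using OnePoint.rec with
  | infty =>
    rw [continuousAt_infty', invFun_infty, coclosedCompact_eq_cocompact]
    have h : Tendsto (fun z : ℂ => ((z⁻¹ : ℂ) : OnePoint ℂ)) (cocompact ℂ)
        (𝓝 ((0 : ℂ) : OnePoint ℂ)) :=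
      by
      refine (continuous_coe.tendsto (0 : ℂ)).comp ?_
      rw [← Metric.cobounded_eq_cocompact]
      exact tendsto_inv₀_cobounded'.mono_right nhdsWithin_le_nhds
    refine h.congr' ?_
    have h0 : ∀ᶠ z : ℂ in cocompact ℂ, z ≠ 0 :=
      (isCompact_singleton (x := (0 : ℂ))).compl_mem_cocompact
    filter_upwards [h0] with z hz
    exact (invFun_coe hz).symm
  | coe z =>
    rw [continuousAt_coe]
    by_cases hz : z = 0
    · subst hz
      rw [continuousAt_iff_punctured_nhds]
      have h : Tendsto (fun z : ℂ => ((z⁻¹ : ℂ) : OnePoint ℂ)) (𝓝[≠] 0) (𝓝 OnePoint.infty) := by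
        have h1 : Tendsto ((↑) : ℂ → OnePoint ℂ) (cocompact ℂ) (𝓝 OnePoint.infty) := by
          rw [← coclosedCompact_eq_cocompact]; exact tendsto_coe_infty
        have h2 : Tendsto (fun z : ℂ => z⁻¹) (𝓝[≠] 0) (cocompact ℂ) := by
          rw [← Metric.cobounded_eq_cocompact]; exact tendsto_inv₀_nhdsNE_zero
        exact h1.comp h2
      show Tendsto _ _ (𝓝 (invFun ((0 : ℂ) : OnePoint ℂ)))
      rw [invFun_zero]
      refine h.congr' ?_
      filter_upwards [self_mem_nhdsWithin] with z hz
      exact (invFun_coe hz).symm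
    · have h : ContinuousAt (fun z : ℂ => ((z⁻¹ : ℂ) : OnePoint ℂ)) z :=
        continuous_coe.continuousAt.comp (continuousAt_inv₀ hz)
      refine h.congr ?_
      filter_upwards [isOpen_ne.mem_nhds hz] with w hw
      exact (invFun_coe hw).symm

/-- The inversion as a homeomorphism. -/
def inversion : OnePoint ℂ ≃ₜ OnePoint ℂ where
  toFun := invFun
  invFun := invFun
  left_inv := invFun_invFun
  right_inv := invFun_invFun
  continuous_toFun := continuous_invFun
  continuous_invFun := continuous_invFun

/-- The affine chart `z` on `ℂ ⊂ ℂ ∪ {∞}`. -/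
def chartZero : OpenPartialHomeomorph (OnePoint ℂ) ℂ :=
  (OnePoint.isOpenEmbedding_coe.toOpenPartialHomeomorph ((↑) : ℂ → OnePoint ℂ)).symm

/-- The chart `1 / z` on `(ℂ ∪ {∞}) ∖ {0}`. -/
def chartInfty : OpenPartialHomeomorph (OnePoint ℂ) ℂ :=
  inversion.toOpenPartialHomeomorph.trans chartZero

open Classical in
instance : ChartedSpace ℂ (OnePoint ℂ) where
  atlas := {chartZero, chartInfty}
  chartAt x := if x = OnePoint.infty then chartInfty else chartZero
  mem_chart_source x := by
    induction x using OnePoint.rec with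
    | infty =>
      simp [chartInfty, chartZero, inversion, invFun_infty]
    | coe z => simp [chartZero]
  chart_mem_atlas x := by
    by_cases h : x = OnePoint.infty <;> simp [h]

lemma chartZero_coe (z : ℂ) : chartZero (z : OnePoint ℂ) = z :=
  OnePoint.isOpenEmbedding_coe.toOpenPartialHomeomorph_left_inv _

lemma chartZero_symm (z : ℂ) : chartZero.symm z = (z : OnePoint ℂ) := rfl

lemma chartZero_source (x : OnePoint ℂ) : x ∈ chartZero.source ↔ x ≠ OnePoint.infty := by
  induction x using OnePoint.rec <;> simp [chartZero]

lemma chartInfty_apply (x : OnePoint ℂ) : chartInfty x = chartZero (invFun x) := rfl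

lemma chartInfty_symm (z : ℂ) : chartInfty.symm z = invFun (z : OnePoint ℂ) := rfl

lemma chartInfty_source (x : OnePoint ℂ) :
    x ∈ chartInfty.source ↔ x ≠ ((0 : ℂ) : OnePoint ℂ) := by
  have : x ∈ chartInfty.source ↔ invFun x ∈ chartZero.source := by
    simp [chartInfty, inversion]
  rw [this, chartZero_source]
  refine not_congr ⟨fun h => ?_, fun h => by rw [h, invFun_zero]⟩
  rw [← invFun_invFun x, h, invFun_infty]

instance : IsManifold 𝓘(ℂ) ω (OnePoint ℂ) := by
  have key : ContDiffOn ℂ ω (fun w : ℂ => w⁻¹) {w : ℂ | w ≠ 0} :=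
    fun z hz => (contDiffAt_inv ℂ hz).contDiffWithinAt
  refine isManifold_of_contDiffOn _ _ _ ?_
  rintro e e' he he'
  simp only [modelWithCornersSelf_coe, modelWithCornersSelf_coe_symm, Set.range_id,
    Set.inter_univ, Function.comp_id, Function.id_comp, Set.preimage_id_eq, id_eq]
  have hz : ∀ z : ℂ, invFun (z : OnePoint ℂ) ≠ OnePoint.infty → z ≠ 0 := by
    rintro z h rfl; exact h invFun_zero
  rcases he with rfl | rfl <;> rcases he' with rfl | rfl
  · refine contDiffOn_id.congr fun z _ => ?_
    exact chartZero_coe z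
  · have hs : ∀ z ∈ (chartZero.symm.trans chartInfty).source, z ≠ 0 := by
      intro z h
      have h2 := h.2
      rw [Set.mem_preimage, chartInfty_source] at h2
      rintro rfl; exact h2 rfl
    refine (key.mono hs).congr fun z h => ?_
    show chartZero (invFun (z : OnePoint ℂ)) = _
    rw [invFun_coe (hs z h), chartZero_coe]
  · have hs : ∀ z ∈ (chartInfty.symm.trans chartZero).source, z ≠ 0 := by
      intro z h
      have h2 := h.2
      rw [Set.mem_preimage, chartZero_source] at h2
      exact hz z h2
    refine (key.mono hs).congr fun z h => ?_
    show chartZero (invFun (z : OnePoint ℂ)) = _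
    rw [invFun_coe (hs z h), chartZero_coe]
  · refine contDiffOn_id.congr fun z _ => ?_
    show chartZero (invFun (invFun (z : OnePoint ℂ))) = _
    rw [invFun_invFun, chartZero_coe]; rfl

end RiemannSphere

namespace IsotropicCurves

/-! ### The complex symplectic group and the quadric of Lagrangian planes

`ℂ⁴` has its coordinates `(z¹, z², z³, z⁴)` indexed by `inl 0, inl 1, inr 0, inr 1`, so that
`Matrix.symplecticGroup (Fin 2) ℂ` is the group `Sp(2, ℂ)` of `ω = dz¹ ∧ dz³ + dz² ∧ dz⁴`. -/

/-- The index set of the coordinates of `ℂ⁴`. -/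
abbrev Idx : Type := Fin 2 ⊕ Fin 2

/-- First coordinate. -/
abbrev i1 : Idx := Sum.inl 0
/-- Second coordinate. -/
abbrev i2 : Idx := Sum.inl 1
/-- Third coordinate. -/
abbrev i3 : Idx := Sum.inr 0
/-- Fourth coordinate. -/
abbrev i4 : Idx := Sum.inr 1

/-- The vector with coordinates `(z¹, z², z³, z⁴)`. -/
def vec4 (z₁ z₂ z₃ z₄ : ℂ) : Idx → ℂ := Sum.elim ![z₁, z₂] ![z₃, z₄]

/-- The symplectic form `ω = dz¹ ∧ dz³ + dz² ∧ dz⁴`. -/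
def symp (x y : Idx → ℂ) : ℂ :=
  (x i1 * y i3 - x i3 * y i1) + (x i2 * y i4 - x i4 * y i2)

/-- A linear subspace of `ℂ⁴` is a Lagrangian plane. -/
def IsLagrangian (P : Submodule ℂ (Idx → ℂ)) : Prop :=
  Module.finrank ℂ P = 2 ∧ ∀ x ∈ P, ∀ y ∈ P, symp x y = 0

/-- The quadric `ℚ₃`: the set of Lagrangian planes of `ℂ⁴`. -/
abbrev Q3 : Type := {P : Submodule ℂ (Idx → ℂ) // IsLagrangian P}

/-- The group `Sp(2, ℂ)`. -/
abbrev Sp2 : Type := Matrix.symplecticGroup (Fin 2) ℂ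

lemma symp_eq (x y : Idx → ℂ) :
    symp x y = - (x ⬝ᵥ (Matrix.J (Fin 2) ℂ).mulVec y) := by
  simp [symp, Matrix.J, Matrix.mulVec, dotProduct, Matrix.fromBlocks, Fintype.sum_sum_type,
    Matrix.one_apply]
  ring

lemma symp_mulVec (X : Sp2) (x y : Idx → ℂ) :
    symp (X.1.mulVec x) (X.1.mulVec y) = symp x y := by
  have h : X.1.transpose * Matrix.J (Fin 2) ℂ * X.1 = Matrix.J (Fin 2) ℂ :=
    SymplecticGroup.mem_iff'.1 X.2
  rw [symp_eq, symp_eq]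
  conv_rhs => rw [← h, ← Matrix.mulVec_mulVec, ← Matrix.mulVec_mulVec,
    Matrix.dotProduct_mulVec x, Matrix.vecMul_transpose]

lemma mulVecLin_injective (X : Sp2) : Function.Injective X.1.mulVecLin :=
  Matrix.mulVec_injective_of_isUnit
    ((Matrix.isUnit_iff_isUnit_det _).2 (SymplecticGroup.symplectic_det X.2))

/-- The plane `X · P`. -/
def act (X : Sp2) (P : Q3) : Q3 :=
  ⟨P.1.map X.1.mulVecLin, by
    constructor
    · exact ((Submodule.equivMapOfInjective _ (mulVecLin_injective X) P.1).finrank_eq).symm.trans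
        P.2.1
    · rintro _ ⟨x, hx, rfl⟩ _ ⟨y, hy, rfl⟩
      simpa only [Matrix.mulVecLin_apply, symp_mulVec] using P.2.2 x hx y hy⟩

lemma isLagrangian_span {u v : Idx → ℂ} (hl : LinearIndependent ℂ ![u, v])
    (h : symp u v = 0) : IsLagrangian (Submodule.span ℂ {u, v}) := by
  constructor
  · have := finrank_span_eq_card hl
    rwa [Matrix.range_cons_cons_empty, Fintype.card_fin] at this
  · intro x hx y hy
    obtain ⟨a, b, rfl⟩ := Submodule.mem_span_pair.1 hx
    obtain ⟨c, d, rfl⟩ := Submodule.mem_span_pair.1 hy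
    simp only [symp, Pi.add_apply, Pi.smul_apply, smul_eq_mul] at h ⊢
    linear_combination (a * d - b * c) * h

/-! ### Isotropic curves and their moving frames -/

section Curves

variable {S : Type*} [TopologicalSpace S] [ChartedSpace ℂ S]

/-- A map into the Grassmannian is holomorphic if, near each point, it is spanned by two
holomorphic vector-valued functions of a local coordinate `e`. -/
def IsHolomorphic (f : S → Q3) : Prop :=
  ∀ p : S, ∃ e ∈ IsManifold.maximalAtlas 𝓘(ℂ) ω S, p ∈ e.source ∧ ∃ u v : ℂ → Idx → ℂ,
    DifferentiableOn ℂ u e.target ∧ DifferentiableOn ℂ v e.target ∧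
      ∀ x ∈ e.source, (f x).1 = Submodule.span ℂ {u (e x), v (e x)}

/-- `A` is a (holomorphic) symplectic frame along `f` on the domain of the local coordinate `e`,
written in terms of this coordinate: `A` is `Sp(2, ℂ)`-valued and `f = [A₁ ∧ A₂]`. -/
structure IsSymplecticFrame (f : S → Q3) (e : OpenPartialHomeomorph S ℂ)
    (A : ℂ → Matrix Idx Idx ℂ) : Prop where
  chart : e ∈ IsManifold.maximalAtlas 𝓘(ℂ) ω S
  holo : ∀ i j, DifferentiableOn ℂ (fun z => A z i j) e.target
  mem : ∀ z ∈ e.target, A z ∈ Matrix.symplecticGroup (Fin 2) ℂ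
  span : ∀ x ∈ e.source,
    (f x).1 = Submodule.span ℂ {(A (e x)).transpose i1, (A (e x)).transpose i2}

/-- The coefficient `A⁻¹ A'` of the pull-back `A⁻¹ dA = (A⁻¹ A') dz` of the Maurer--Cartan form;
its entry in row `j` and column `i` is the coefficient of `φʲᵢ`. -/
def mc (A : ℂ → Matrix Idx Idx ℂ) (z : ℂ) : Matrix Idx Idx ℂ :=
  (A z)⁻¹ * Matrix.of fun i j => deriv (fun w => A w i j) z

/-- The pull-back of the holomorphic conformal structure `g`, which is represented by
`φ³₁ φ⁴₂ - (φ⁴₁)²` in every symplectic frame, vanishes. -/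
def IsNull (f : S → Q3) : Prop :=
  ∀ e A, IsSymplecticFrame f e A → ∀ z ∈ e.target,
    mc A z i3 i1 * mc A z i4 i2 - (mc A z i4 i1) ^ 2 = 0

/-- Isotropic curves: nonconstant holomorphic null maps into `ℚ₃` which are not (contained in)
null rays, a null ray being the pencil of all Lagrangian planes through a point `[ξ]` of `ℂℙ³`. -/
structure IsIsotropicCurve (f : S → Q3) : Prop where
  holo : IsHolomorphic f
  nonconst : ∃ p q, f p ≠ f q
  null : IsNull f
  not_ray : ¬ ∃ ξ : Idx → ℂ, ξ ≠ 0 ∧ ∀ p, ξ ∈ (f p).1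

/-- The frames adapted to an isotropic curve: local sections of its projective bundle `𝓕`, the
reduction of the bundle of symplectic frames defined by the equations
`φ³₁ = φ⁴₁ = φ²₁ - φ⁴₂ = φ¹₁ - 3 φ²₂ = 4 φ¹₂ - 3 φ²₄ = φ¹₄ = 0`, `φ⁴₂ ≠ 0`. Such frames exist
locally off the critical points of the curve and of its Legendre associate. -/
structure IsReducedFrame (f : S → Q3) (e : OpenPartialHomeomorph S ℂ)
    (A : ℂ → Matrix Idx Idx ℂ) : Prop extends IsSymplecticFrame f e A where
  phi31 : ∀ z ∈ e.target, mc A z i3 i1 = 0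
  phi41 : ∀ z ∈ e.target, mc A z i4 i1 = 0
  phi21 : ∀ z ∈ e.target, mc A z i2 i1 = mc A z i4 i2
  phi11 : ∀ z ∈ e.target, mc A z i1 i1 = 3 * mc A z i2 i2
  phi12 : ∀ z ∈ e.target, 4 * mc A z i1 i2 = 3 * mc A z i2 i4
  phi14 : ∀ z ∈ e.target, mc A z i1 i4 = 0
  phi42 : ∀ z ∈ e.target, mc A z i4 i2 ≠ 0

/-- The coefficient of the quartic differential `δ = φ¹₃ (φ⁴₂)³` of an isotropic curve, computed
from a reduced frame: `δ = (quarticCoeff A) dz⁴`. -/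
def quarticCoeff (A : ℂ → Matrix Idx Idx ℂ) (z : ℂ) : ℂ :=
  mc A z i1 i3 * (mc A z i4 i2) ^ 3

/-- The curve is of general type: its meromorphic quartic differential `δ` is not identically
zero. -/
def IsGeneralType (f : S → Q3) : Prop :=
  ∃ e A, IsReducedFrame f e A ∧ ∃ z ∈ e.target, quarticCoeff A z ≠ 0

/-- The coefficient of the `𝔰𝔩(2, ℂ)`-valued Cartan connection
`η = φ²₂ (a¹₁ - a²₂) - 6^(-1/3) φ⁴₂ a¹₂ - (3/32)^(1/3) φ²₄ a²₁`
(the elementary matrix `aʲᵢ` has its entry `1` in row `i` and column `j`) of the projective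
structure of an isotropic curve, computed from a reduced frame. -/
def cartanCoeff (A : ℂ → Matrix Idx Idx ℂ) (z : ℂ) : Matrix (Fin 2) (Fin 2) ℂ :=
  !![mc A z i2 i2, -(((3 / 32 : ℝ) ^ (1 / 3 : ℝ) : ℝ) : ℂ) * mc A z i2 i4;
     -(((6 : ℝ) ^ (-(1 / 3) : ℝ) : ℝ) : ℂ) * mc A z i4 i2, -mc A z i2 i2]

/-- The coordinate `e` is adapted to the projective structure of the curve (a projective
coordinate), and `A` is a flat section over it: `A^* η = a¹₂ dz`. -/
structure IsFlatFrame (f : S → Q3) (e : OpenPartialHomeomorph S ℂ)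
    (A : ℂ → Matrix Idx Idx ℂ) : Prop extends IsReducedFrame f e A where
  flat : ∀ z ∈ e.target, cartanCoeff A z = !![0, 0; 1, 0]

/-- The coefficient `Z''/(2 Z) - 9 Z'² / (16 Z²)` of the quadratic differential `𝔡(Z dz⁴)` in a
projective coordinate `z`. -/
def frakD (Z : ℂ → ℂ) (z : ℂ) : ℂ :=
  1 / 2 * (deriv (deriv Z) z / Z z) - 9 / 16 * ((deriv Z z) ^ 2 / (Z z) ^ 2)

/-- `k` is the value at `p` of the conformal bending `𝔡(δ)² / δ`, at a point `p` where the
projective structure is regular and `δ` is nonzero. -/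
def IsBendingAt (f : S → Q3) (p : S) (k : ℂ) : Prop :=
  ∃ e A, IsFlatFrame f e A ∧ p ∈ e.source ∧ quarticCoeff A (e p) ≠ 0 ∧
    k = (frakD (quarticCoeff A) (e p)) ^ 2 / quarticCoeff A (e p)

/-- The curve is of general type, so that its conformal bending is defined, and the conformal
bending, a meromorphic function on the curve, is the constant `κ`. -/
def HasConstantBending (f : S → Q3) (κ : ℂ) : Prop :=
  IsGeneralType f ∧ ∀ p k, IsBendingAt f p k → k = κ

/-- `f'` is dominated by `f`: `f' = X · f ∘ h` for a holomorphic map `h` and some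
`X ∈ Sp(2, ℂ)`. -/
def IsDominatedBy {S' : Type*} [TopologicalSpace S'] [ChartedSpace ℂ S']
    (f' : S' → Q3) (f : S → Q3) : Prop :=
  ∃ h : S' → S, MDifferentiable 𝓘(ℂ) 𝓘(ℂ) h ∧ ∃ X : Sp2, ∀ p, f' p = act X (f (h p))

end Curves

/-! ### Isotropic `W`-curves -/

/-- The vector `v_q(z)`, `q = m / n`, with `ε = m + n mod 2`. -/
def vq (m n : ℕ) (z : ℂ) : Idx → ℂ :=
  vec4 ((m : ℂ) - n) 0 (-((m : ℂ) + n) * z ^ ((1 + (m + n) % 2) * m))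
    (-2 * Complex.I * (Real.sqrt (m * n) : ℂ) * z ^ ((m + n) * (1 + (m + n) % 2) / 2))

/-- The vector `w_q(z)`, `q = m / n`, with `ε = m + n mod 2`. -/
def wq (m n : ℕ) (z : ℂ) : Idx → ℂ :=
  vec4 0 ((m : ℂ) - n)
    (-2 * Complex.I * (Real.sqrt (m * n) : ℂ) * z ^ ((m + n) * (1 + (m + n) % 2) / 2))
    (((m : ℂ) + n) * z ^ (n * (1 + (m + n) % 2)))

lemma isLagrangian_frame {a b c d : ℂ} (ha : a ≠ 0) :
    IsLagrangian (Submodule.span ℂ {vec4 a 0 b c, vec4 0 a c d}) := by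
  refine isLagrangian_span ?_ ?_
  · rw [LinearIndependent.pair_iff]
    intro s t h
    have h1 := congrFun h i1
    have h2 := congrFun h i2
    simp [vec4, ha] at h1 h2
    exact ⟨h1, h2⟩
  · simp [symp, vec4]
    ring

lemma isLagrangian_infty :
    IsLagrangian (Submodule.span ℂ {vec4 0 0 1 0, vec4 0 0 0 1}) := by
  refine isLagrangian_span ?_ ?_
  · rw [LinearIndependent.pair_iff]
    intro s t h
    have h1 := congrFun h i3
    have h2 := congrFun h i4
    simp [vec4] at h1 h2
    exact ⟨h1, h2⟩
  · simp [symp, vec4]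

lemma num_sub_den_ne_zero {q : ℚ} (hq : 1 < q) : ((q.num.toNat : ℂ) - (q.den : ℂ)) ≠ 0 := by
  have h1 : (q.den : ℤ) < q.num := by
    have := (Rat.lt_iff 1 q).1 hq
    simpa using this
  have h2 : q.den < q.num.toNat := by omega
  rw [sub_ne_zero]
  exact_mod_cast h2.ne'

/-- The isotropic `W`-curve `f_q : ℂ ∪ {∞} → ℚ₃` for a rational number `q = m / n > 1` in lowest
terms: `f_q(z) = [v_q(z) ∧ w_q(z)]` and `f_q(∞) = [e₃ ∧ e₄]`. -/
def wCurve (q : ℚ) (hq : 1 < q) : OnePoint ℂ → Q3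
  | OnePoint.infty => ⟨Submodule.span ℂ {vec4 0 0 1 0, vec4 0 0 0 1}, isLagrangian_infty⟩
  | OnePoint.some z => ⟨Submodule.span ℂ {vq q.num.toNat q.den z, wq q.num.toNat q.den z},
      isLagrangian_frame (num_sub_den_ne_zero hq)⟩

/-! ### The invariant `r` -/

/-- The group `𝓓₄` of transformations of `ℂ ∖ {0}` generated by `z ↦ 1 / z` and `z ↦ -z`. -/
def dihedral : Subgroup (Equiv.Perm ℂˣ) :=
  Subgroup.closure {Equiv.inv ℂˣ, Equiv.neg ℂˣ}

/-- The quotient `(ℂ ∖ {0}) / 𝓓₄`. -/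
abbrev DihedralQuotient : Type := MulAction.orbitRel.Quotient dihedral ℂˣ

/-- The class `|[z]|` of `z`. -/
def cls (z : ℂˣ) : DihedralQuotient := Quotient.mk'' z

/-- The complex number `z` is an element of the class `c`, seen as a subset of `ℂ ∖ {0}`. -/
def MemClass (z : ℂ) (c : DihedralQuotient) : Prop := ∃ u : ℂˣ, (u : ℂ) = z ∧ cls u = c

/-- The image of `ℚ ∖ {0}` in the quotient. -/
def ratClasses : Set DihedralQuotient :=
  {c | ∃ q : ℚˣ, c = cls (Units.map (algebraMap ℚ ℂ).toMonoidHom q)}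

/-- A value of the bending is regular if it is neither `1` nor `-16/9`. -/
def IsRegularValue (κ : ℂ) : Prop := κ ≠ 1 ∧ κ ≠ -16 / 9

/-- The principal square root. -/
def csqrt (z : ℂ) : ℂ := z ^ ((2 : ℂ)⁻¹)

lemma csqrt_sq (z : ℂ) : csqrt z ^ 2 = z := by
  simp [csqrt]

/-- The number `√((5c - 4√(c² - 1)) / (5c + 4√(c² - 1)))`, where `c² = κ`. -/
def rNum (κ : ℂ) : ℂ :=
  let c := csqrt κ
  csqrt ((5 * c - 4 * csqrt (c ^ 2 - 1)) / (5 * c + 4 * csqrt (c ^ 2 - 1)))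

lemma rNum_ne_zero {κ : ℂ} (hκ : IsRegularValue κ) : rNum κ ≠ 0 := by
  intro h
  have hc := csqrt_sq κ
  have hd := csqrt_sq (csqrt κ ^ 2 - 1)
  have h2 := csqrt_sq
    ((5 * csqrt κ - 4 * csqrt (csqrt κ ^ 2 - 1)) / (5 * csqrt κ + 4 * csqrt (csqrt κ ^ 2 - 1)))
  rw [show csqrt _ = 0 from h, zero_pow two_ne_zero, eq_comm, div_eq_zero_iff] at h2
  have h3 : (5 * csqrt κ - 4 * csqrt (csqrt κ ^ 2 - 1)) *
      (5 * csqrt κ + 4 * csqrt (csqrt κ ^ 2 - 1)) = 0 := mul_eq_zero.2 h2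
  refine hκ.2 ?_
  linear_combination (1 / 9) * h3 + (16 / 9) * hd - hc

/-- The class `r(κ)`; other choices of `c` and of the square roots give the same class. -/
def r (κ : ℂ) (hκ : IsRegularValue κ) : DihedralQuotient :=
  cls (Units.mk0 (rNum κ) (rNum_ne_zero hκ))

end IsotropicCurves

end

noncomputable section

open Filter Topology Metric

namespace IsotropicCurves

/-! Near a point where δ ≠ 0 there are a coordinate z with δ = dz⁴ and a reduced frame A with φ⁴₂
equal to a fixed constant p (`flatScale`) and φ²₂ = 0. The only function left in A⁻¹A' is φ²₄, and
passing to a projective coordinate shows that the bending is (p φ²₄)² (`IsNormalFrame.isBendingAt`).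
Constant bending therefore makes A⁻¹A' a constant matrix on a disk
(`HasConstantBending.exists_constant_frame`); with κ = 16T² its characteristic polynomial is l⁴ -
10Tl² + 9T² + 1.

If w is an eigenvector for l, then A w = e^{lz} c with c constant. Hence the Plücker coordinates of
f with respect to such vectors c are exponentials of z on the disk, up to a common factor, while
their quotients, being built from f alone, are meromorphic on all of S
(`IsHolomorphic.isMero_plRatio`). On the compact surface S a nonconstant meromorphic function has a
pole, and at a pole of a function continuing e^{mz} the form m dz has a simple pole with nonzero
integer residue. If the quartic has a double root, a Jordan chain makes z itself meromorphic on S;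
then dz is the differential of a meromorphic function and cannot have a simple pole
(`IsMero.not_exp_and_linear`). This rules out κ = 1 and κ = -16/9. Otherwise the roots ±α, ±β are
distinct, e^{2αz} and e^{2βz} are both meromorphic on S, and comparing residues makes α/β rational
(`IsMero.exists_rat_of_exp`). Up to exchanging α and β and changing signs, α = qβ with q > 1, and
the square of the number defining r(κ) is q² or q⁻² (`rNum_sq`).

Finally the vectors c, suitably scaled, are the columns of a symplectic matrix X with f = X ·
f_q(e^{σz}) on the disk, where 2α = (1+ε)mσ and 2β = (1+ε)nσ (`IsConstantFrame.exists_act_wCurve`).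
By Bézout, e^{σz} is a monomial in e^{2αz} and e^{(α+β)z}, so it extends to a holomorphic map h from
S to the sphere, and the identity principle (`IsHolomorphic.eq_of_eventually_eq`) spreads f = X ·
f_q ∘ h over S. -/

/-! ### Local complex analysis: primitives, roots, second order linear equations -/

lemma exists_primitive {g : ℂ → ℂ} {z₀ : ℂ} (hg : AnalyticAt ℂ g z₀) :
    ∃ G : ℂ → ℂ, AnalyticAt ℂ G z₀ ∧ ∀ᶠ z in 𝓝 z₀, HasDerivAt G (g z) z := by
  obtain ⟨ε, hε, h⟩ := Metric.eventually_nhds_iff_ball.1 hg.eventually_analyticAt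
  have hd : DifferentiableOn ℂ g (ball z₀ ε) :=
    fun z hz => (h z hz).differentiableAt.differentiableWithinAt
  obtain ⟨G, hG⟩ := hd.isExactOn_ball
  refine ⟨G, ?_, ?_⟩
  · have : DifferentiableOn ℂ G (ball z₀ ε) :=
      fun z hz => (hG z hz).differentiableAt.differentiableWithinAt
    exact this.analyticAt (ball_mem_nhds _ hε)
  · filter_upwards [ball_mem_nhds z₀ hε] with z hz using hG z hz

lemma exists_root {g : ℂ → ℂ} {z₀ : ℂ} (hg : AnalyticAt ℂ g z₀) (h0 : g z₀ ≠ 0)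
    {n : ℕ} (hn : n ≠ 0) :
    ∃ k : ℂ → ℂ, AnalyticAt ℂ k z₀ ∧ k z₀ ≠ 0 ∧ ∀ z, k z ^ n = g z := by
  -- Dividing by the value at z₀ moves the base point to 1, away from the branch cut of the power.
  refine ⟨fun z => (g z₀) ^ ((n : ℂ)⁻¹) * (g z / g z₀) ^ ((n : ℂ)⁻¹), ?_, ?_, ?_⟩
  · refine analyticAt_const.mul (AnalyticAt.cpow (hg.div analyticAt_const h0) analyticAt_const ?_)
    simp [div_self h0]
  · simp [Complex.cpow_eq_zero_iff, h0]
  · intro z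
    rw [mul_pow, Complex.cpow_nat_inv_pow _ hn, Complex.cpow_nat_inv_pow _ hn,
      mul_div_cancel₀ _ h0]

/-- One step of the Picard iteration for y'' = t y, with the bounds that make the iteration contract
on a small disk. -/
lemma exists_double_primitive {t u : ℂ → ℂ} {z₀ : ℂ} {R M B : ℝ} (hR : 0 < R)
    (ht : DifferentiableOn ℂ t (ball z₀ R)) (hu : DifferentiableOn ℂ u (ball z₀ R))
    (hM : ∀ z ∈ ball z₀ R, ‖t z‖ ≤ M) (hB : ∀ z ∈ ball z₀ R, ‖u z‖ ≤ B) :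
    ∃ v v' : ℂ → ℂ, (∀ z ∈ ball z₀ R, HasDerivAt v (v' z) z) ∧
      (∀ z ∈ ball z₀ R, HasDerivAt v' (t z * u z) z) ∧ v z₀ = 0 ∧
      (∀ z ∈ ball z₀ R, ‖v' z‖ ≤ M * B * R) ∧ (∀ z ∈ ball z₀ R, ‖v z‖ ≤ M * B * R * R) := by
  have key : ∀ (g : ℂ → ℂ) (C : ℝ), DifferentiableOn ℂ g (ball z₀ R) →
      (∀ z ∈ ball z₀ R, ‖g z‖ ≤ C) → ∃ G : ℂ → ℂ, (∀ z ∈ ball z₀ R, HasDerivAt G (g z) z) ∧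
        G z₀ = 0 ∧ ∀ z ∈ ball z₀ R, ‖G z‖ ≤ C * R := by
    intro g C hg hC
    obtain ⟨G, hG⟩ := hg.isExactOn_ball
    refine ⟨fun z => G z - G z₀, fun z hz => (hG z hz).sub_const _, sub_self _, ?_⟩
    intro z hz
    have h1 := (convex_ball z₀ R).norm_image_sub_le_of_norm_hasDerivWithin_le
      (fun w hw => (hG w hw).hasDerivWithinAt) hC (mem_ball_self hR) hz
    have hC0 : 0 ≤ C := (norm_nonneg _).trans (hC z₀ (mem_ball_self hR))
    refine h1.trans (mul_le_mul_of_nonneg_left ?_ hC0)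
    rw [mem_ball, dist_eq_norm] at hz
    exact hz.le
  obtain ⟨v', h1, -, h3⟩ := key (fun z => t z * u z) (M * B) (ht.mul hu) (fun z hz => by
    rw [norm_mul]
    exact mul_le_mul (hM z hz) (hB z hz) (norm_nonneg _) ((norm_nonneg _).trans (hM z hz)))
  obtain ⟨v, h4, h5, h6⟩ := key v' (M * B * R)
    (fun z hz => (h1 z hz).differentiableAt.differentiableWithinAt) h3
  exact ⟨v, v', h4, h1, h5, h3, h6⟩

/-- Local solvability of the linear equation `y'' = t y`. -/
lemma exists_second_order_solution {t : ℂ → ℂ} {z₀ : ℂ} (ht : AnalyticAt ℂ t z₀) :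
    ∃ y : ℂ → ℂ, AnalyticAt ℂ y z₀ ∧ y z₀ = 1 ∧
      ∀ᶠ z in 𝓝 z₀, deriv (deriv y) z = t z * y z := by
  obtain ⟨M, hM1, hM⟩ : ∃ M : ℝ, 1 ≤ M ∧ ∀ᶠ z in 𝓝 z₀, ‖t z‖ ≤ M := by
    refine ⟨‖t z₀‖ + 1, by linarith [norm_nonneg (t z₀)], ?_⟩
    have := ht.continuousAt.norm.eventually (gt_mem_nhds (lt_add_one ‖t z₀‖))
    filter_upwards [this] with z hz using hz.le
  obtain ⟨ε, hε, h⟩ := Metric.eventually_nhds_iff_ball.1 (ht.eventually_analyticAt.and hM)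
  -- Then M R ≤ 1/2, and R ≤ 1 because M ≥ 1: one integration already halves the bound, and the
  -- second one does not enlarge it.
  set R : ℝ := min ε (1 / (2 * M)) with hRdef
  have hM0 : 0 < M := by linarith
  have hR : 0 < R := lt_min hε (by positivity)
  have hRε : R ≤ ε := min_le_left _ _
  have hRM : M * R ≤ 1 / 2 := by
    have : R ≤ 1 / (2 * M) := min_le_right _ _
    calc M * R ≤ M * (1 / (2 * M)) := by gcongr
      _ = 1 / 2 := by field_simp
  have hR1 : R ≤ 1 := by nlinarith
  have htd : DifferentiableOn ℂ t (ball z₀ R) := fun z hz =>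
    (h z (ball_subset_ball hRε hz)).1.differentiableAt.differentiableWithinAt
  have htM : ∀ z ∈ ball z₀ R, ‖t z‖ ≤ M := fun z hz => (h z (ball_subset_ball hRε hz)).2
  -- Bundling each iterate with its derivative and its bound lets the step be iterated after
  -- `choose`. The derivatives are bounded as well, so that the series may be differentiated
  -- termwise twice.
  have step : ∀ (k : ℕ) (u : {p : (ℂ → ℂ) × (ℂ → ℂ) //
      (∀ z ∈ ball z₀ R, HasDerivAt p.1 (p.2 z) z) ∧ ∀ z ∈ ball z₀ R, ‖p.1 z‖ ≤ (1 / 2) ^ k}),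
      ∃ v : {p : (ℂ → ℂ) × (ℂ → ℂ) //
      (∀ z ∈ ball z₀ R, HasDerivAt p.1 (p.2 z) z) ∧ ∀ z ∈ ball z₀ R, ‖p.1 z‖ ≤ (1 / 2) ^ (k + 1)},
      (∀ z ∈ ball z₀ R, HasDerivAt v.1.2 (t z * u.1.1 z) z) ∧ v.1.1 z₀ = 0 ∧
        ∀ z ∈ ball z₀ R, ‖v.1.2 z‖ ≤ (1 / 2) ^ (k + 1) := by
    rintro k ⟨⟨u, u'⟩, hu, hb⟩
    obtain ⟨v, v', h1, h2, h3, h4, h5⟩ := exists_double_primitive hR htd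
      (fun z hz => (hu z hz).differentiableAt.differentiableWithinAt) htM hb
    have e1 : M * (1 / 2) ^ k * R ≤ (1 / 2) ^ (k + 1) := by
      rw [pow_succ]
      have : (0 : ℝ) ≤ (1 / 2) ^ k := by positivity
      nlinarith
    have e2 : M * (1 / 2) ^ k * R * R ≤ (1 / 2) ^ (k + 1) := by
      have : (0 : ℝ) ≤ M * (1 / 2) ^ k * R := by positivity
      nlinarith
    exact ⟨⟨(v, v'), h1, fun z hz => (h5 z hz).trans e2⟩, h2, h3, fun z hz => (h4 z hz).trans e1⟩
  choose F hF using step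
  let U : (k : ℕ) → {p : (ℂ → ℂ) × (ℂ → ℂ) //
      (∀ z ∈ ball z₀ R, HasDerivAt p.1 (p.2 z) z) ∧ ∀ z ∈ ball z₀ R, ‖p.1 z‖ ≤ (1 / 2) ^ k} :=
    fun k => Nat.rec ⟨(fun _ => 1, fun _ => 0), fun z _ => hasDerivAt_const z 1, by simp⟩ F k
  let u : ℕ → ℂ → ℂ := fun k => (U k).1.1
  let u' : ℕ → ℂ → ℂ := fun k => (U k).1.2
  have hu0 : u 0 = fun _ => 1 := rfl
  have hu0' : u' 0 = fun _ => 0 := rfl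
  have hd : ∀ k, ∀ z ∈ ball z₀ R, HasDerivAt (u k) (u' k z) z := fun k => (U k).2.1
  have hb : ∀ k, ∀ z ∈ ball z₀ R, ‖u k z‖ ≤ (1 / 2) ^ k := fun k => (U k).2.2
  have hd' : ∀ k, ∀ z ∈ ball z₀ R, HasDerivAt (u' (k + 1)) (t z * u k z) z :=
    fun k => (hF k (U k)).1
  have hz : ∀ k, u (k + 1) z₀ = 0 := fun k => (hF k (U k)).2.1
  have hb' : ∀ k, ∀ z ∈ ball z₀ R, ‖u' k z‖ ≤ (1 / 2) ^ k := by
    rintro (_ | k) z hz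
    · simp [hu0']
    · exact (hF k (U k)).2.2 z hz
  have hdiff' : ∀ k, DifferentiableOn ℂ (u' k) (ball z₀ R) := by
    rintro (_ | k)
    · rw [hu0']; exact differentiableOn_const 0
    · exact fun z hz => (hd' k z hz).differentiableAt.differentiableWithinAt
  have hdiff : ∀ k, DifferentiableOn ℂ (u k) (ball z₀ R) :=
    fun k z hz => (hd k z hz).differentiableAt.differentiableWithinAt
  have hsum : Summable fun k : ℕ => ((1 / 2 : ℝ)) ^ k := summable_geometric_two
  have hy1 : ∀ z ∈ ball z₀ R, HasSum (fun k => deriv (u k) z) (deriv (fun w => ∑' k, u k w) z) :=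
    fun z hz => Complex.hasSum_deriv_of_summable_norm hsum hdiff isOpen_ball hb hz
  have hy2 : ∀ z ∈ ball z₀ R,
      HasSum (fun k => deriv (u' k) z) (deriv (fun w => ∑' k, u' k w) z) :=
    fun z hz => Complex.hasSum_deriv_of_summable_norm hsum hdiff' isOpen_ball hb' hz
  have hder : ∀ z ∈ ball z₀ R, deriv (fun w => ∑' k, u k w) z = ∑' k, u' k z := by
    intro z hz
    rw [← (hy1 z hz).tsum_eq]
    exact tsum_congr fun k => (hd k z hz).deriv
  refine ⟨fun w => ∑' k, u k w, ?_, ?_, ?_⟩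
  · exact (Complex.differentiableOn_tsum_of_summable_norm hsum hdiff isOpen_ball hb).analyticAt
      (ball_mem_nhds _ hR)
  · show ∑' k, u k z₀ = 1
    rw [tsum_eq_single 0]
    · rw [hu0]
    · rintro (_ | k) hk
      · exact absurd rfl hk
      · exact hz k
  · filter_upwards [isOpen_ball.mem_nhds (mem_ball_self hR)] with z hz
    have e : deriv (fun w => ∑' k, u k w) =ᶠ[𝓝 z] fun w => ∑' k, u' k w := by
      filter_upwards [isOpen_ball.mem_nhds hz] with w hw using hder w hw
    -- The initial term is the constant 1, whose second derivative vanishes; the shifted series is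
    -- then t times the series itself.
    rw [e.deriv_eq, ← (hy2 z hz).tsum_eq, (hy2 z hz).summable.tsum_eq_zero_add,
      ← tsum_mul_left]
    rw [show deriv (u' 0) z = 0 by rw [hu0']; simp, zero_add]
    exact tsum_congr fun k => (hd' k z hz).deriv

/-! ### Entrywise derivatives of matrices -/

/-- `M'` is the entrywise derivative of `M` at `z`. -/
def HasMatDeriv (M : ℂ → Matrix Idx Idx ℂ) (M' : Matrix Idx Idx ℂ) (z : ℂ) : Prop :=
  ∀ i j, HasDerivAt (fun w => M w i j) (M' i j) z

lemma HasMatDeriv.mul {M N : ℂ → Matrix Idx Idx ℂ} {M' N' : Matrix Idx Idx ℂ} {z : ℂ}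
    (hM : HasMatDeriv M M' z) (hN : HasMatDeriv N N' z) :
    HasMatDeriv (fun w => M w * N w) (M' * N z + M z * N') z := by
  intro i j
  simp only [Matrix.mul_apply, Matrix.add_apply, ← Finset.sum_add_distrib]
  exact HasDerivAt.fun_sum fun k _ => (hM i k).mul (hN k j)

lemma HasMatDeriv.transpose {M : ℂ → Matrix Idx Idx ℂ} {M' : Matrix Idx Idx ℂ} {z : ℂ}
    (hM : HasMatDeriv M M' z) : HasMatDeriv (fun w => (M w).transpose) M'.transpose z :=
  fun i j => hM j i

lemma hasMatDeriv_const (M : Matrix Idx Idx ℂ) (z : ℂ) : HasMatDeriv (fun _ => M) 0 z :=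
  fun _ _ => hasDerivAt_const _ _

lemma HasMatDeriv.comp {M : ℂ → Matrix Idx Idx ℂ} {M' : Matrix Idx Idx ℂ} {z c : ℂ} {φ : ℂ → ℂ}
    (hM : HasMatDeriv M M' (φ z)) (hφ : HasDerivAt φ c z) :
    HasMatDeriv (fun w => M (φ w)) (c • M') z := by
  intro i j
  have := (hM i j).comp z hφ
  rw [Matrix.smul_apply, smul_eq_mul, mul_comm]
  exact this

lemma HasMatDeriv.unique {M : ℂ → Matrix Idx Idx ℂ} {M' M'' : Matrix Idx Idx ℂ} {z : ℂ}
    (h : HasMatDeriv M M' z) (h' : HasMatDeriv M M'' z) : M' = M'' := by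
  ext i j; exact (h i j).unique (h' i j)

lemma HasMatDeriv.congr_of_eventuallyEq {M N : ℂ → Matrix Idx Idx ℂ} {M' : Matrix Idx Idx ℂ}
    {z : ℂ} (h : HasMatDeriv M M' z) (e : N =ᶠ[𝓝 z] M) : HasMatDeriv N M' z :=
  fun i j => (h i j).congr_of_eventuallyEq (e.mono fun w hw => by simp [hw])

lemma isUnit_of_mem_symplectic {A : Matrix Idx Idx ℂ}
    (h : A ∈ Matrix.symplecticGroup (Fin 2) ℂ) : IsUnit A.det :=
  SymplecticGroup.symplectic_det h

lemma mc_eq {A : ℂ → Matrix Idx Idx ℂ} {M : Matrix Idx Idx ℂ} {z : ℂ}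
    (hA : A z ∈ Matrix.symplecticGroup (Fin 2) ℂ) (h : HasMatDeriv A (A z * M) z) :
    mc A z = M := by
  have : (Matrix.of fun i j => deriv (fun w => A w i j) z) = A z * M := by
    ext i j; exact (h i j).deriv
  rw [mc, this, ← Matrix.mul_assoc, Matrix.nonsing_inv_mul _ (isUnit_of_mem_symplectic hA),
    Matrix.one_mul]

lemma hasMatDeriv_mc {A : ℂ → Matrix Idx Idx ℂ} {z : ℂ}
    (hA : A z ∈ Matrix.symplecticGroup (Fin 2) ℂ)
    (h : ∀ i j, DifferentiableAt ℂ (fun w => A w i j) z) :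
    HasMatDeriv A (A z * mc A z) z := by
  rw [mc, ← Matrix.mul_assoc, Matrix.mul_nonsing_inv _ (isUnit_of_mem_symplectic hA),
    Matrix.one_mul]
  exact fun i j => (h i j).hasDerivAt

/-- Differentiate the constant Aᵀ J A = J along A' = A φ: the form φ takes values in 𝔰𝔭(2, ℂ). -/
lemma mc_mem_lie {A : ℂ → Matrix Idx Idx ℂ} {z : ℂ}
    (hA : ∀ᶠ w in 𝓝 z, A w ∈ Matrix.symplecticGroup (Fin 2) ℂ)
    (h : ∀ i j, DifferentiableAt ℂ (fun w => A w i j) z) :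
    (mc A z).transpose * Matrix.J (Fin 2) ℂ + Matrix.J (Fin 2) ℂ * mc A z = 0 := by
  have hz := hA.self_of_nhds
  have hJ : ∀ w, A w ∈ Matrix.symplecticGroup (Fin 2) ℂ →
      (A w).transpose * Matrix.J (Fin 2) ℂ * A w = Matrix.J (Fin 2) ℂ :=
    fun w hw => SymplecticGroup.mem_iff'.1 hw
  have h1 := hasMatDeriv_mc hz h
  have h2 := (h1.transpose.mul (hasMatDeriv_const (Matrix.J (Fin 2) ℂ) z)).mul h1
  have h3 : HasMatDeriv (fun w => (A w).transpose * Matrix.J (Fin 2) ℂ * A w) 0 z :=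
    (hasMatDeriv_const (Matrix.J (Fin 2) ℂ) z).congr_of_eventuallyEq (hA.mono hJ)
  have h4 := h2.unique h3
  simp only [Matrix.mul_zero, add_zero, Matrix.transpose_mul] at h4
  have e1 : (mc A z).transpose * (A z).transpose * Matrix.J (Fin 2) ℂ * A z
      = (mc A z).transpose * Matrix.J (Fin 2) ℂ := by
    rw [Matrix.mul_assoc, Matrix.mul_assoc, ← Matrix.mul_assoc (A z).transpose, hJ _ hz]
  have e2 : (A z).transpose * Matrix.J (Fin 2) ℂ * (A z * mc A z)
      = Matrix.J (Fin 2) ℂ * mc A z := by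
    rw [← Matrix.mul_assoc, hJ _ hz]
  rwa [e1, e2] at h4

/-! ### Reduced frames and their gauge transformations -/

/-- The general value of the Maurer--Cartan form on a reduced frame. -/
def redMat (p s r Q : ℂ) : Matrix Idx Idx ℂ :=
  Matrix.fromBlocks !![3 * s, 3 / 4 * r; p, s] !![Q, 0; 0, r] !![0, 0; 0, p]
    !![-3 * s, -p; -(3 / 4 * r), -s]

/-- The group of changes of reduced frames. -/
def gauge (a b : ℂ) : Matrix Idx Idx ℂ :=
  Matrix.fromBlocks !![a ^ 3, 3 / 4 * b * a ^ 3; 0, a]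
    !![-(3 / 32) * b ^ 3 * a ^ 3, 3 / 8 * b ^ 2 * a ^ 3; -(3 / 8) * b ^ 2 * a, b * a]
    0 !![(a ^ 3)⁻¹, 0; -(3 / 4) * b * a⁻¹, a⁻¹]

lemma gauge_mem {a : ℂ} (b : ℂ) (ha : a ≠ 0) :
    gauge a b ∈ Matrix.symplecticGroup (Fin 2) ℂ := by
  rw [SymplecticGroup.mem_iff']
  ext i j
  rcases i with i | i <;> rcases j with j | j <;> fin_cases i <;> fin_cases j <;>
    simp [gauge, Matrix.J, Matrix.mul_apply, Fintype.sum_sum_type, Fin.sum_univ_two,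
      Matrix.one_apply] <;> field_simp <;> ring

lemma hasMatDeriv_gauge {a b : ℂ → ℂ} {a' b' z : ℂ} (ha : HasDerivAt a a' z)
    (hb : HasDerivAt b b' z) (h0 : a z ≠ 0) :
    HasMatDeriv (fun w => gauge (a w) (b w))
      (Matrix.fromBlocks
        !![3 * a z ^ 2 * a', 3 / 4 * (b' * a z ^ 3 + b z * (3 * a z ^ 2 * a')); 0, a']
        !![-(3 / 32) * (3 * b z ^ 2 * b' * a z ^ 3 + b z ^ 3 * (3 * a z ^ 2 * a')),
          3 / 8 * (2 * b z * b' * a z ^ 3 + b z ^ 2 * (3 * a z ^ 2 * a'));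
          -(3 / 8) * (2 * b z * b' * a z + b z ^ 2 * a'), b' * a z + b z * a']
        0 !![-(3 * a z ^ 2 * a') / (a z ^ 3) ^ 2, 0;
          -(3 / 4) * (b' * (a z)⁻¹ + b z * (-a' / a z ^ 2)), -a' / a z ^ 2]) z := by
  have h2 : HasDerivAt (fun w => b w ^ 2) (2 * b z * b') z := by simpa using hb.fun_pow 2
  have h3 : HasDerivAt (fun w => a w ^ 3) (3 * a z ^ 2 * a') z := by simpa using ha.fun_pow 3
  have h3b : HasDerivAt (fun w => b w ^ 3) (3 * b z ^ 2 * b') z := by simpa using hb.fun_pow 3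
  have hi : HasDerivAt (fun w => (a w)⁻¹) (-a' / a z ^ 2) z := ha.inv h0
  have hi3 : HasDerivAt (fun w => (a w ^ 3)⁻¹) (-(3 * a z ^ 2 * a') / (a z ^ 3) ^ 2) z :=
    h3.inv (pow_ne_zero 3 h0)
  intro i j
  rcases i with i | i <;> rcases j with j | j <;> fin_cases i <;> fin_cases j <;>
    simp only [gauge, Fin.zero_eta, Fin.mk_one, Matrix.fromBlocks_apply₁₁,
      Matrix.fromBlocks_apply₁₂, Matrix.fromBlocks_apply₂₁, Matrix.fromBlocks_apply₂₂,
      Matrix.of_apply, Matrix.cons_val_zero, Matrix.cons_val_one, Matrix.zero_apply,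
      Matrix.cons_val_fin_one, mul_assoc]
  all_goals first
    | exact hasDerivAt_const _ _
    | exact h3
    | exact ha
    | exact hi
    | exact hi3
    | simpa only [mul_assoc] using h3
    | simpa only [mul_assoc] using hi3
    | simpa only [mul_assoc] using (hb.fun_mul h3).const_mul (3 / 4)
    | simpa only [mul_assoc] using (h3b.fun_mul h3).const_mul (-(3 / 32))
    | simpa only [mul_assoc] using (h2.fun_mul h3).const_mul (3 / 8)
    | simpa only [mul_assoc] using (h2.fun_mul ha).const_mul (-(3 / 8))
    | simpa only [mul_assoc] using hb.fun_mul ha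
    | simpa only [mul_assoc] using (hb.fun_mul hi).const_mul (-(3 / 4))

/-- This is the gauge rule φ' = g⁻¹(φ g + g'), written without inverses. It shows that the reduced
shape is preserved, that p is scaled by a² and Q by a⁻⁶ (so that δ = Q p³ is invariant), and that b
moves s and r. -/
lemma redMat_mul_gauge {a : ℂ} (b a' b' p s r Q : ℂ) (h0 : a ≠ 0) :
    redMat p s r Q * gauge a b + (Matrix.fromBlocks
        !![3 * a ^ 2 * a', 3 / 4 * (b' * a ^ 3 + b * (3 * a ^ 2 * a')); 0, a']
        !![-(3 / 32) * (3 * b ^ 2 * b' * a ^ 3 + b ^ 3 * (3 * a ^ 2 * a')),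
          3 / 8 * (2 * b * b' * a ^ 3 + b ^ 2 * (3 * a ^ 2 * a'));
          -(3 / 8) * (2 * b * b' * a + b ^ 2 * a'), b' * a + b * a']
        0 !![-(3 * a ^ 2 * a') / (a ^ 3) ^ 2, 0;
          -(3 / 4) * (b' * a⁻¹ + b * (-a' / a ^ 2)), -a' / a ^ 2])
      = gauge a b * redMat (a ^ 2 * p) (a' / a + s - b * (a ^ 2 * p) / 4)
        (r / a ^ 2 + 2 * (s + a' / a) * b - b ^ 2 * (a ^ 2 * p) / 4 + b') (Q / a ^ 6) := by
  ext i j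
  rcases i with i | i <;> rcases j with j | j <;> fin_cases i <;> fin_cases j <;>
    simp [gauge, redMat, Matrix.mul_apply, Fintype.sum_sum_type, Fin.sum_univ_two] <;>
    field_simp <;> ring

section Frames

variable {S : Type*} [TopologicalSpace S] [ChartedSpace ℂ S]

lemma mem_maximalAtlas_trans {e : OpenPartialHomeomorph S ℂ}
    (he : e ∈ IsManifold.maximalAtlas 𝓘(ℂ) ω S) {ψ : OpenPartialHomeomorph ℂ ℂ}
    (hψ : ψ ∈ contDiffGroupoid ω 𝓘(ℂ)) :
    e.trans ψ ∈ IsManifold.maximalAtlas 𝓘(ℂ) ω S := by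
  intro e' he'
  obtain ⟨h1, h2⟩ := he e' he'
  constructor
  · rw [OpenPartialHomeomorph.trans_symm_eq_symm_trans_symm, OpenPartialHomeomorph.trans_assoc]
    exact StructureGroupoid.trans _ (StructureGroupoid.symm _ hψ) h1
  · rw [← OpenPartialHomeomorph.trans_assoc]
    exact StructureGroupoid.trans _ h2 hψ

/-- Composing a chart with a locally invertible holomorphic function. -/
lemma exists_chart_comp {e : OpenPartialHomeomorph S ℂ}
    (he : e ∈ IsManifold.maximalAtlas 𝓘(ℂ) ω S) {x₀ : S} (hx₀ : x₀ ∈ e.source) {ζ : ℂ → ℂ}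
    (hζ : AnalyticAt ℂ ζ (e x₀)) (hζ' : deriv ζ (e x₀) ≠ 0) {P : ℂ → Prop}
    (hP : ∀ᶠ z in 𝓝 (e x₀), P z) :
    ∃ e' ∈ IsManifold.maximalAtlas 𝓘(ℂ) ω S, x₀ ∈ e'.source ∧ ∀ x ∈ e'.source,
      x ∈ e.source ∧ P (e x) ∧ e' x = ζ (e x) ∧ deriv ζ (e x) ≠ 0 ∧
        HasDerivAt (fun w => e (e'.symm w)) (deriv ζ (e x))⁻¹ (e' x) := by
  have hstrict := (hζ.hasStrictDerivAt).hasStrictFDerivAt_equiv hζ'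
  set ψ := hstrict.toOpenPartialHomeomorph ζ with hψdef
  have hψ : (ψ : ℂ → ℂ) = ζ := rfl
  have hev : ∀ᶠ z in 𝓝 (e x₀), P z ∧ AnalyticAt ℂ ζ z ∧ deriv ζ z ≠ 0 :=
    hP.and (hζ.eventually_analyticAt.and (hζ.deriv.continuousAt.eventually_ne hζ'))
  obtain ⟨W, hWsub, hWo, hxW⟩ := _root_.mem_nhds_iff.1 hev
  set ψ' := ψ.restrOpen W hWo with hψ'def
  have hsrc : ∀ z ∈ ψ'.source, P z ∧ AnalyticAt ℂ ζ z ∧ deriv ζ z ≠ 0 := fun z hz => hWsub hz.2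
  have hsymm : ∀ w ∈ ψ'.target, ContDiffAt ℂ ω ψ'.symm w := by
    intro w hw
    obtain ⟨-, h1, h2⟩ := hsrc _ (ψ'.map_target hw)
    exact ψ'.contDiffAt_symm_deriv h2 hw h1.differentiableAt.hasDerivAt h1.contDiffAt
  have hgr : ψ' ∈ contDiffGroupoid ω 𝓘(ℂ) := by
    rw [contDiffGroupoid, mem_groupoid_of_pregroupoid]
    simp only [contDiffPregroupoid, modelWithCornersSelf_coe, modelWithCornersSelf_coe_symm,
      Set.range_id, Set.inter_univ, Function.comp_id, Function.id_comp, Set.preimage_id_eq, id_eq]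
    exact ⟨fun z hz => (hsrc z hz).2.1.contDiffAt.contDiffWithinAt,
      fun w hw => (hsymm w hw).contDiffWithinAt⟩
  refine ⟨e.trans ψ', mem_maximalAtlas_trans he hgr, ?_, ?_⟩
  · rw [OpenPartialHomeomorph.trans_source]
    exact ⟨hx₀, hstrict.mem_toOpenPartialHomeomorph_source, hxW⟩
  · intro x hx
    rw [OpenPartialHomeomorph.trans_source] at hx
    obtain ⟨h0, h1, h2⟩ := hsrc _ hx.2
    refine ⟨hx.1, h0, rfl, h2, ?_⟩
    have hx' : ψ' (e x) ∈ ψ'.target := ψ'.map_source hx.2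
    have hs : ψ'.symm (ψ' (e x)) = e x := ψ'.left_inv hx.2
    have hder : HasDerivAt ψ'.symm (deriv ζ (e x))⁻¹ (ψ' (e x)) := by
      refine ψ'.hasDerivAt_symm hx' h2 ?_
      rw [hs]
      exact h1.differentiableAt.hasDerivAt
    refine HasDerivAt.congr_of_eventuallyEq hder ?_
    have hn : (e.trans ψ').target ∈ 𝓝 (ψ' (e x)) :=
      (e.trans ψ').open_target.mem_nhds ((e.trans ψ').map_source
        (by rw [OpenPartialHomeomorph.trans_source]; exact hx))
    filter_upwards [hn] with w hw
    rw [OpenPartialHomeomorph.trans_target] at hw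
    exact e.right_inv hw.2

lemma IsSymplecticFrame.hasMatDeriv {f : S → Q3} {e : OpenPartialHomeomorph S ℂ}
    {A : ℂ → Matrix Idx Idx ℂ} (hA : IsSymplecticFrame f e A) {z : ℂ} (hz : z ∈ e.target) :
    HasMatDeriv A (A z * mc A z) z :=
  hasMatDeriv_mc (hA.mem z hz) fun i j =>
    (hA.holo i j).differentiableAt (e.open_target.mem_nhds hz)

/-- The six linear equations of a reduced frame cut the ten-dimensional algebra 𝔰𝔭(2, ℂ) down to
four parameters. -/
lemma IsReducedFrame.mc_eq_redMat {f : S → Q3} {e : OpenPartialHomeomorph S ℂ}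
    {A : ℂ → Matrix Idx Idx ℂ} (hA : IsReducedFrame f e A) {z : ℂ} (hz : z ∈ e.target) :
    mc A z = redMat (mc A z i4 i2) (mc A z i2 i2) (mc A z i2 i4) (mc A z i1 i3) := by
  have hlie := mc_mem_lie (A := A) (z := z)
    (Filter.eventually_of_mem (e.open_target.mem_nhds hz) hA.mem)
    fun i j => (hA.holo i j).differentiableAt (e.open_target.mem_nhds hz)
  have ent : ∀ i j, ((mc A z).transpose * Matrix.J (Fin 2) ℂ + Matrix.J (Fin 2) ℂ * mc A z) i j
      = 0 := fun i j => by rw [hlie]; rfl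
  have h31 := hA.phi31 z hz
  have h41 := hA.phi41 z hz
  have h21 := hA.phi21 z hz
  have h11 := hA.phi11 z hz
  have h12 := hA.phi12 z hz
  have h14 := hA.phi14 z hz
  -- The matrix φᵀJ + Jφ is antisymmetric, so the entries above the diagonal carry all the
  -- relations.
  have e1 := ent i1 i2
  have e2 := ent i1 i3
  have e3 := ent i1 i4
  have e4 := ent i2 i3
  have e5 := ent i2 i4
  have e6 := ent i3 i4
  simp [Matrix.J, Matrix.mul_apply, Fintype.sum_sum_type, Matrix.one_apply]
    at e1 e2 e3 e4 e5 e6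
  ext i j
  rcases i with i | i <;> rcases j with j | j <;> fin_cases i <;> fin_cases j <;>
    simp [redMat]
  · exact h11
  · linear_combination h12 / 4
  · exact h21
  · exact h14
  · linear_combination h14 - e6
  · exact h31
  · linear_combination h41 - e1
  · exact h41
  · linear_combination -e2 - h11
  · linear_combination -e3 - h21
  · linear_combination -e4 - h12 / 4
  · linear_combination -e5

lemma IsReducedFrame.analyticAt_mc {f : S → Q3} {e : OpenPartialHomeomorph S ℂ}
    {A : ℂ → Matrix Idx Idx ℂ} (hA : IsReducedFrame f e A) {z : ℂ} (hz : z ∈ e.target) (i j : Idx) :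
    AnalyticAt ℂ (fun w => mc A w i j) z := by
  have hent : ∀ i j, AnalyticAt ℂ (fun w => A w i j) z := fun i j =>
    (hA.holo i j).analyticAt (e.open_target.mem_nhds hz)
  have hJ : ∀ i j, AnalyticAt ℂ (fun w => (A w)⁻¹ i j) z := by
    intro i j
    -- The inverse of a symplectic matrix is -J Aᵀ J, linear in the entries of A.
    have h1 : AnalyticAt ℂ (fun w => (-(Matrix.J (Fin 2) ℂ) * (A w).transpose *
        Matrix.J (Fin 2) ℂ) i j) z := by
      simp only [Matrix.mul_apply, Matrix.neg_apply, Matrix.transpose_apply]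
      refine Finset.analyticAt_fun_sum _ fun k _ => ?_
      refine AnalyticAt.mul ?_ analyticAt_const
      refine Finset.analyticAt_fun_sum _ fun l _ => ?_
      exact analyticAt_const.mul (hent k l)
    refine h1.congr ?_
    filter_upwards [e.open_target.mem_nhds hz] with w hw
    exact congrFun (congrFun
      (SymplecticGroup.inv_eq_symplectic_inv _ (hA.mem w hw)).symm i) j
  simp only [mc, Matrix.mul_apply, Matrix.of_apply]
  exact Finset.analyticAt_fun_sum _ fun k _ => (hJ i k).mul (hent k j).deriv

lemma span_gauge_columns (A : Matrix Idx Idx ℂ) {a : ℂ} (b : ℂ) (ha : a ≠ 0) :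
    Submodule.span ℂ {(A * gauge a b).transpose i1, (A * gauge a b).transpose i2}
      = Submodule.span ℂ {A.transpose i1, A.transpose i2} := by
  have h1 : (A * gauge a b).transpose i1 = a ^ 3 • A.transpose i1 := by
    ext k
    simp [gauge, Matrix.mul_apply, Fintype.sum_sum_type, Fin.sum_univ_two, mul_comm]
  have h2 : (A * gauge a b).transpose i2
      = (3 / 4 * b * a ^ 3) • A.transpose i1 + a • A.transpose i2 := by
    ext k
    simp [gauge, Matrix.mul_apply, Fintype.sum_sum_type, Fin.sum_univ_two, mul_comm]
  rw [h1, h2]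
  apply le_antisymm
  · rw [Submodule.span_le, Set.insert_subset_iff, Set.singleton_subset_iff]
    exact ⟨Submodule.mem_span_pair.2 ⟨a ^ 3, 0, by simp⟩,
      Submodule.mem_span_pair.2 ⟨_, _, rfl⟩⟩
  · rw [Submodule.span_le, Set.insert_subset_iff, Set.singleton_subset_iff]
    refine ⟨Submodule.mem_span_pair.2 ⟨(a ^ 3)⁻¹, 0, ?_⟩,
      Submodule.mem_span_pair.2 ⟨-(3 / 4 * b) * a⁻¹, a⁻¹, ?_⟩⟩
    · rw [zero_smul, add_zero, smul_smul, inv_mul_cancel₀ (pow_ne_zero 3 ha), one_smul]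
    · ext k
      simp only [Pi.add_apply, Pi.smul_apply, smul_eq_mul]
      field_simp
      ring

/-- Change of coordinate and of reduced frame. -/
lemma IsReducedFrame.exists_regauge {f : S → Q3} {e : OpenPartialHomeomorph S ℂ}
    {A : ℂ → Matrix Idx Idx ℂ} (hA : IsReducedFrame f e A) {x₀ : S} (hx₀ : x₀ ∈ e.source)
    {ζ a b : ℂ → ℂ} (hζ : AnalyticAt ℂ ζ (e x₀)) (hζ' : deriv ζ (e x₀) ≠ 0)
    (ha : AnalyticAt ℂ a (e x₀)) (ha0 : a (e x₀) ≠ 0) (hb : AnalyticAt ℂ b (e x₀))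
    {P : ℂ → Prop} (hP : ∀ᶠ z in 𝓝 (e x₀), P z) :
    ∃ e' A', IsReducedFrame f e' A' ∧ x₀ ∈ e'.source ∧ ∀ x ∈ e'.source,
      x ∈ e.source ∧ P (e x) ∧ e' x = ζ (e x) ∧ deriv ζ (e x) ≠ 0 ∧ a (e x) ≠ 0 ∧
        HasDerivAt (fun w => e (e'.symm w)) (deriv ζ (e x))⁻¹ (e' x) ∧
        mc A' (e' x) = (deriv ζ (e x))⁻¹ • redMat (a (e x) ^ 2 * mc A (e x) i4 i2)
          (deriv a (e x) / a (e x) + mc A (e x) i2 i2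
            - b (e x) * (a (e x) ^ 2 * mc A (e x) i4 i2) / 4)
          (mc A (e x) i2 i4 / a (e x) ^ 2
            + 2 * (mc A (e x) i2 i2 + deriv a (e x) / a (e x)) * b (e x)
            - b (e x) ^ 2 * (a (e x) ^ 2 * mc A (e x) i4 i2) / 4 + deriv b (e x))
          (mc A (e x) i1 i3 / a (e x) ^ 6) := by
  obtain ⟨e', he', hx', h⟩ := exists_chart_comp hA.chart hx₀ hζ hζ'
    (P := fun z => P z ∧ AnalyticAt ℂ a z ∧ AnalyticAt ℂ b z ∧ a z ≠ 0)
    (hP.and (ha.eventually_analyticAt.and (hb.eventually_analyticAt.and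
      (ha.continuousAt.eventually_ne ha0))))
  set A' : ℂ → Matrix Idx Idx ℂ := fun w =>
    A (e (e'.symm w)) * gauge (a (e (e'.symm w))) (b (e (e'.symm w))) with hA'
  have hmem : ∀ w ∈ e'.target, A' w ∈ Matrix.symplecticGroup (Fin 2) ℂ := by
    intro w hw
    have hx := e'.map_target hw
    obtain ⟨h1, ⟨-, -, -, h2⟩, -⟩ := h _ hx
    exact mul_mem (hA.mem _ (e.map_source h1)) (gauge_mem _ h2)
  have key : ∀ x ∈ e'.source, HasMatDeriv A' (A' (e' x) * ((deriv ζ (e x))⁻¹ •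
        redMat (a (e x) ^ 2 * mc A (e x) i4 i2)
          (deriv a (e x) / a (e x) + mc A (e x) i2 i2
            - b (e x) * (a (e x) ^ 2 * mc A (e x) i4 i2) / 4)
          (mc A (e x) i2 i4 / a (e x) ^ 2
            + 2 * (mc A (e x) i2 i2 + deriv a (e x) / a (e x)) * b (e x)
            - b (e x) ^ 2 * (a (e x) ^ 2 * mc A (e x) i4 i2) / 4 + deriv b (e x))
          (mc A (e x) i1 i3 / a (e x) ^ 6))) (e' x) := by
    intro x hx
    obtain ⟨h1, ⟨-, h2, h3, h4⟩, h5, h6, h7⟩ := h x hx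
    have hz := e.map_source h1
    have e1 := (hA.toIsSymplecticFrame.hasMatDeriv hz).mul
      (hasMatDeriv_gauge h2.differentiableAt.hasDerivAt h3.differentiableAt.hasDerivAt h4)
    rw [hA.mc_eq_redMat hz, Matrix.mul_assoc, ← Matrix.mul_add,
      redMat_mul_gauge _ _ _ _ _ _ _ h4, ← Matrix.mul_assoc] at e1
    have hl : e'.symm (e' x) = x := e'.left_inv hx
    have e2 := HasMatDeriv.comp (φ := fun w => e (e'.symm w)) (z := e' x)
      (c := (deriv ζ (e x))⁻¹) (M := fun w => A w * gauge (a w) (b w)) (by rw [hl]; exact e1) h7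
    rw [Matrix.mul_smul]
    simpa only [hA', hl] using e2
  have hmc := fun x hx => mc_eq (hmem _ (e'.map_source hx)) (key x hx)
  refine ⟨e', A', ?_, hx', fun x hx => ?_⟩
  · have hmc' : ∀ w ∈ e'.target, ∃ c p s r Q : ℂ, c ≠ 0 ∧ p ≠ 0 ∧
        mc A' w = c • redMat p s r Q := by
      intro w hw
      have hx := e'.map_target hw
      obtain ⟨h1, ⟨-, -, -, h4⟩, -, h6, -⟩ := h _ hx
      have := hmc _ hx
      rw [e'.right_inv hw] at this
      exact ⟨_, _, _, _, _, inv_ne_zero h6,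
        mul_ne_zero (pow_ne_zero 2 h4) (hA.phi42 _ (e.map_source h1)), this⟩
    refine ⟨⟨he', ?_, hmem, ?_⟩, ?_, ?_, ?_, ?_, ?_, ?_, ?_⟩
    · intro i j w hw
      have hx := e'.map_target hw
      have := key _ hx i j
      rw [e'.right_inv hw] at this
      exact this.differentiableAt.differentiableWithinAt
    · intro x hx
      obtain ⟨h1, ⟨-, -, -, h4⟩, -⟩ := h _ hx
      rw [hA.span x h1]
      simp only [hA', e'.left_inv hx]
      rw [span_gauge_columns _ _ h4]
    all_goals
      intro w hw
      obtain ⟨c, p, s, r, Q, hc, hp, hM⟩ := hmc' w hw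
      simp [hM, redMat]
    · ring
    · ring
    · exact ⟨hc, hp⟩
  · obtain ⟨h1, ⟨h2, -, -, h4⟩, h5, h6, h7⟩ := h x hx
    exact ⟨h1, h2, h5, h6, h4, h7, hmc x hx⟩

end Frames

/-! ### Normal frames and the computation of the bending -/

/-- The constant value of `φ⁴₂` on a flat frame. -/
def flatScale : ℂ := -((((6 : ℝ) ^ (-(1 / 3) : ℝ) : ℝ) : ℂ))⁻¹

lemma rpow_six_ne_zero : (((6 : ℝ) ^ (-(1 / 3) : ℝ) : ℝ) : ℂ) ≠ 0 :=
  Complex.ofReal_ne_zero.2 (Real.rpow_pos_of_pos (by norm_num) _).ne'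

lemma flatScale_ne_zero : flatScale ≠ 0 := neg_ne_zero.2 (inv_ne_zero rpow_six_ne_zero)

lemma rpow_six_mul_flatScale : (((6 : ℝ) ^ (-(1 / 3) : ℝ) : ℝ) : ℂ) * flatScale = -1 := by
  rw [flatScale, mul_neg, mul_inv_cancel₀ rpow_six_ne_zero]

lemma smul_redMat (c p s r Q : ℂ) :
    c • redMat p s r Q = redMat (c * p) (c * s) (c * r) (c * Q) := by
  ext i j
  rcases i with i | i <;> rcases j with j | j <;> fin_cases i <;> fin_cases j <;>
    simp [redMat] <;> ring

section Frames

variable {S : Type*} [TopologicalSpace S] [ChartedSpace ℂ S]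

/-- Reduced frames over a coordinate in which the quartic differential is `dz⁴`, normalized by
`φ²₂ = 0`. -/
structure IsNormalFrame (f : S → Q3) (e : OpenPartialHomeomorph S ℂ)
    (A : ℂ → Matrix Idx Idx ℂ) : Prop extends IsReducedFrame f e A where
  scale : ∀ z ∈ e.target, mc A z i4 i2 = flatScale
  diag : ∀ z ∈ e.target, mc A z i2 i2 = 0
  quartic : ∀ z ∈ e.target, mc A z i1 i3 * flatScale ^ 3 = 1

lemma IsGeneralType.exists_normalFrame {f : S → Q3} (hf : IsGeneralType f) :
    ∃ e A, IsNormalFrame f e A ∧ e.source.Nonempty := by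
  obtain ⟨e, A, hA, z₀, hz₀, hq⟩ := hf
  set x₀ := e.symm z₀ with hx₀def
  have hx₀ : x₀ ∈ e.source := e.map_target hz₀
  have hex : e x₀ = z₀ := e.right_inv hz₀
  have hp0 := flatScale_ne_zero
  have han := hA.analyticAt_mc hz₀
  have hqa : AnalyticAt ℂ (quarticCoeff A) z₀ := (han i1 i3).mul ((han i4 i2).pow 3)
  -- A fourth root k of the coefficient of δ; its primitive ζ satisfies δ = dζ⁴.
  obtain ⟨k, hk, hk0, hk4⟩ := exists_root hqa hq (n := 4) (by norm_num)
  obtain ⟨ζ, hζ, hζk⟩ := exists_primitive hk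
  have hpz := hA.phi42 z₀ hz₀
  -- This a makes a² φ⁴₂ = p k, so that dividing by ζ' = k leaves the constant p.
  obtain ⟨a, ha, ha0, ha2⟩ := exists_root (g := fun z => flatScale * k z / mc A z i4 i2)
    ((analyticAt_const.mul hk).div (han i4 i2) hpz)
    (div_ne_zero (mul_ne_zero hp0 hk0) hpz) (n := 2) (by norm_num)
  -- The solution of a'/a + φ²₂ - b a² φ⁴₂ / 4 = 0, which kills the new φ²₂.
  set b : ℂ → ℂ := fun z => 4 * (deriv a z / a z + mc A z i2 i2) / (a z ^ 2 * mc A z i4 i2)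
    with hb
  have hban : AnalyticAt ℂ b z₀ :=
    (analyticAt_const.mul ((ha.deriv.div ha ha0).add (han i2 i2))).div
      ((ha.pow 2).mul (han i4 i2)) (mul_ne_zero (pow_ne_zero 2 ha0) hpz)
  have hζ0 : deriv ζ z₀ ≠ 0 := by rw [hζk.self_of_nhds.deriv]; exact hk0
  obtain ⟨e', A', hA', hx', h⟩ := hA.exists_regauge (x₀ := x₀) hx₀ (ζ := ζ) (a := a) (b := b)
    (by rwa [hex]) (by rwa [hex]) (by rwa [hex]) (by rwa [hex]) (by rwa [hex])
    (P := fun z => deriv ζ z = k z)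
    (by rw [hex]; exact hζk.mono fun z hz => hz.deriv)
  have key : ∀ w ∈ e'.target, mc A' w i4 i2 = flatScale ∧ mc A' w i2 i2 = 0 ∧
      mc A' w i1 i3 * flatScale ^ 3 = 1 := by
    intro w hw
    have hx := e'.map_target hw
    obtain ⟨h1, h2, -, h4, h5, -, h7⟩ := h _ hx
    rw [e'.right_inv hw, h2] at h7
    rw [h2] at h4
    set z := e (e'.symm w)
    have hpz := hA.phi42 z (e.map_source h1)
    have e2 : a z ^ 2 * mc A z i4 i2 = flatScale * k z := by
      rw [ha2]; field_simp
    have e4 : k z ^ 4 = mc A z i1 i3 * mc A z i4 i2 ^ 3 := hk4 z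
    rw [h7]
    refine ⟨?_, ?_, ?_⟩
    · simp [redMat]
      rw [e2]; field_simp
    · simp [redMat, hb]
      right
      have : a z ^ 2 * mc A z i4 i2 ≠ 0 := mul_ne_zero (pow_ne_zero 2 h5) hpz
      field_simp
      ring
    · simp [redMat]
      have e6 : a z ^ 6 * mc A z i4 i2 ^ 3 = flatScale ^ 3 * k z ^ 3 := by
        rw [← mul_pow, ← e2]; ring
      field_simp
      have hp3 : mc A z i4 i2 ^ 3 ≠ 0 := pow_ne_zero 3 hpz
      apply mul_right_cancel₀ hp3
      linear_combination -flatScale ^ 3 * e4 - k z * e6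
  exact ⟨e', A', ⟨hA', fun w hw => (key w hw).1, fun w hw => (key w hw).2.1,
    fun w hw => (key w hw).2.2⟩, x₀, hx'⟩

-- Solve y'' = (p φ²₄/4) y with y = 1 at the point, and pass to the coordinate ζ with ζ' = y⁻². It
-- is projective, and in it δ has coefficient Z = y⁸, because δ = dz⁴. In 𝔡(δ) the terms in y'²
-- cancel (36 - 36), leaving 4 y³ y'' = p φ²₄ y⁴, whose square divided by y⁸ is (p φ²₄)².
set_option maxHeartbeats 1000000 in
lemma IsNormalFrame.isBendingAt {f : S → Q3} {e : OpenPartialHomeomorph S ℂ}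
    {A : ℂ → Matrix Idx Idx ℂ} (hA : IsNormalFrame f e A) {x₀ : S} (hx₀ : x₀ ∈ e.source) :
    IsBendingAt f x₀ ((flatScale * mc A (e x₀) i2 i4) ^ 2) := by
  have hz₀ := e.map_source hx₀
  have hp0 := flatScale_ne_zero
  have han := hA.toIsReducedFrame.analyticAt_mc hz₀
  obtain ⟨y, hy, hy1, hy2⟩ := exists_second_order_solution
    (t := fun z => flatScale * mc A z i2 i4 / 4)
    ((analyticAt_const.mul (han i2 i4)).div analyticAt_const (by norm_num))
  have hy0 : y (e x₀) ≠ 0 := by rw [hy1]; exact one_ne_zero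
  obtain ⟨ζ, hζ, hζk⟩ := exists_primitive ((hy.pow 2).inv (pow_ne_zero 2 hy0))
  -- Taking a = 1/y and ζ' = y⁻² keeps φ⁴₂ equal to p. The function b is forced by φ²₂ = 0, and the
  -- vanishing of the new φ²₄ is then exactly the equation for y.
  obtain ⟨e', A', hA', hx', h⟩ := hA.toIsReducedFrame.exists_regauge hx₀ (ζ := ζ)
    (a := fun z => (y z)⁻¹) (b := fun z => -4 * (deriv y z * y z) / flatScale) hζ
    (by rw [hζk.self_of_nhds.deriv]; exact inv_ne_zero (pow_ne_zero 2 hy0))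
    (hy.inv hy0) (inv_ne_zero hy0)
    ((analyticAt_const.mul (hy.deriv.mul hy)).div analyticAt_const hp0)
    (P := fun z => deriv ζ z = (y z ^ 2)⁻¹ ∧ AnalyticAt ℂ y z ∧
      deriv (deriv y) z = flatScale * mc A z i2 i4 / 4 * y z ∧ y z ≠ 0)
    ((hζk.mono fun z hz => hz.deriv).and (hy.eventually_analyticAt.and
      (hy2.and (hy.continuousAt.eventually_ne hy0))))
  have key : ∀ x ∈ e'.source, HasDerivAt (fun w => e (e'.symm w)) (y (e x) ^ 2) (e' x) ∧
      mc A' (e' x) = redMat flatScale 0 0 (y (e x) ^ 8 * mc A (e x) i1 i3) := by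
    intro x hx
    obtain ⟨h1, ⟨h2, hya, hyy, hyne⟩, -, -, -, h6, h7⟩ := h x hx
    rw [h2, inv_inv] at h6 h7
    refine ⟨h6, ?_⟩
    have hz := e.map_source h1
    have d1 : deriv (fun z => (y z)⁻¹) (e x) = -deriv y (e x) / y (e x) ^ 2 :=
      (hya.differentiableAt.hasDerivAt.inv hyne).deriv
    have d2 : deriv (fun z => -4 * (deriv y z * y z) / flatScale) (e x)
        = -4 * (deriv (deriv y) (e x) * y (e x) + deriv y (e x) * deriv y (e x)) / flatScale :=
      (((hya.deriv.differentiableAt.hasDerivAt.fun_mul hya.differentiableAt.hasDerivAt).const_mul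
        (-4)).div_const _).deriv
    rw [d1, d2, hA.scale _ hz, hA.diag _ hz, hyy] at h7
    rw [h7]
    set Y := y (e x)
    set Y' := deriv y (e x)
    rw [show Y⁻¹ ^ 2 * flatScale = flatScale / Y ^ 2 by field_simp]
    rw [show -Y' / Y ^ 2 / Y⁻¹ + 0 - -4 * (Y' * Y) / flatScale * (flatScale / Y ^ 2) / 4 = 0 by
      field_simp; ring]
    rw [show mc A (e x) i2 i4 / Y⁻¹ ^ 2 + 2 * (0 + -Y' / Y ^ 2 / Y⁻¹) *
        (-4 * (Y' * Y) / flatScale) - (-4 * (Y' * Y) / flatScale) ^ 2 * (flatScale / Y ^ 2) / 4 +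
        -4 * (flatScale * mc A (e x) i2 i4 / 4 * Y * Y + Y' * Y') / flatScale = 0 by
      field_simp; ring]
    rw [smul_redMat, mul_zero, show Y ^ 2 * (flatScale / Y ^ 2) = flatScale by field_simp,
      show Y ^ 2 * (mc A (e x) i1 i3 / Y⁻¹ ^ 6) = Y ^ 8 * mc A (e x) i1 i3 by field_simp]
  have hquart : ∀ x ∈ e'.source, quarticCoeff A' (e' x) = y (e x) ^ 8 := by
    intro x hx
    have hz := e.map_source (h x hx).1
    have hq := hA.quartic _ hz
    rw [quarticCoeff, (key x hx).2]
    simp only [redMat, Matrix.fromBlocks_apply₁₂, Matrix.fromBlocks_apply₂₁, Matrix.of_apply,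
      Matrix.cons_val_zero, Matrix.cons_val_one]
    linear_combination y (e x) ^ 8 * hq
  have hnhds : ∀ x ∈ e'.source, e'.target ∈ 𝓝 (e' x) :=
    fun x hx => e'.open_target.mem_nhds (e'.map_source hx)
  have hd1 : ∀ x ∈ e'.source,
      deriv (quarticCoeff A') (e' x) = 8 * y (e x) ^ 9 * deriv y (e x) := by
    intro x hx
    obtain ⟨h1, ⟨-, hya, -, -⟩, -⟩ := h x hx
    have hl : e'.symm (e' x) = x := e'.left_inv hx
    have hc : HasDerivAt (fun w => y (e (e'.symm w))) (deriv y (e x) * y (e x) ^ 2) (e' x) :=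
      HasDerivAt.comp (h₂ := y) (h := fun w => e (e'.symm w)) (e' x)
        (by rw [hl]; exact hya.differentiableAt.hasDerivAt) (key x hx).1
    have hp := hc.fun_pow 8
    rw [hl] at hp
    have he : quarticCoeff A' =ᶠ[𝓝 (e' x)] fun w => y (e (e'.symm w)) ^ 8 := by
      filter_upwards [hnhds x hx] with w hw
      have := hquart _ (e'.map_target hw)
      rwa [e'.right_inv hw] at this
    rw [he.deriv_eq, hp.deriv]
    push_cast
    ring
  have hd2 : deriv (deriv (quarticCoeff A')) (e' x₀) =
      72 * y (e x₀) ^ 10 * deriv y (e x₀) ^ 2 + 8 * y (e x₀) ^ 11 * deriv (deriv y) (e x₀) := by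
    obtain ⟨h1, ⟨-, hya, -, -⟩, -⟩ := h x₀ hx'
    have hl : e'.symm (e' x₀) = x₀ := e'.left_inv hx'
    have hc : HasDerivAt (fun w => 8 * y (e (e'.symm w)) ^ 9 * deriv y (e (e'.symm w)))
        ((8 * (9 * y (e x₀) ^ 8 * deriv y (e x₀)) * deriv y (e x₀)
          + 8 * y (e x₀) ^ 9 * deriv (deriv y) (e x₀)) * y (e x₀) ^ 2) (e' x₀) := by
      refine HasDerivAt.comp (h₂ := fun z => 8 * y z ^ 9 * deriv y z)
        (h := fun w => e (e'.symm w)) (e' x₀) ?_ (key x₀ hx').1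
      rw [hl]
      have := (((hya.differentiableAt.hasDerivAt.fun_pow 9).const_mul 8).fun_mul
        hya.deriv.differentiableAt.hasDerivAt)
      simpa using this
    have he : deriv (quarticCoeff A') =ᶠ[𝓝 (e' x₀)]
        fun w => 8 * y (e (e'.symm w)) ^ 9 * deriv y (e (e'.symm w)) := by
      filter_upwards [hnhds x₀ hx'] with w hw
      have := hd1 _ (e'.map_target hw)
      rwa [e'.right_inv hw] at this
    rw [he.deriv_eq, hc.deriv]
    ring
  refine ⟨e', A', ⟨hA', ?_⟩, hx', ?_, ?_⟩
  · intro w hw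
    have := (key _ (e'.map_target hw)).2
    rw [e'.right_inv hw] at this
    rw [cartanCoeff, this]
    have h6 := rpow_six_mul_flatScale
    generalize (((6 : ℝ) ^ (-(1 / 3) : ℝ) : ℝ) : ℂ) = c at h6 ⊢
    ext i j
    fin_cases i <;> fin_cases j <;> simp [redMat, h6]
  · rw [hquart _ hx', hy1]; norm_num
  · rw [frakD, hd2, hd1 _ hx', hquart _ hx', hy2.self_of_nhds, hy1]
    ring

end Frames

section Frames

variable {S : Type*} [TopologicalSpace S] [ChartedSpace ℂ S]

/-- Restricting a chart of the maximal atlas to a ball in its target. -/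
lemma exists_chart_ball {e : OpenPartialHomeomorph S ℂ}
    (he : e ∈ IsManifold.maximalAtlas 𝓘(ℂ) ω S) {z₀ : ℂ} {R : ℝ} (hR : ball z₀ R ⊆ e.target) :
    ∃ e' ∈ IsManifold.maximalAtlas 𝓘(ℂ) ω S, e'.target = ball z₀ R ∧ e'.source ⊆ e.source ∧
      (∀ x, e' x = e x) ∧ ∀ z, e'.symm z = e.symm z := by
  have ho : IsOpen (e.source ∩ e ⁻¹' ball z₀ R) := e.isOpen_inter_preimage isOpen_ball
  refine ⟨e.restr (e.source ∩ e ⁻¹' ball z₀ R), restr_mem_maximalAtlas _ he ho, ?_, ?_,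
    fun _ => rfl, fun _ => rfl⟩
  · ext z
    rw [e.restr_target, ho.interior_eq]
    constructor
    · rintro ⟨h1, h2, h3⟩
      rwa [Set.mem_preimage, e.right_inv h1] at h3
    · intro hz
      refine ⟨hR hz, e.map_target (hR hz), ?_⟩
      rwa [Set.mem_preimage, e.right_inv (hR hz)]
  · rw [e.restr_source]
    exact Set.inter_subset_left

/-- In a normal frame only φ²₄ can vary, and (p φ²₄)² = κ pins it down up to sign; continuity on a
disk fixes the sign. The scaling T = p φ²₄ / 4 is the one that gives the characteristic polynomial
integral coefficients in T. -/
lemma HasConstantBending.exists_constant_frame {f : S → Q3} {κ : ℂ}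
    (hf : HasConstantBending f κ) :
    ∃ e A, IsSymplecticFrame f e A ∧ e.source.Nonempty ∧ (∃ z₀ R, e.target = ball z₀ R) ∧
      ∃ T : ℂ, 16 * T ^ 2 = κ ∧
        ∀ z ∈ e.target, mc A z = redMat flatScale 0 (4 * T / flatScale) (flatScale ^ 3)⁻¹ := by
  obtain ⟨e, A, hA, x₀, hx₀⟩ := hf.1.exists_normalFrame
  have hp0 := flatScale_ne_zero
  obtain ⟨R, hR, hball⟩ := Metric.isOpen_iff.1 e.open_target _ (e.map_source hx₀)
  have hr : ∀ z ∈ ball (e x₀) R, (flatScale * mc A z i2 i4) ^ 2 = κ := by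
    intro z hz
    have h := hA.isBendingAt (e.map_target (hball hz))
    rw [e.right_inv (hball hz)] at h
    exact hf.2 _ _ h
  have hcont : ContinuousOn (fun z => flatScale * mc A z i2 i4) (ball (e x₀) R) := fun z hz =>
    (analyticAt_const.mul
      (hA.toIsReducedFrame.analyticAt_mc (hball hz) i2 i4)).continuousAt.continuousWithinAt
  have hconst : ∀ z ∈ ball (e x₀) R,
      flatScale * mc A z i2 i4 = flatScale * mc A (e x₀) i2 i4 := by
    intro z hz
    have hx := mem_ball_self (x := e x₀) hR
    have hpre : IsPreconnected (ball (e x₀) R) := (convex_ball _ _).isPreconnected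
    by_cases h0 : flatScale * mc A (e x₀) i2 i4 = 0
    · rw [h0]
      have := hr z hz
      rw [← hr _ hx, h0] at this
      exact pow_eq_zero_iff two_ne_zero |>.1 (by rw [this]; ring)
    -- The alternative with the opposite sign fails at the center, where the value is nonzero.
    · rcases hpre.eq_or_eq_neg_of_sq_eq hcont (g := fun _ => flatScale * mc A (e x₀) i2 i4)
        continuousOn_const (fun w hw => by
          simp only [Pi.pow_apply]
          rw [hr w hw, hr _ hx]) (fun _ => h0) with h | h
      · exact h hz
      · exfalso
        have := h hx
        simp only [Pi.neg_apply] at this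
        exact h0 (self_eq_neg.1 this)
  obtain ⟨e', he', ht, hs, h1, h2⟩ := exists_chart_ball hA.chart hball
  have hsub : e'.target ⊆ e.target := by rw [ht]; exact hball
  refine ⟨e', A, ⟨he', fun i j => (hA.holo i j).mono hsub, fun z hz => hA.mem z (hsub hz),
    fun x hx => ?_⟩, ?_, ⟨_, _, ht⟩, flatScale * mc A (e x₀) i2 i4 / 4, ?_, ?_⟩
  · rw [h1]; exact hA.span x (hs hx)
  · have : e x₀ ∈ e'.target := by rw [ht]; exact mem_ball_self hR
    exact ⟨_, e'.map_target this⟩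
  · rw [← hr _ (mem_ball_self hR)]; ring
  · intro z hz
    have hz' := hsub hz
    rw [ht] at hz
    rw [hA.mc_eq_redMat hz', hA.scale z hz', hA.diag z hz',
      mul_left_cancel₀ hp0 (hconst z hz)]
    congr 1
    · field_simp
    · have := hA.quartic z hz'
      field_simp
      exact this

end Frames

/-! ### Solutions of the system with constant coefficients -/

lemma hasDerivAt_mulVec {A : ℂ → Matrix Idx Idx ℂ} {A' : Matrix Idx Idx ℂ} {v : ℂ → Idx → ℂ}
    {v' : Idx → ℂ} {z : ℂ} (hA : HasMatDeriv A A' z)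
    (hv : ∀ i, HasDerivAt (fun w => v w i) (v' i) z) (i : Idx) :
    HasDerivAt (fun w => (A w).mulVec (v w) i) ((A'.mulVec (v z) + (A z).mulVec v') i) z := by
  simp only [Matrix.mulVec, dotProduct, Pi.add_apply, ← Finset.sum_add_distrib]
  exact HasDerivAt.fun_sum fun k _ => (hA i k).mul (hv k)

/-- With u = v' - z v one has M u + u' = l u, so e^{-lz} A u has zero derivative. The case v = 0 is
that of an eigenvector v'; otherwise (v, v') is a Jordan chain. -/
lemma exists_const_vector {A : ℂ → Matrix Idx Idx ℂ} {M : Matrix Idx Idx ℂ} {z₀ : ℂ} {R : ℝ}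
    (hA : ∀ z ∈ ball z₀ R, HasMatDeriv A (A z * M) z) {l : ℂ} {v v' : Idx → ℂ}
    (hv : M.mulVec v = l • v) (hv' : M.mulVec v' = l • v' + v) :
    ∃ c : Idx → ℂ, ∀ z ∈ ball z₀ R, (A z).mulVec (v' - z • v) = Complex.exp (l * z) • c := by
  have hd : ∀ z ∈ ball z₀ R, ∀ i, HasDerivAt
      (fun w => Complex.exp (-l * w) * (A w).mulVec (v' - w • v) i) 0 z := by
    intro z hz i
    have h1 : ∀ i, HasDerivAt (fun w : ℂ => (v' - w • v) i) ((-v) i) z := by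
      intro i
      simpa using ((hasDerivAt_id z).mul_const (v i)).const_sub (v' i)
    have h2 := hasDerivAt_mulVec (hA z hz) h1 i
    have h3 : HasDerivAt (fun w : ℂ => Complex.exp (-l * w)) (Complex.exp (-l * z) * (-l)) z := by
      simpa using ((hasDerivAt_id z).const_mul (-l)).cexp
    refine (h3.fun_mul h2).congr_deriv ?_
    have e : M.mulVec (v' - z • v) + -v = l • (v' - z • v) := by
      rw [Matrix.mulVec_sub, Matrix.mulVec_smul, hv, hv', smul_sub, smul_comm]; abel
    rw [← Matrix.mulVec_mulVec, ← Matrix.mulVec_add, e, Matrix.mulVec_smul]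
    simp only [Pi.smul_apply, smul_eq_mul]
    ring
  refine ⟨fun i => Complex.exp (-l * z₀) * (A z₀).mulVec (v' - z₀ • v) i, fun z hz => ?_⟩
  have hR : z₀ ∈ ball z₀ R := mem_ball_self (dist_nonneg.trans_lt hz)
  ext i
  have hc := (convex_ball z₀ R).is_const_of_fderivWithin_eq_zero (𝕜 := ℂ)
    (f := fun w => Complex.exp (-l * w) * (A w).mulVec (v' - w • v) i)
    (fun w hw => (hd w hw i).differentiableAt.differentiableWithinAt)
    (fun w hw => by
      rw [fderivWithin_of_isOpen isOpen_ball hw]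
      have := (hd w hw i).hasFDerivAt.fderiv
      rw [this]; ext; simp) hR hz
  simp only [Pi.smul_apply, smul_eq_mul]
  rw [hc, ← mul_assoc, ← Complex.exp_add]
  simp

/-! ### Meromorphic functions on a Riemann surface -/

lemma tendsto_chart_punctured {S : Type*} [TopologicalSpace S] (e : OpenPartialHomeomorph S ℂ)
    {p : S} (hp : p ∈ e.source) : Tendsto e (𝓝[≠] p) (𝓝[≠] (e p)) := by
  refine tendsto_nhdsWithin_iff.2
    ⟨(e.continuousAt hp).tendsto.mono_left nhdsWithin_le_nhds, ?_⟩
  filter_upwards [self_mem_nhdsWithin, nhdsWithin_le_nhds (e.open_source.mem_nhds hp)]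
    with x hx hxs h
  exact hx (e.injOn hxs hp h)

lemma tendsto_chart_symm_punctured {S : Type*} [TopologicalSpace S]
    (e : OpenPartialHomeomorph S ℂ) {p : S} (hp : p ∈ e.source) :
    Tendsto e.symm (𝓝[≠] (e p)) (𝓝[≠] p) := by
  refine tendsto_nhdsWithin_iff.2 ⟨?_, ?_⟩
  · have := (e.symm.continuousAt (e.map_source hp)).tendsto
    rw [e.left_inv hp] at this
    exact this.mono_left nhdsWithin_le_nhds
  · filter_upwards [self_mem_nhdsWithin,
      nhdsWithin_le_nhds (e.open_target.mem_nhds (e.map_source hp))] with z hz hzt h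
    exact hz (by rw [Set.mem_singleton_iff, ← e.right_inv hzt, h])

lemma eventually_chart_iff {S : Type*} [TopologicalSpace S] (e : OpenPartialHomeomorph S ℂ)
    {p : S} (hp : p ∈ e.source) {P : ℂ → Prop} :
    (∀ᶠ x in 𝓝[≠] p, P (e x)) ↔ ∀ᶠ z in 𝓝[≠] (e p), P z := by
  refine ⟨fun h => ?_, fun h => (tendsto_chart_punctured e hp).eventually h⟩
  filter_upwards [(tendsto_chart_symm_punctured e hp).eventually h,
    nhdsWithin_le_nhds (e.open_target.mem_nhds (e.map_source hp))] with z hz hzt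
  rwa [e.right_inv hzt] at hz

lemma eventually_chart_symm_iff {S : Type*} [TopologicalSpace S] (e : OpenPartialHomeomorph S ℂ)
    {p : S} (hp : p ∈ e.source) {P : S → Prop} :
    (∀ᶠ z in 𝓝[≠] (e p), P (e.symm z)) ↔ ∀ᶠ x in 𝓝[≠] p, P x := by
  refine ⟨fun h => ?_, fun h => (tendsto_chart_symm_punctured e hp).eventually h⟩
  filter_upwards [(tendsto_chart_punctured e hp).eventually h,
    nhdsWithin_le_nhds (e.open_source.mem_nhds hp)] with x hx hxs
  rwa [e.left_inv hxs] at hx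

lemma punctured_neBot {S : Type*} [TopologicalSpace S] [ChartedSpace ℂ S] (p : S) :
    (𝓝[≠] p).NeBot :=
  (tendsto_chart_symm_punctured (chartAt ℂ p) (mem_chart_source ℂ p)).neBot

section

variable {S : Type*} [TopologicalSpace S] [ChartedSpace ℂ S]

lemma analyticAt_transition {e e' : OpenPartialHomeomorph S ℂ}
    (he : e ∈ IsManifold.maximalAtlas 𝓘(ℂ) ω S) (he' : e' ∈ IsManifold.maximalAtlas 𝓘(ℂ) ω S)
    {z : ℂ} (hz : z ∈ e.target) (hz' : e.symm z ∈ e'.source) :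
    AnalyticAt ℂ (fun w => e' (e.symm w)) z := by
  have h := StructureGroupoid.compatible_of_mem_maximalAtlas he he'
  rw [contDiffGroupoid, mem_groupoid_of_pregroupoid] at h
  simp only [contDiffPregroupoid, modelWithCornersSelf_coe, modelWithCornersSelf_coe_symm,
    Set.range_id, Set.inter_univ, Function.comp_id, Function.id_comp, Set.preimage_id_eq,
    id_eq] at h
  have hs : z ∈ (e.symm.trans e').source := by
    rw [OpenPartialHomeomorph.trans_source]; exact ⟨hz, hz'⟩
  exact ((h.1.contDiffAt ((e.symm.trans e').open_source.mem_nhds hs)).analyticAt)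

/-- The identity principle for conditions expressed by meromorphic functions of a local
coordinate. -/
lemma eventually_of_meromorphic_condition [PreconnectedSpace S] {R : S → Prop}
    (hR : ∀ p, ∃ e ∈ IsManifold.maximalAtlas 𝓘(ℂ) ω S, p ∈ e.source ∧ ∃ (n : ℕ) (G : Fin n → ℂ → ℂ),
      (∀ i, MeromorphicOn (G i) e.target) ∧
        ∀ q ∈ e.source, ∀ᶠ x in 𝓝[≠] q, (R x ↔ ∀ i, G i (e x) = 0))
    (h0 : ∃ p, ∀ᶠ x in 𝓝[≠] p, R x) (p : S) : ∀ᶠ x in 𝓝[≠] p, R x := by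
  -- The condition near q says that each G i has infinite order at q, and infinite order propagates
  -- over a connected disk.
  have key : ∀ p, ∀ᶠ q in 𝓝 p, ((∀ᶠ x in 𝓝[≠] q, R x) ↔ ∀ᶠ x in 𝓝[≠] p, R x) := by
    intro p
    obtain ⟨e, -, hp, n, G, hG, hRG⟩ := hR p
    obtain ⟨r, hr, hball⟩ := Metric.isOpen_iff.1 e.open_target _ (e.map_source hp)
    have hgood : ∀ q ∈ e.source,
        ((∀ᶠ x in 𝓝[≠] q, R x) ↔ ∀ i, meromorphicOrderAt (G i) (e q) = ⊤) := by
      intro q hq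
      rw [eventually_congr (hRG q hq), eventually_all]
      refine forall_congr' fun i => ?_
      rw [eventually_chart_iff e hq (P := fun z => G i z = 0), meromorphicOrderAt_eq_top_iff]
    have hmem := e.continuousAt hp (ball_mem_nhds (e p) hr)
    filter_upwards [hmem, e.open_source.mem_nhds hp] with q hq hqs
    rw [hgood q hqs, hgood p hp]
    refine forall_congr' fun i => ?_
    have hm := (hG i).mono_set hball
    have hc : IsPreconnected (ball (e p) r) := (convex_ball _ _).isPreconnected
    constructor
    · intro h; by_contra h'
      exact hm.meromorphicOrderAt_ne_top_of_isPreconnected hc (mem_ball_self hr) hq h' h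
    · intro h; by_contra h'
      exact hm.meromorphicOrderAt_ne_top_of_isPreconnected hc hq (mem_ball_self hr) h' h
  -- The choices Q = `True` and Q = `False` give openness of the set and of its complement.
  have hopen : ∀ Q : Prop, IsOpen {p : S | (∀ᶠ x in 𝓝[≠] p, R x) ↔ Q} := by
    intro Q
    rw [isOpen_iff_mem_nhds]
    intro p hp
    filter_upwards [key p] with q hq
    exact hq.trans hp
  have hclopen : IsClopen {p : S | ∀ᶠ x in 𝓝[≠] p, R x} := by
    constructor
    · rw [← isOpen_compl_iff]
      convert hopen False using 1
      ext p; simp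
    · convert hopen True using 1
      ext p; simp
  rcases isClopen_iff.1 hclopen with h | h
  · obtain ⟨p₀, hp₀⟩ := h0
    exact absurd (show p₀ ∈ {p : S | ∀ᶠ x in 𝓝[≠] p, R x} from hp₀) (by rw [h]; simp)
  · exact (show p ∈ {p : S | ∀ᶠ x in 𝓝[≠] p, R x} by rw [h]; trivial)

/-- Meromorphic functions on a Riemann surface, with arbitrary values at a discrete set. -/
def IsMero (F : S → ℂ) : Prop :=
  ∀ e ∈ IsManifold.maximalAtlas 𝓘(ℂ) ω S, MeromorphicOn (fun z => F (e.symm z)) e.target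

lemma IsMero.of_local {F : S → ℂ} (h : ∀ p, ∃ e ∈ IsManifold.maximalAtlas 𝓘(ℂ) ω S,
    p ∈ e.source ∧ MeromorphicAt (fun z => F (e.symm z)) (e p)) : IsMero F := by
  intro e he z hz
  obtain ⟨e', he', hp, hm⟩ := h (e.symm z)
  have h1 : MeromorphicAt ((fun z => F (e'.symm z)) ∘ fun w => e' (e.symm w)) z :=
    MeromorphicAt.comp_analyticAt (f := fun z => F (e'.symm z)) (g := fun w => e' (e.symm w)) hm
      (analyticAt_transition he he' hz hp)
  refine h1.congr ?_
  have hn : ∀ᶠ w in 𝓝 z, e.symm w ∈ e'.source :=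
    (e.symm.continuousAt hz).eventually (e'.open_source.mem_nhds hp)
  filter_upwards [nhdsWithin_le_nhds hn] with w hw
  simp [e'.left_inv hw]

lemma IsMero.const (c : ℂ) : IsMero (fun _ : S => c) := fun _ _ => MeromorphicOn.const c

lemma IsMero.mul {F G : S → ℂ} (hF : IsMero F) (hG : IsMero G) :
    IsMero (fun x => F x * G x) := fun e he => (hF e he).fun_mul (hG e he)

lemma IsMero.zpow {F : S → ℂ} (hF : IsMero F) (n : ℤ) :
    IsMero (fun x => F x ^ n) := fun e he => (hF e he).fun_zpow n

lemma IsMero.eventually_eq_of_eventually_eq [IsManifold 𝓘(ℂ) ω S] [PreconnectedSpace S]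
    {F : S → ℂ} (hF : IsMero F) {c : ℂ}
    (h0 : ∃ p, ∀ᶠ x in 𝓝[≠] p, F x = c) (p : S) : ∀ᶠ x in 𝓝[≠] p, F x = c := by
  refine eventually_of_meromorphic_condition (fun p => ?_) h0 p
  refine ⟨chartAt ℂ p, IsManifold.chart_mem_maximalAtlas p, mem_chart_source ℂ p, 1,
    fun _ z => F ((chartAt ℂ p).symm z) - c, fun _ =>
    (hF _ (IsManifold.chart_mem_maximalAtlas p)).fun_sub (MeromorphicOn.const c), fun q hq => ?_⟩
  filter_upwards [nhdsWithin_le_nhds ((chartAt ℂ p).open_source.mem_nhds hq)] with x hx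
  simp [(chartAt ℂ p).left_inv hx, sub_eq_zero]

/-- The identity principle for a linear relation between the differentials of two meromorphic
functions. -/
lemma IsMero.differential_relation [IsManifold 𝓘(ℂ) ω S] [PreconnectedSpace S]
    {F₁ F₂ a b : S → ℂ} (h₁ : IsMero F₁) (h₂ : IsMero F₂) (ha : IsMero a) (hb : IsMero b)
    {e : OpenPartialHomeomorph S ℂ} (he : e ∈ IsManifold.maximalAtlas 𝓘(ℂ) ω S)
    (hne : e.source.Nonempty)
    (hrel : ∀ z ∈ e.target, DifferentiableAt ℂ (fun z => F₁ (e.symm z)) z ∧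
      DifferentiableAt ℂ (fun z => F₂ (e.symm z)) z ∧
      a (e.symm z) * deriv (fun z => F₁ (e.symm z)) z
        + b (e.symm z) * deriv (fun z => F₂ (e.symm z)) z = 0)
    {e' : OpenPartialHomeomorph S ℂ} (he' : e' ∈ IsManifold.maximalAtlas 𝓘(ℂ) ω S) {p : S}
    (hp : p ∈ e'.source) :
    ∀ᶠ z in 𝓝[≠] (e' p), a (e'.symm z) * deriv (fun z => F₁ (e'.symm z)) z
        + b (e'.symm z) * deriv (fun z => F₂ (e'.symm z)) z = 0 := by
  set G : OpenPartialHomeomorph S ℂ → ℂ → ℂ := fun e z =>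
    a (e.symm z) * deriv (fun z => F₁ (e.symm z)) z
        + b (e.symm z) * deriv (fun z => F₂ (e.symm z)) z with hGdef
  have hG : ∀ e ∈ IsManifold.maximalAtlas 𝓘(ℂ) ω S, MeromorphicOn (G e) e.target := fun e he =>
    ((ha e he).fun_mul (h₁ e he).deriv).fun_add ((hb e he).fun_mul (h₂ e he).deriv)
  -- A change of coordinate multiplies both terms by the derivative of the transition map.
  have htrans : ∀ e ∈ IsManifold.maximalAtlas 𝓘(ℂ) ω S, ∀ e' ∈ IsManifold.maximalAtlas 𝓘(ℂ) ω S,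
      ∀ x ∈ e.source, x ∈ e'.source →
      DifferentiableAt ℂ (fun z => F₁ (e.symm z)) (e x) →
      DifferentiableAt ℂ (fun z => F₂ (e.symm z)) (e x) → G e (e x) = 0 → G e' (e' x) = 0 := by
    intro e he e' he' x hx hx' hd1 hd2 h0
    have hl : e'.symm (e' x) = x := e'.left_inv hx'
    have hτ := (analyticAt_transition he' he (e'.map_source hx')
      (by rw [hl]; exact hx)).differentiableAt.hasDerivAt
    have hchain : ∀ F : S → ℂ, DifferentiableAt ℂ (fun z => F (e.symm z)) (e x) →
        deriv (fun z => F (e'.symm z)) (e' x) =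
          deriv (fun z => F (e.symm z)) (e x) * deriv (fun w => e (e'.symm w)) (e' x) := by
      intro F hd
      have h1 := HasDerivAt.comp (h₂ := fun z => F (e.symm z)) (h := fun w => e (e'.symm w))
        (e' x) (by rw [hl]; exact hd.hasDerivAt) hτ
      rw [← h1.deriv]
      refine Filter.EventuallyEq.deriv_eq ?_
      have hn : ∀ᶠ w in 𝓝 (e' x), e'.symm w ∈ e.source :=
        (e'.symm.continuousAt (e'.map_source hx')).eventually
          (e.open_source.mem_nhds (by rw [hl]; exact hx))
      filter_upwards [hn] with w hw
      simp [e.left_inv hw]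
    simp only [hGdef] at h0 ⊢
    rw [hchain F₁ hd1, hchain F₂ hd2, hl]
    rw [e.left_inv hx] at h0
    linear_combination deriv (fun w => e (e'.symm w)) (e' x) * h0
  have hdiff : ∀ F : S → ℂ, IsMero F → ∀ e ∈ IsManifold.maximalAtlas 𝓘(ℂ) ω S, ∀ x ∈ e.source,
      ∀ᶠ y in 𝓝[≠] x, DifferentiableAt ℂ (fun z => F (e.symm z)) (e y) := by
    intro F hF e he x hx
    refine (eventually_chart_iff e hx
      (P := fun z => DifferentiableAt ℂ (fun z => F (e.symm z)) z)).2 ?_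
    filter_upwards [(hF e he _ (e.map_source hx)).eventually_analyticAt] with z hz
    exact hz.differentiableAt
  -- Quantifying over all coordinates makes the condition independent of the chart, so that it can
  -- be continued along S.
  have hev := eventually_of_meromorphic_condition
    (R := fun x => ∀ e ∈ IsManifold.maximalAtlas 𝓘(ℂ) ω S, x ∈ e.source → G e (e x) = 0)
    (fun p => ⟨chartAt ℂ p, IsManifold.chart_mem_maximalAtlas p, mem_chart_source ℂ p, 1,
      fun _ => G (chartAt ℂ p), fun _ => hG _ (IsManifold.chart_mem_maximalAtlas p),
      fun q hq => by
        have hc := IsManifold.chart_mem_maximalAtlas (I := 𝓘(ℂ)) (n := ω) p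
        filter_upwards [hdiff _ h₁ _ hc q hq, hdiff _ h₂ _ hc q hq,
          nhdsWithin_le_nhds ((chartAt ℂ p).open_source.mem_nhds hq)] with x hx1 hx2 hxs
        exact ⟨fun h _ => h _ hc hxs, fun h e he hxe => htrans _ hc _ he x hxs hxe hx1 hx2 (h 0)⟩⟩)
    ?_ p
  · refine (eventually_chart_iff e' hp (P := fun z => G e' z = 0)).1 ?_
    filter_upwards [hev, nhdsWithin_le_nhds (e'.open_source.mem_nhds hp)] with x hx hxs
    exact hx _ he' hxs
  · obtain ⟨x₀, hx₀⟩ := hne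
    refine ⟨x₀, ?_⟩
    filter_upwards [nhdsWithin_le_nhds (e.open_source.mem_nhds hx₀)] with x hx e'' he'' hx''
    obtain ⟨hd1, hd2, h⟩ := hrel _ (e.map_source hx)
    exact htrans _ he _ he'' x hx hx'' hd1 hd2 h

end

/-! ### Logarithmic derivatives -/

/-- A nonzero order n drops to n - 1 ≠ -1 under differentiation; a function of order 0 extends
analytically, and so does its derivative. -/
lemma meromorphicOrderAt_deriv_ne_neg_one {g : ℂ → ℂ} {z : ℂ} (hg : MeromorphicAt g z) :
    meromorphicOrderAt (deriv g) z ≠ -1 := by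
  intro h
  by_cases htop : meromorphicOrderAt g z = ⊤
  · rw [meromorphicOrderAt_eq_top_iff] at htop
    have : deriv g =ᶠ[𝓝[≠] z] deriv (fun _ => (0 : ℂ)) :=
      Filter.EventuallyEq.nhdsNE_deriv (f₁ := g) (f := fun _ => 0) htop
    rw [meromorphicOrderAt_congr this] at h
    have h0 : meromorphicOrderAt (deriv fun _ : ℂ => (0 : ℂ)) z = ⊤ :=
      meromorphicOrderAt_eq_top_iff.2 (by simp)
    rw [h0] at h
    exact absurd h (by decide)
  · obtain ⟨n, hn⟩ := WithTop.ne_top_iff_exists.1 htop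
    by_cases h0 : n = 0
    · subst h0
      obtain ⟨k, hk, -, hgk⟩ := (meromorphicOrderAt_eq_int_iff hg).1 hn.symm
      have h1 : g =ᶠ[𝓝[≠] z] k := by
        filter_upwards [hgk] with w hw
        simpa using hw
      rw [meromorphicOrderAt_congr h1.nhdsNE_deriv] at h
      have := hk.deriv.meromorphicOrderAt_nonneg
      rw [h] at this
      exact absurd this (by decide)
    · rw [meromorphicOrderAt_deriv_eq_sub_one (Int.cast_ne_zero.2 h0) hn.symm] at h
      have h' : ((n - 1 : ℤ) : WithTop ℤ) = ((-1 : ℤ) : WithTop ℤ) := h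
      have := WithTop.coe_injective h'
      omega

/-- Writing g = (z - z₀)ⁿ k with k(z₀) ≠ 0 gives g'/g = n/(z - z₀) + k'/k: the residue of the
logarithmic derivative is the order, and this is where integers enter the argument. -/
lemma tendsto_mul_logDeriv {g : ℂ → ℂ} {z₀ : ℂ} {n : ℤ} (hg : MeromorphicAt g z₀)
    (hn : meromorphicOrderAt g z₀ = n) :
    Tendsto (fun z => (z - z₀) * (deriv g z / g z)) (𝓝[≠] z₀) (𝓝 (n : ℂ)) := by
  obtain ⟨k, hk, hk0, hgk⟩ := (meromorphicOrderAt_eq_int_iff hg).1 hn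
  have hgk' : g =ᶠ[𝓝[≠] z₀] fun z => (z - z₀) ^ n * k z := hgk
  have hlim : Tendsto (fun z => (n : ℂ) + (z - z₀) * (deriv k z / k z)) (𝓝[≠] z₀) (𝓝 (n : ℂ)) := by
    have hc : ContinuousAt (fun z => (n : ℂ) + (z - z₀) * (deriv k z / k z)) z₀ :=
      continuousAt_const.add ((continuousAt_id.sub continuousAt_const).mul
        (hk.deriv.continuousAt.div hk.continuousAt hk0))
    have := hc.tendsto.mono_left (nhdsWithin_le_nhds (s := {z₀}ᶜ))
    simpa using this
  refine hlim.congr' ?_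
  filter_upwards [hgk', hgk'.nhdsNE_deriv, self_mem_nhdsWithin,
    nhdsWithin_le_nhds hk.eventually_analyticAt,
    nhdsWithin_le_nhds (hk.continuousAt.eventually_ne hk0)] with z h1 h2 h3 h4 h5
  have hz : z - z₀ ≠ 0 := sub_ne_zero.2 h3
  have hd : HasDerivAt (fun z => (z - z₀) ^ n * k z)
      ((n * (z - z₀) ^ (n - 1) * 1) * k z + (z - z₀) ^ n * deriv k z) z := by
    refine HasDerivAt.fun_mul ?_ h4.differentiableAt.hasDerivAt
    exact (hasDerivAt_zpow n (z - z₀) (Or.inl hz)).comp z ((hasDerivAt_id z).sub_const z₀)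
  have hzn : (z - z₀) ^ n ≠ 0 := zpow_ne_zero n hz
  rw [h1, h2, hd.deriv, zpow_sub_one₀ hz]
  field_simp

lemma exists_analytic_of_meromorphicOrderAt_nonneg {g : ℂ → ℂ} {z : ℂ} (hg : MeromorphicAt g z)
    (h : 0 ≤ meromorphicOrderAt g z) : ∃ k, AnalyticAt ℂ k z ∧ g =ᶠ[𝓝[≠] z] k := by
  have h1 := (meromorphicNFAt_toMeromorphicNFAt (f := g) (x := z)).meromorphicOrderAt_nonneg_iff_analyticAt.1
    (by rwa [← meromorphicOrderAt_congr hg.eq_nhdsNE_toMeromorphicNFAt])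
  exact ⟨_, h1, hg.eq_nhdsNE_toMeromorphicNFAt⟩

/-! ### Extension to the Riemann sphere, and poles on compact surfaces -/

lemma mdifferentiable_coe : MDifferentiable 𝓘(ℂ) 𝓘(ℂ) ((↑) : ℂ → OnePoint ℂ) := by
  intro z
  have h := contMDiffAt_symm_of_mem_maximalAtlas (I := 𝓘(ℂ)) (n := ω)
    (e := RiemannSphere.chartZero) (x := z)
    (StructureGroupoid.subset_maximalAtlas _ (Or.inl rfl)) (by simp [RiemannSphere.chartZero])
  exact h.mdifferentiableAt (by simp)

lemma mdifferentiable_inv_coe :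
    MDifferentiable 𝓘(ℂ) 𝓘(ℂ) (fun z : ℂ => RiemannSphere.invFun (z : OnePoint ℂ)) := by
  intro z
  have h := contMDiffAt_symm_of_mem_maximalAtlas (I := 𝓘(ℂ)) (n := ω)
    (e := RiemannSphere.chartInfty) (x := z)
    (StructureGroupoid.subset_maximalAtlas _ (Or.inr rfl))
    (by simp [RiemannSphere.chartInfty, RiemannSphere.chartZero])
  exact h.mdifferentiableAt (by simp)

section

variable {S : Type*} [TopologicalSpace S] [ChartedSpace ℂ S] [IsManifold 𝓘(ℂ) ω S]

/-- At each point F or 1/F has a removable singularity; in the second case one inverts back on the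
sphere. -/
lemma IsMero.exists_local_extension {F : S → ℂ} (hF : IsMero F) (p : S) :
    ∃ g : S → OnePoint ℂ, (∀ᶠ x in 𝓝 p, MDifferentiableAt 𝓘(ℂ) 𝓘(ℂ) g x) ∧
      ∀ᶠ x in 𝓝[≠] p, g x = (F x : OnePoint ℂ) := by
  set e := chartAt ℂ p with he_def
  have he := IsManifold.chart_mem_maximalAtlas (I := 𝓘(ℂ)) (n := ω) p
  have hp : p ∈ e.source := mem_chart_source ℂ p
  have hm := hF e he _ (e.map_source hp)
  have hmd : ∀ k : ℂ → ℂ, AnalyticAt ℂ k (e p) →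
      ∀ᶠ x in 𝓝 p, MDifferentiableAt 𝓘(ℂ) 𝓘(ℂ) (fun x => k (e x)) x := by
    intro k hk
    filter_upwards [(e.continuousAt hp).eventually hk.eventually_analyticAt,
      e.open_source.mem_nhds hp] with x hx hxs
    exact MDifferentiableAt.comp (I' := 𝓘(ℂ)) x hx.differentiableAt.mdifferentiableAt
      ((contMDiffAt_of_mem_maximalAtlas he hxs).mdifferentiableAt (by simp))
  by_cases ho : 0 ≤ meromorphicOrderAt (fun z => F (e.symm z)) (e p)
  · obtain ⟨k, hk, hFk⟩ := exists_analytic_of_meromorphicOrderAt_nonneg hm ho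
    refine ⟨fun x => ((k (e x) : ℂ) : OnePoint ℂ), ?_, ?_⟩
    · filter_upwards [hmd k hk] with x hx
      exact (mdifferentiable_coe _).comp x hx
    · filter_upwards [(eventually_chart_iff e hp).2 hFk,
        nhdsWithin_le_nhds (e.open_source.mem_nhds hp)] with x hx hxs
      rw [← hx, e.left_inv hxs]
  · rw [not_le] at ho
    have hmi : MeromorphicAt (fun z => (F (e.symm z))⁻¹) (e p) := hm.fun_inv
    obtain ⟨k, hk, hFk⟩ := exists_analytic_of_meromorphicOrderAt_nonneg hmi (by
      show 0 ≤ meromorphicOrderAt (fun z => F (e.symm z))⁻¹ (e p)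
      rw [meromorphicOrderAt_inv]
      have := ho.le
      rcases WithTop.ne_top_iff_exists.1 ho.ne_top with ⟨n, hn⟩
      rw [← hn] at this ⊢
      have h2 : n ≤ 0 := by exact_mod_cast this
      have h3 : 0 ≤ -n := by omega
      exact_mod_cast h3)
    refine ⟨fun x => RiemannSphere.invFun ((k (e x) : ℂ) : OnePoint ℂ), ?_, ?_⟩
    · filter_upwards [hmd k hk] with x hx
      exact (mdifferentiable_inv_coe _).comp x hx
    · have hne := (meromorphicOrderAt_ne_top_iff_eventually_ne_zero hm).1 ho.ne_top
      filter_upwards [(eventually_chart_iff e hp).2 hFk, (eventually_chart_iff e hp).2 hne,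
        nhdsWithin_le_nhds (e.open_source.mem_nhds hp)] with x hx hx0 hxs
      rw [e.left_inv hxs] at hx hx0
      rw [← hx, RiemannSphere.invFun_coe (inv_ne_zero hx0), inv_inv]

/-- A meromorphic function is a holomorphic map into the Riemann sphere, off a discrete set. -/
lemma IsMero.exists_extension [T2Space S] {F : S → ℂ} (hF : IsMero F) :
    ∃ h : S → OnePoint ℂ, MDifferentiable 𝓘(ℂ) 𝓘(ℂ) h ∧
      ∀ p, ∀ᶠ x in 𝓝[≠] p, h x = (F x : OnePoint ℂ) := by
  choose g hg hgF using fun p => hF.exists_local_extension p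
  -- The global map takes at x the value of the local extension centered at x. Near p it agrees with
  -- the extension centered at p, since at a nearby x ≠ p both extensions are continuous and equal F
  -- on a punctured neighborhood of x.
  have key : ∀ p, (fun x => g x x) =ᶠ[𝓝 p] g p := by
    intro p
    have h1 : ∀ᶠ x in 𝓝[≠] p, g x x = g p x := by
      filter_upwards [eventually_eventually_nhdsWithin.2 (hgF p), self_mem_nhdsWithin,
        nhdsWithin_le_nhds (hg p)] with x hx hxp hxd
      have := punctured_neBot x
      rw [isOpen_compl_singleton.nhdsWithin_eq hxp] at hx
      have l1 : Tendsto (g p) (𝓝[≠] x) (𝓝 (g p x)) :=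
        hxd.continuousAt.mono_left nhdsWithin_le_nhds
      have l2 : Tendsto (g x) (𝓝[≠] x) (𝓝 (g x x)) :=
        (hg x).self_of_nhds.continuousAt.mono_left nhdsWithin_le_nhds
      refine tendsto_nhds_unique (l2.congr' ?_) l1
      filter_upwards [nhdsWithin_le_nhds hx, hgF x] with y h1 h2
      rw [h1, h2]
    rw [← nhdsNE_sup_pure p]
    exact eventually_sup.2 ⟨h1, by simp⟩
  refine ⟨fun x => g x x, fun p => (hg p).self_of_nhds.congr_of_eventuallyEq (key p),
    fun p => ?_⟩
  filter_upwards [nhdsWithin_le_nhds (key p), hgF p] with x h1 h2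
  rw [h1, h2]

lemma mdifferentiableAt_chartZero {y : OnePoint ℂ} (hy : y ≠ OnePoint.infty) :
    MDifferentiableAt 𝓘(ℂ) 𝓘(ℂ) RiemannSphere.chartZero y :=
  (contMDiffAt_of_mem_maximalAtlas (I := 𝓘(ℂ)) (n := ω)
    (StructureGroupoid.subset_maximalAtlas _ (Or.inl rfl))
    ((RiemannSphere.chartZero_source y).2 hy)).mdifferentiableAt (by simp)

lemma mdifferentiableAt_chartInfty {y : OnePoint ℂ} (hy : y ≠ ((0 : ℂ) : OnePoint ℂ)) :
    MDifferentiableAt 𝓘(ℂ) 𝓘(ℂ) RiemannSphere.chartInfty y :=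
  (contMDiffAt_of_mem_maximalAtlas (I := 𝓘(ℂ)) (n := ω)
    (StructureGroupoid.subset_maximalAtlas _ (Or.inr rfl))
    ((RiemannSphere.chartInfty_source y).2 hy)).mdifferentiableAt (by simp)

/-- A meromorphic function on a compact Riemann surface is constant or has a pole. -/
lemma IsMero.const_or_exists_pole [T2Space S] [CompactSpace S] [ConnectedSpace S] {F : S → ℂ}
    (hF : IsMero F) : (∃ c, ∀ p, ∀ᶠ x in 𝓝[≠] p, F x = c) ∨
      ∃ p, meromorphicOrderAt (fun z => F ((chartAt ℂ p).symm z)) (chartAt ℂ p p) < 0 := by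
  obtain ⟨h, hd, hh⟩ := hF.exists_extension
  by_cases hinf : ∃ p, h p = OnePoint.infty
  · right
    obtain ⟨p, hp⟩ := hinf
    refine ⟨p, ?_⟩
    have hs := mem_chart_source ℂ p
    rw [← tendsto_cobounded_iff_meromorphicOrderAt_neg
      (hF _ (IsManifold.chart_mem_maximalAtlas p) _ ((chartAt ℂ p).map_source hs)),
      Metric.cobounded_eq_cocompact, ← coclosedCompact_eq_cocompact,
      ← OnePoint.comap_coe_nhds_infty, tendsto_comap_iff]
    have h1 : Tendsto h (𝓝[≠] p) (𝓝 OnePoint.infty) := by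
      rw [← hp]; exact (hd p).continuousAt.mono_left nhdsWithin_le_nhds
    have h2 : Tendsto (fun x => (F x : OnePoint ℂ)) (𝓝[≠] p) (𝓝 OnePoint.infty) :=
      h1.congr' (hh p)
    exact h2.comp (tendsto_chart_symm_punctured _ hs)
  · left
    have hinf' : ∀ p, h p ≠ OnePoint.infty := fun p hp => hinf ⟨p, hp⟩
    -- A map that avoids ∞ is a holomorphic function on a compact connected surface, hence constant.
    have hmd : MDifferentiable 𝓘(ℂ) 𝓘(ℂ) (fun x => RiemannSphere.chartZero (h x)) := fun x =>
      (mdifferentiableAt_chartZero (hinf' x)).comp x (hd x)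
    obtain ⟨c, hc⟩ := hmd.exists_eq_const_of_compactSpace
    refine ⟨c, fun p => ?_⟩
    filter_upwards [hh p] with x hx
    have := congrFun hc x
    simp only [Function.const_apply] at this
    rwa [hx, RiemannSphere.chartZero_coe] at this

/-- The exponential of a nonzero multiple of the local coordinate is not meromorphic on a compact
surface on which the local coordinate is meromorphic. -/
lemma IsMero.not_exp_and_linear [T2Space S] [CompactSpace S] [ConnectedSpace S] {F₁ F₂ : S → ℂ}
    (h₁ : IsMero F₁) (h₂ : IsMero F₂) {e : OpenPartialHomeomorph S ℂ}
    (he : e ∈ IsManifold.maximalAtlas 𝓘(ℂ) ω S) (hne : e.source.Nonempty) {C c m : ℂ} (hC : C ≠ 0)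
    (hm : m ≠ 0) (hF₁ : ∀ z ∈ e.target, F₁ (e.symm z) = C * Complex.exp (m * z))
    (hF₂ : ∀ z ∈ e.target, F₂ (e.symm z) = -z + c) : False := by
  have hd₁ : ∀ z ∈ e.target,
      HasDerivAt (fun z => F₁ (e.symm z)) (C * (Complex.exp (m * z) * m)) z := by
    intro z hz
    have h3 : HasDerivAt (fun w : ℂ => C * Complex.exp (m * w)) (C * (Complex.exp (m * z) * m)) z := by
      simpa using (((hasDerivAt_id z).const_mul m).cexp).const_mul C
    refine h3.congr_of_eventuallyEq ?_
    filter_upwards [e.open_target.mem_nhds hz] with w hw using hF₁ w hw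
  have hd₂ : ∀ z ∈ e.target, HasDerivAt (fun z => F₂ (e.symm z)) (-1) z := by
    intro z hz
    have h3 : HasDerivAt (fun w : ℂ => -w + c) (-1) z := (hasDerivAt_id z).neg.add_const c
    refine h3.congr_of_eventuallyEq ?_
    filter_upwards [e.open_target.mem_nhds hz] with w hw using hF₂ w hw
  obtain ⟨x₀, hx₀⟩ := hne
  rcases h₁.const_or_exists_pole with ⟨k, hk⟩ | ⟨p, hp⟩
  · have h3 := (eventually_chart_symm_iff e hx₀).2 (hk x₀)
    have h4 : (fun z => F₁ (e.symm z)) =ᶠ[𝓝[≠] (e x₀)] fun _ => k := h3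
    obtain ⟨z, h5, h6⟩ := (h4.nhdsNE_deriv.and
      (nhdsWithin_le_nhds (e.open_target.mem_nhds (e.map_source hx₀)))).exists
    rw [(hd₁ z h6).deriv] at h5
    simp [hC, hm] at h5
  · have hcp := IsManifold.chart_mem_maximalAtlas (I := 𝓘(ℂ)) (n := ω) p
    have hps := mem_chart_source ℂ p
    have hrel := h₁.differential_relation h₂ (IsMero.const 1) ((IsMero.const m).mul h₁) he
      ⟨x₀, hx₀⟩ (fun z hz => ⟨(hd₁ z hz).differentiableAt, (hd₂ z hz).differentiableAt, by
        rw [(hd₁ z hz).deriv, (hd₂ z hz).deriv, hF₁ z hz]; ring⟩) hcp hps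
    set f₁ : ℂ → ℂ := fun z => F₁ ((chartAt ℂ p).symm z)
    set f₂ : ℂ → ℂ := fun z => F₂ ((chartAt ℂ p).symm z)
    have hm₁ : MeromorphicAt f₁ (chartAt ℂ p p) := h₁ _ hcp _ ((chartAt ℂ p).map_source hps)
    have hm₂ : MeromorphicAt f₂ (chartAt ℂ p p) := h₂ _ hcp _ ((chartAt ℂ p).map_source hps)
    have hlog := meromorphicOrderAt_logDeriv_eq_neg_one hm₁ hp.ne hp.ne_top
    have hne := (meromorphicOrderAt_ne_top_iff_eventually_ne_zero hm₁).1 hp.ne_top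
    -- The relation dF₁/F₁ = -m dF₂, continued from the disk, is contradictory at a pole of F₁: the
    -- left side has order -1 there, which no derivative of a meromorphic function has.
    have heq : logDeriv f₁ =ᶠ[𝓝[≠] (chartAt ℂ p p)] fun z => (-m) * deriv f₂ z := by
      filter_upwards [hrel, hne] with z hz h0
      rw [logDeriv_apply, div_eq_iff h0]
      linear_combination hz
    rw [meromorphicOrderAt_congr heq] at hlog
    have := meromorphicOrderAt_mul_of_ne_zero (f := deriv f₂) (g := fun _ => -m)
      (x := chartAt ℂ p p) analyticAt_const (neg_ne_zero.2 hm)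
    refine meromorphicOrderAt_deriv_ne_neg_one hm₂ ?_
    rw [← this]
    exact hlog

/-- If two exponentials of the local coordinate are meromorphic on a compact surface, their
exponents are commensurable. -/
lemma IsMero.exists_rat_of_exp [T2Space S] [CompactSpace S] [ConnectedSpace S] {F₁ F₂ : S → ℂ}
    (h₁ : IsMero F₁) (h₂ : IsMero F₂) {e : OpenPartialHomeomorph S ℂ}
    (he : e ∈ IsManifold.maximalAtlas 𝓘(ℂ) ω S) (hne : e.source.Nonempty) {C₁ C₂ a b : ℂ}
    (hC₁ : C₁ ≠ 0) (hC₂ : C₂ ≠ 0) (hb : b ≠ 0)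
    (hF₁ : ∀ z ∈ e.target, F₁ (e.symm z) = C₁ * Complex.exp (a * z))
    (hF₂ : ∀ z ∈ e.target, F₂ (e.symm z) = C₂ * Complex.exp (b * z)) :
    ∃ ρ : ℚ, a = ρ * b := by
  have hder : ∀ (F : S → ℂ) (C m : ℂ), (∀ z ∈ e.target, F (e.symm z) = C * Complex.exp (m * z)) →
      ∀ z ∈ e.target, HasDerivAt (fun z => F (e.symm z)) (C * (Complex.exp (m * z) * m)) z := by
    intro F C m hF z hz
    have h3 : HasDerivAt (fun w : ℂ => C * Complex.exp (m * w)) (C * (Complex.exp (m * z) * m)) z := by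
      simpa using (((hasDerivAt_id z).const_mul m).cexp).const_mul C
    refine h3.congr_of_eventuallyEq ?_
    filter_upwards [e.open_target.mem_nhds hz] with w hw using hF w hw
  have hd₁ := hder F₁ C₁ a hF₁
  have hd₂ := hder F₂ C₂ b hF₂
  obtain ⟨x₀, hx₀⟩ := hne
  rcases h₂.const_or_exists_pole with ⟨k, hk⟩ | ⟨p, hp⟩
  · have h3 := (eventually_chart_symm_iff e hx₀).2 (hk x₀)
    have h4 : (fun z => F₂ (e.symm z)) =ᶠ[𝓝[≠] (e x₀)] fun _ => k := h3
    obtain ⟨z, h5, h6⟩ := (h4.nhdsNE_deriv.and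
      (nhdsWithin_le_nhds (e.open_target.mem_nhds (e.map_source hx₀)))).exists
    rw [(hd₂ z h6).deriv] at h5
    simp [hC₂, hb] at h5
  · have hcp := IsManifold.chart_mem_maximalAtlas (I := 𝓘(ℂ)) (n := ω) p
    have hps := mem_chart_source ℂ p
    have hrel := h₁.differential_relation h₂ ((IsMero.const b).mul h₂) ((IsMero.const (-a)).mul h₁)
      he ⟨x₀, hx₀⟩ (fun z hz => ⟨(hd₁ z hz).differentiableAt, (hd₂ z hz).differentiableAt, by
        rw [(hd₁ z hz).deriv, (hd₂ z hz).deriv, hF₁ z hz, hF₂ z hz]; ring⟩) hcp hps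
    set f₁ : ℂ → ℂ := fun z => F₁ ((chartAt ℂ p).symm z)
    set f₂ : ℂ → ℂ := fun z => F₂ ((chartAt ℂ p).symm z)
    have hm₁ : MeromorphicAt f₁ (chartAt ℂ p p) := h₁ _ hcp _ ((chartAt ℂ p).map_source hps)
    have hm₂ : MeromorphicAt f₂ (chartAt ℂ p p) := h₂ _ hcp _ ((chartAt ℂ p).map_source hps)
    -- If F₁ vanished identically near p, it would also vanish on the disk, where it is a nonzero
    -- exponential.
    have htop₁ : meromorphicOrderAt f₁ (chartAt ℂ p p) ≠ ⊤ := by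
      intro htop
      rw [meromorphicOrderAt_eq_top_iff] at htop
      have h0 := h₁.eventually_eq_of_eventually_eq (c := 0)
        ⟨p, (eventually_chart_symm_iff (chartAt ℂ p) hps (P := fun x => F₁ x = 0)).1 htop⟩ x₀
      obtain ⟨z, h5, h6⟩ := (((eventually_chart_symm_iff e hx₀).2 h0).and
        (nhdsWithin_le_nhds (e.open_target.mem_nhds (e.map_source hx₀)))).exists
      rw [hF₁ z h6] at h5
      simp [hC₁] at h5
    have htop₂ := hp.ne_top
    obtain ⟨n₁, hn₁⟩ := WithTop.ne_top_iff_exists.1 htop₁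
    obtain ⟨n₂, hn₂⟩ := WithTop.ne_top_iff_exists.1 htop₂
    have hn₂0 : n₂ ≠ 0 := by
      rintro rfl
      rw [← hn₂] at hp
      exact absurd hp (by simp)
    have l₁ := (tendsto_mul_logDeriv hm₁ hn₁.symm).const_mul b
    have l₂ := (tendsto_mul_logDeriv hm₂ hn₂.symm).const_mul a
    -- Compare the residues at p of the two sides of b dF₁/F₁ = a dF₂/F₂. Here n₂ ≠ 0 because p is a
    -- pole of F₂.
    have heq : b * n₁ = a * n₂ := by
      refine tendsto_nhds_unique (l₁.congr' ?_) l₂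
      filter_upwards [hrel, (meromorphicOrderAt_ne_top_iff_eventually_ne_zero hm₁).1 htop₁,
        (meromorphicOrderAt_ne_top_iff_eventually_ne_zero hm₂).1 htop₂] with z hz h0 h0'
      field_simp
      linear_combination (z - chartAt ℂ p p) * hz
    refine ⟨n₁ / n₂, ?_⟩
    have : (n₂ : ℂ) ≠ 0 := Int.cast_ne_zero.2 hn₂0
    push_cast
    field_simp
    linear_combination -heq

end

/-! ### Plücker coordinates -/

lemma symp_add_left (x y z : Idx → ℂ) : symp (x + y) z = symp x z + symp y z := by
  simp only [symp, Pi.add_apply]; ring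

lemma symp_smul_left (c : ℂ) (x y : Idx → ℂ) : symp (c • x) y = c * symp x y := by
  simp only [symp, Pi.smul_apply, smul_eq_mul]; ring

lemma symp_add_right (x y z : Idx → ℂ) : symp x (y + z) = symp x y + symp x z := by
  simp only [symp, Pi.add_apply]; ring

lemma symp_smul_right (c : ℂ) (x y : Idx → ℂ) : symp x (c • y) = c * symp x y := by
  simp only [symp, Pi.smul_apply, smul_eq_mul]; ring

/-- The value on `u ∧ v` of the product of the linear forms `ω(a, ·)` and `ω(b, ·)`. -/
def pl (a b u v : Idx → ℂ) : ℂ := symp a u * symp b v - symp b u * symp a v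

lemma linearIndependent_of_span_eq {P : Q3} {u v : Idx → ℂ} (h : P.1 = Submodule.span ℂ {u, v}) :
    LinearIndependent ℂ ![u, v] := by
  rw [linearIndependent_iff_card_eq_finrank_span, Matrix.range_cons_cons_empty, Set.finrank, ← h,
    P.2.1]
  rfl

/-- All Plücker coordinates are multiplied by the determinant of the change of basis. It cancels in
quotients, which therefore depend on the plane only. -/
lemma pl_change {P : Q3} {u v u' v' : Idx → ℂ} (h : P.1 = Submodule.span ℂ {u, v})
    (h' : P.1 = Submodule.span ℂ {u', v'}) :
    ∃ D : ℂ, D ≠ 0 ∧ ∀ a b, pl a b u' v' = D * pl a b u v := by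
  have hu : u' ∈ Submodule.span ℂ {u, v} := by
    rw [← h, h']; exact Submodule.subset_span (by simp)
  have hv : v' ∈ Submodule.span ℂ {u, v} := by
    rw [← h, h']; exact Submodule.subset_span (by simp)
  obtain ⟨α, β, hu⟩ := Submodule.mem_span_pair.1 hu
  obtain ⟨γ, δ, hv⟩ := Submodule.mem_span_pair.1 hv
  have hli := LinearIndependent.pair_iff.1 (linearIndependent_of_span_eq h')
  refine ⟨α * δ - β * γ, fun hD => ?_, fun a b => ?_⟩
  · have h1 : δ • u' + (-β) • v' = 0 := by
      rw [← hu, ← hv]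
      ext i
      simp only [Pi.add_apply, Pi.smul_apply, smul_eq_mul, Pi.zero_apply]
      linear_combination u i * hD
    have h2 : γ • u' + (-α) • v' = 0 := by
      rw [← hu, ← hv]
      ext i
      simp only [Pi.add_apply, Pi.smul_apply, smul_eq_mul, Pi.zero_apply]
      linear_combination -v i * hD
    obtain ⟨-, h3⟩ := hli _ _ h1
    obtain ⟨-, h4⟩ := hli _ _ h2
    have h5 : u' = 0 := by
      rw [← hu, neg_eq_zero.1 h3, neg_eq_zero.1 h4]; simp
    have := (hli 1 0 (by rw [h5]; simp)).1
    exact one_ne_zero this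
  · rw [← hu, ← hv]
    simp only [pl, symp_add_right, symp_smul_right]
    ring

lemma exists_span_pair (P : Q3) : ∃ u v : Idx → ℂ, P.1 = Submodule.span ℂ {u, v} := by
  have : Module.Finite ℂ P.1 := Module.finite_of_finrank_eq_succ P.2.1
  let b := Module.finBasisOfFinrankEq ℂ P.1 P.2.1
  refine ⟨b 0, b 1, ?_⟩
  have h := congrArg (Submodule.map P.1.subtype) b.span_eq
  rw [Submodule.map_span, Submodule.map_top, Submodule.range_subtype] at h
  refine h.symm.trans ?_
  congr 1
  ext x
  simp [eq_comm]

/-- Quotients of Plücker coordinates of a Lagrangian plane. -/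
def plRatio (a b c d : Idx → ℂ) (P : Q3) : ℂ :=
  pl a b (exists_span_pair P).choose (exists_span_pair P).choose_spec.choose /
    pl c d (exists_span_pair P).choose (exists_span_pair P).choose_spec.choose

lemma plRatio_eq {P : Q3} {u v : Idx → ℂ} (h : P.1 = Submodule.span ℂ {u, v})
    (a b c d : Idx → ℂ) : plRatio a b c d P = pl a b u v / pl c d u v := by
  obtain ⟨D, hD, h1⟩ := pl_change (exists_span_pair P).choose_spec.choose_spec h
  rw [plRatio, h1, h1, mul_div_mul_left _ _ hD]

/-- A Lagrangian plane is its own orthogonal for the symplectic form. -/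
lemma mem_of_symp_eq_zero (P : Q3) {x : Idx → ℂ} (h : ∀ y ∈ P.1, symp x y = 0) : x ∈ P.1 := by
  obtain ⟨u, v, huv⟩ := exists_span_pair P
  by_contra hx
  have hu : u ∈ P.1 := by rw [huv]; exact Submodule.subset_span (by simp)
  have hv : v ∈ P.1 := by rw [huv]; exact Submodule.subset_span (by simp)
  have hli : LinearIndependent ℂ ![x, u, v] := by
    refine linearIndependent_finCons.2 ⟨linearIndependent_of_span_eq huv, ?_⟩
    rwa [Matrix.range_cons_cons_empty, ← huv]
  -- If x is not in the plane, the pairings with x, u, v are independent functionals on ℂ⁴, with a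
  -- one-dimensional common kernel; yet that kernel contains the plane itself.
  let φ : (Idx → ℂ) →ₗ[ℂ] (Fin 3 → ℂ) :=
    { toFun := fun y => ![symp x y, symp u y, symp v y]
      map_add' := fun y z => by
        ext i; fin_cases i <;> simp [symp_add_right]
      map_smul' := fun c y => by
        ext i; fin_cases i <;> simp [symp_smul_right] }
  -- A functional g that kills the image yields a combination of x, u, v orthogonal to everything;
  -- it vanishes because ω is nondegenerate, and independence then gives g = 0.
  have hφ : Function.Surjective φ := by
    rw [← LinearMap.range_eq_top]
    by_contra hne
    obtain ⟨g, hg0, hg⟩ := Submodule.exists_le_ker_of_lt_top _ (lt_top_iff_ne_top.2 hne)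
    have hker : ∀ y, g (φ y) = 0 := fun y => hg ⟨y, rfl⟩
    have hgs : ∀ w : Fin 3 → ℂ, g w = w 0 * g ![1, 0, 0] + w 1 * g ![0, 1, 0] +
        w 2 * g ![0, 0, 1] := by
      intro w
      have : w = w 0 • ![1, 0, 0] + w 1 • ![0, 1, 0] + w 2 • ![0, 0, 1] := by
        ext i; fin_cases i <;> simp
      conv_lhs => rw [this]
      simp only [map_add, map_smul, smul_eq_mul]
    set α := g ![1, 0, 0]
    set β := g ![0, 1, 0]
    set γ := g ![0, 0, 1]
    have hcomb : ∀ y, symp (α • x + β • u + γ • v) y = 0 := by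
      intro y
      have := hker y
      rw [hgs] at this
      simp only [φ, LinearMap.coe_mk, AddHom.coe_mk, Matrix.cons_val_zero, Matrix.cons_val_one,
        Matrix.cons_val_two, Matrix.tail_cons, Matrix.head_cons] at this
      simp only [symp_add_left, symp_smul_left]
      linear_combination this
    have hzero : ∀ y : Idx → ℂ, (∀ z, symp y z = 0) → y = 0 := by
      intro y hy
      have e1 := hy (vec4 1 0 0 0)
      have e2 := hy (vec4 0 1 0 0)
      have e3 := hy (vec4 0 0 1 0)
      have e4 := hy (vec4 0 0 0 1)
      simp [symp, vec4] at e1 e2 e3 e4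
      ext i
      rcases i with i | i <;> fin_cases i
      · exact e3
      · exact e4
      · exact e1
      · exact e2
    have h0 := hzero _ hcomb
    have h1 := Fintype.linearIndependent_iff.1 hli ![α, β, γ] (by
      simpa [Fin.sum_univ_three] using h0)
    refine hg0 (LinearMap.ext fun w => ?_)
    have hα : α = 0 := h1 0
    have hβ : β = 0 := h1 1
    have hγ : γ = 0 := h1 2
    rw [hgs, hα, hβ, hγ]; simp
  have hrk := φ.finrank_range_add_finrank_ker
  rw [LinearMap.range_eq_top.2 hφ, finrank_top] at hrk
  have hP : P.1 ≤ LinearMap.ker φ := by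
    intro y hy
    rw [LinearMap.mem_ker]
    ext i
    fin_cases i
    · exact h y hy
    · exact P.2.2 u hu y hy
    · exact P.2.2 v hv y hy
  have h2 := Submodule.finrank_mono hP
  rw [P.2.1] at h2
  simp at hrk
  omega

/-- Lagrangian planes are their own orthogonals. Equality of planes thus becomes four scalar
equations in spanning vectors, analytic when these are: the form needed for the identity principle
and for explicit verifications. -/
lemma eq_iff_symp {P P' : Q3} {u v u' v' : Idx → ℂ} (h : P.1 = Submodule.span ℂ {u, v})
    (h' : P'.1 = Submodule.span ℂ {u', v'}) :
    P = P' ↔ ∀ i, (![symp u u', symp u v', symp v u', symp v v'] : Fin 4 → ℂ) i = 0 := by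
  have hu : u ∈ P.1 := by rw [h]; exact Submodule.subset_span (by simp)
  have hv : v ∈ P.1 := by rw [h]; exact Submodule.subset_span (by simp)
  have hu' : u' ∈ P'.1 := by rw [h']; exact Submodule.subset_span (by simp)
  have hv' : v' ∈ P'.1 := by rw [h']; exact Submodule.subset_span (by simp)
  constructor
  · rintro rfl i
    fin_cases i
    · exact P.2.2 u hu u' hu'
    · exact P.2.2 u hu v' hv'
    · exact P.2.2 v hv u' hu'
    · exact P.2.2 v hv v' hv'
  · intro hi
    have h0 := hi 0
    have h1 := hi 1
    have h2 := hi 2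
    have h3 := hi 3
    simp at h0 h1 h2 h3
    have hle : P.1 ≤ P'.1 := by
      rw [h, Submodule.span_le, Set.insert_subset_iff, Set.singleton_subset_iff]
      constructor <;>
      · refine mem_of_symp_eq_zero P' fun y hy => ?_
        rw [h'] at hy
        obtain ⟨a, b, rfl⟩ := Submodule.mem_span_pair.1 hy
        simp [symp_add_right, symp_smul_right, h0, h1, h2, h3]
    have : Module.Finite ℂ P'.1 := Module.finite_of_finrank_eq_succ P'.2.1
    exact Subtype.ext (Submodule.eq_of_le_of_finrank_eq hle (P.2.1.trans P'.2.1.symm))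

lemma analyticAt_symp {u v : ℂ → Idx → ℂ} {z : ℂ} (hu : AnalyticAt ℂ u z) (hv : AnalyticAt ℂ v z) :
    AnalyticAt ℂ (fun w => symp (u w) (v w)) z := by
  have hu' := analyticAt_pi_iff.1 hu
  have hv' := analyticAt_pi_iff.1 hv
  exact (((hu' i1).mul (hv' i3)).sub ((hu' i3).mul (hv' i1))).add
    (((hu' i2).mul (hv' i4)).sub ((hu' i4).mul (hv' i2)))

section

variable {S : Type*} [TopologicalSpace S] [ChartedSpace ℂ S]

lemma IsHolomorphic.isMero_plRatio {f : S → Q3} (hf : IsHolomorphic f) (a b c d : Idx → ℂ) :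
    IsMero (fun x => plRatio a b c d (f x)) := by
  refine IsMero.of_local fun p => ?_
  obtain ⟨e, he, hp, u, v, hu, hv, hs⟩ := hf p
  refine ⟨e, he, hp, ?_⟩
  have hn := e.open_target.mem_nhds (e.map_source hp)
  have hu' := hu.analyticAt hn
  have hv' := hv.analyticAt hn
  have hpl : ∀ a b, AnalyticAt ℂ (fun z => pl a b (u z) (v z)) (e p) := fun a b =>
    ((analyticAt_symp analyticAt_const hu').mul (analyticAt_symp analyticAt_const hv')).sub
      ((analyticAt_symp analyticAt_const hu').mul (analyticAt_symp analyticAt_const hv'))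
  refine (((hpl a b).meromorphicAt).fun_div ((hpl c d).meromorphicAt)).congr ?_
  filter_upwards [nhdsWithin_le_nhds hn] with z hz
  have := hs _ (e.map_target hz)
  rw [e.right_inv hz] at this
  exact (plRatio_eq this a b c d).symm

/-- The identity principle for holomorphic maps into the quadric of Lagrangian planes. -/
lemma IsHolomorphic.eq_of_eventually_eq [PreconnectedSpace S] {f g : S → Q3}
    (hf : IsHolomorphic f) (hg : IsHolomorphic g) (h0 : ∃ p, ∀ᶠ x in 𝓝[≠] p, f x = g x) :
    f = g := by
  have hloc : ∀ p, ∃ e ∈ IsManifold.maximalAtlas 𝓘(ℂ) ω S, p ∈ e.source ∧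
      ∃ G : Fin 4 → ℂ → ℂ, (∀ i, ∀ z ∈ e.target, AnalyticAt ℂ (G i) z) ∧
        ∀ x ∈ e.source, (f x = g x ↔ ∀ i, G i (e x) = 0) := by
    intro p
    obtain ⟨e, he, hp, u, v, hu, hv, hs⟩ := hf p
    obtain ⟨e', he', hp', u', v', hu', hv', hs'⟩ := hg p
    have hopen : IsOpen (e.target ∩ e.symm ⁻¹' e'.source) :=
      e.symm.isOpen_inter_preimage e'.open_source
    obtain ⟨r, hr, hball⟩ := Metric.isOpen_iff.1 hopen (e p)
      ⟨e.map_source hp, by rw [Set.mem_preimage, e.left_inv hp]; exact hp'⟩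
    obtain ⟨e₁, he₁, ht₁, hs₁, h1, h2⟩ := exists_chart_ball he
      (hball.trans Set.inter_subset_left)
    have han : ∀ w : ℂ → Idx → ℂ, DifferentiableOn ℂ w e.target → ∀ z ∈ e₁.target,
        AnalyticAt ℂ w z := fun w hw z hz => hw.analyticAt (e.open_target.mem_nhds
          (hball (by rwa [ht₁] at hz)).1)
    have han' : ∀ w : ℂ → Idx → ℂ, DifferentiableOn ℂ w e'.target → ∀ z ∈ e₁.target,
        AnalyticAt ℂ (fun z => w (e' (e.symm z))) z := by
      intro w hw z hz
      rw [ht₁] at hz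
      obtain ⟨h3, h4⟩ := hball hz
      exact AnalyticAt.comp (g := w) (f := fun z => e' (e.symm z))
        (hw.analyticAt (e'.open_target.mem_nhds (e'.map_source h4)))
        (analyticAt_transition he he' h3 h4)
    have hsrc : ∀ x ∈ e₁.source, x ∈ e'.source := by
      intro x hx
      have h3 := e₁.map_source hx
      rw [ht₁, h1] at h3
      have h4 := (hball h3).2
      rwa [Set.mem_preimage, e.left_inv (hs₁ hx)] at h4
    have hp₁ : p ∈ e₁.source := by
      have : e p ∈ e₁.target := by rw [ht₁]; exact mem_ball_self hr
      have h3 := e₁.map_target this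
      rwa [h2, e.left_inv hp] at h3
    refine ⟨e₁, he₁, hp₁, fun i z => ![symp (u z) (u' (e' (e.symm z))),
      symp (u z) (v' (e' (e.symm z))), symp (v z) (u' (e' (e.symm z))),
      symp (v z) (v' (e' (e.symm z)))] i, ?_, ?_⟩
    · intro i z hz
      fin_cases i
      · exact analyticAt_symp (han u hu z hz) (han' u' hu' z hz)
      · exact analyticAt_symp (han u hu z hz) (han' v' hv' z hz)
      · exact analyticAt_symp (han v hv z hz) (han' u' hu' z hz)
      · exact analyticAt_symp (han v hv z hz) (han' v' hv' z hz)
    · intro x hx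
      rw [h1]
      beta_reduce
      rw [e.left_inv (hs₁ hx)]
      exact eq_iff_symp (hs x (hs₁ hx)) (hs' x (hsrc x hx))
  have hev := eventually_of_meromorphic_condition (R := fun x => f x = g x) (fun p => by
    obtain ⟨e, he, hp, G, hG, hGR⟩ := hloc p
    refine ⟨e, he, hp, 4, G, fun i z hz => (hG i z hz).meromorphicAt, fun q hq => ?_⟩
    filter_upwards [nhdsWithin_le_nhds (e.open_source.mem_nhds hq)] with x hx using hGR x hx) h0
  funext p
  obtain ⟨e, he, hp, G, hG, hGR⟩ := hloc p
  rw [hGR p hp]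
  intro i
  -- The identity principle gives equality off a discrete set only. Continuity of the four pairings
  -- supplies the point p, which is not isolated.
  have := punctured_neBot p
  have hc : Tendsto (fun x => G i (e x)) (𝓝[≠] p) (𝓝 (G i (e p))) :=
    ((hG i _ (e.map_source hp)).continuousAt.comp (e.continuousAt hp)).mono_left
      nhdsWithin_le_nhds
  refine tendsto_nhds_unique hc (tendsto_const_nhds.congr' ?_)
  filter_upwards [hev p, nhdsWithin_le_nhds (e.open_source.mem_nhds hp)] with x hx hxs
  exact ((hGR x hxs).1 hx i).symm

end

/-! ### The isotropic `W`-curves are holomorphic -/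

/-- The factor 1 + ε makes (m + n)(1 + ε) even, so the truncated division is exact: the mixed
exponent is the mean of the other two. -/
lemma two_mul_half_exponent (m n : ℕ) :
    2 * ((m + n) * (1 + (m + n) % 2) / 2) = (1 + (m + n) % 2) * m + (1 + (m + n) % 2) * n := by
  rw [← Nat.mul_add, Nat.mul_comm (1 + (m + n) % 2)]
  refine Nat.mul_div_cancel' ?_
  rcases Nat.mod_two_eq_zero_or_one (m + n) with h | h
  · rw [h]; omega
  · rw [h]; omega

lemma sqrt_mul_sq (m n : ℕ) : ((Real.sqrt (m * n) : ℝ) : ℂ) ^ 2 = m * n := by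
  rw [← Complex.ofReal_pow, Real.sq_sqrt (by positivity)]
  push_cast; ring

/-- The vector `v_q` in the coordinate `1 / z`, up to a factor. -/
def vqInf (m n : ℕ) (t : ℂ) : Idx → ℂ :=
  vec4 (-((m : ℂ) + n) * t ^ ((1 + (m + n) % 2) * m))
    (-2 * Complex.I * (Real.sqrt (m * n) : ℂ) * t ^ ((m + n) * (1 + (m + n) % 2) / 2))
    ((m : ℂ) - n) 0

/-- The vector `w_q` in the coordinate `1 / z`, up to a factor. -/
def wqInf (m n : ℕ) (t : ℂ) : Idx → ℂ :=
  vec4 (-2 * Complex.I * (Real.sqrt (m * n) : ℂ) * t ^ ((m + n) * (1 + (m + n) % 2) / 2))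
    (((m : ℂ) + n) * t ^ (n * (1 + (m + n) % 2))) 0 ((m : ℂ) - n)

lemma isLagrangian_inf {m n : ℕ} (h : (m : ℂ) - n ≠ 0) (t : ℂ) :
    IsLagrangian (Submodule.span ℂ {vqInf m n t, wqInf m n t}) := by
  refine isLagrangian_span ?_ ?_
  · rw [LinearIndependent.pair_iff]
    intro s t h
    have h1 := congrFun h i3
    have h2 := congrFun h i4
    simp [vqInf, wqInf, vec4] at h1 h2
    tauto
  · simp [symp, vec4, vqInf, wqInf]
    ring

lemma span_inf_zero {m n : ℕ} (h : (m : ℂ) - n ≠ 0) (hm : 0 < m) (hn : 0 < n) :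
    Submodule.span ℂ {vec4 0 0 1 0, vec4 0 0 0 1} =
      Submodule.span ℂ {vqInf m n 0, wqInf m n 0} := by
  have hK := two_mul_half_exponent m n
  have hM : (1 + (m + n) % 2) * m ≠ 0 := by positivity
  have hN : n * (1 + (m + n) % 2) ≠ 0 := by positivity
  have hK0 : (m + n) * (1 + (m + n) % 2) / 2 ≠ 0 := by
    have : 0 < (1 + (m + n) % 2) * m := by positivity
    omega
  refine congrArg Subtype.val ((eq_iff_symp (P := ⟨_, isLagrangian_infty⟩)
    (P' := ⟨_, isLagrangian_inf h 0⟩) rfl rfl).2 fun i => ?_)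
  fin_cases i <;> simp [symp, vec4, vqInf, wqInf, hM, hN, hK0]

/-- By `eq_iff_symp` four pairings must vanish. They do because (m - n)² = (m + n)² - 4mn and
because the mixed exponent is the mean of the other two. -/
lemma span_inf_eq {m n : ℕ} (h : (m : ℂ) - n ≠ 0) {z t : ℂ} (hzt : t * z = 1) :
    Submodule.span ℂ {vq m n z, wq m n z} =
      Submodule.span ℂ {vqInf m n t, wqInf m n t} := by
  have hK := two_mul_half_exponent m n
  refine congrArg Subtype.val ((eq_iff_symp (P := ⟨_, isLagrangian_frame h⟩)
    (P' := ⟨_, isLagrangian_inf h t⟩) rfl rfl).2 fun i => ?_)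
  have hs := sqrt_mul_sq m n
  have hI := Complex.I_sq
  have hN' : n * (1 + (m + n) % 2) = (1 + (m + n) % 2) * n := mul_comm _ _
  unfold vqInf wqInf
  rw [hN']
  generalize ((Real.sqrt (m * n) : ℝ) : ℂ) = s at *
  generalize (m + n) * (1 + (m + n) % 2) / 2 = K at *
  generalize (1 + (m + n) % 2) * m = M at *
  generalize (1 + (m + n) % 2) * n = N at *
  have hM1 : t ^ M * z ^ M = 1 := by rw [← mul_pow, hzt, one_pow]
  have hN1 : t ^ N * z ^ N = 1 := by rw [← mul_pow, hzt, one_pow]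
  have hK1 : t ^ K * z ^ K = 1 := by rw [← mul_pow, hzt, one_pow]
  have ht2 : t ^ M * t ^ N = t ^ K * t ^ K := by rw [← pow_add, ← pow_add]; congr 1; omega
  have hz2 : z ^ M * z ^ N = z ^ K * z ^ K := by rw [← pow_add, ← pow_add]; congr 1; omega
  have e1 : t ^ M * z ^ K = t ^ K * z ^ N := by
    linear_combination t ^ K * z ^ N * hK1 + z ^ K * z ^ N * ht2 - t ^ M * z ^ K * hN1
  have e2 : z ^ M * t ^ K = z ^ K * t ^ N := by
    linear_combination z ^ K * t ^ N * hK1 + t ^ K * t ^ N * hz2 - z ^ M * t ^ K * hN1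
  fin_cases i <;> simp [symp, vec4]
  · linear_combination (-(m + n : ℂ) ^ 2) * hM1 - 4 * Complex.I ^ 2 * s ^ 2 * hK1
      - 4 * s ^ 2 * hI + 4 * hs
  · linear_combination (-2 * Complex.I * s * (m + n)) * e2
  · linear_combination (-2 * Complex.I * s * (m + n)) * e1
  · linear_combination (-(m + n : ℂ) ^ 2) * hN1 - 4 * Complex.I ^ 2 * s ^ 2 * hK1
      - 4 * s ^ 2 * hI + 4 * hs

lemma wCurve_eq_span_inf {q : ℚ} (hq : 1 < q) {y : OnePoint ℂ} (hy : y ≠ ((0 : ℂ) : OnePoint ℂ)) :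
    (wCurve q hq y).1 = Submodule.span ℂ
      {vqInf q.num.toNat q.den (RiemannSphere.chartInfty y),
        wqInf q.num.toNat q.den (RiemannSphere.chartInfty y)} := by
  have hmn := num_sub_den_ne_zero hq
  have hnum : 0 < q.num := Rat.num_pos.2 (by linarith)
  rw [RiemannSphere.chartInfty_apply]
  induction y using OnePoint.rec with
  | infty =>
    rw [RiemannSphere.invFun_infty, RiemannSphere.chartZero_coe]
    exact span_inf_zero hmn (by omega) q.den_pos
  | coe z =>
    have hz : z ≠ 0 := fun h => hy (by rw [h])
    rw [RiemannSphere.invFun_coe hz, RiemannSphere.chartZero_coe]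
    exact span_inf_eq hmn (inv_mul_cancel₀ hz)

lemma wCurve_eq_span {q : ℚ} (hq : 1 < q) {y : OnePoint ℂ} (hy : y ≠ OnePoint.infty) :
    (wCurve q hq y).1 = Submodule.span ℂ
      {vq q.num.toNat q.den (RiemannSphere.chartZero y),
        wq q.num.toNat q.den (RiemannSphere.chartZero y)} := by
  induction y using OnePoint.rec with
  | infty => exact absurd rfl hy
  | coe z => rw [RiemannSphere.chartZero_coe]; rfl

lemma differentiable_vec4 {a b c d : ℂ → ℂ} (ha : Differentiable ℂ a) (hb : Differentiable ℂ b)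
    (hc : Differentiable ℂ c) (hd : Differentiable ℂ d) :
    Differentiable ℂ (fun z => vec4 (a z) (b z) (c z) (d z)) := by
  refine differentiable_pi.2 fun i => ?_
  rcases i with i | i <;> fin_cases i <;> simpa [vec4]

lemma differentiable_vq (m n : ℕ) : Differentiable ℂ (vq m n) := by
  unfold vq; apply differentiable_vec4 <;> fun_prop

lemma differentiable_wq (m n : ℕ) : Differentiable ℂ (wq m n) := by
  unfold wq; apply differentiable_vec4 <;> fun_prop

lemma differentiable_vqInf (m n : ℕ) : Differentiable ℂ (vqInf m n) := by
  unfold vqInf; apply differentiable_vec4 <;> fun_prop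

lemma differentiable_wqInf (m n : ℕ) : Differentiable ℂ (wqInf m n) := by
  unfold wqInf; apply differentiable_vec4 <;> fun_prop

lemma act_eq_span (X : Sp2) {P : Q3} {u v : Idx → ℂ} (h : P.1 = Submodule.span ℂ {u, v}) :
    (act X P).1 = Submodule.span ℂ {X.1.mulVec u, X.1.mulVec v} := by
  show P.1.map X.1.mulVecLin = _
  rw [h, Submodule.map_span, Set.image_pair]
  rfl

lemma isHolomorphic_act_wCurve {S : Type*} [TopologicalSpace S] [ChartedSpace ℂ S]
    [IsManifold 𝓘(ℂ) ω S] {q : ℚ} (hq : 1 < q) (X : Sp2) {h : S → OnePoint ℂ}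
    (hh : MDifferentiable 𝓘(ℂ) 𝓘(ℂ) h) : IsHolomorphic fun x => act X (wCurve q hq (h x)) := by
  -- One argument for both charts of the sphere: near ∞ the spanning vectors in the coordinate 1/z
  -- are used.
  have key : ∀ (V : Set (OnePoint ℂ)) (c : OnePoint ℂ → ℂ) (u v : ℂ → Idx → ℂ), IsOpen V →
      (∀ y ∈ V, MDifferentiableAt 𝓘(ℂ) 𝓘(ℂ) c y) → Differentiable ℂ u → Differentiable ℂ v →
      (∀ y ∈ V, (wCurve q hq y).1 = Submodule.span ℂ {u (c y), v (c y)}) → ∀ p, h p ∈ V →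
      ∃ e ∈ IsManifold.maximalAtlas 𝓘(ℂ) ω S, p ∈ e.source ∧ ∃ u v : ℂ → Idx → ℂ,
        DifferentiableOn ℂ u e.target ∧ DifferentiableOn ℂ v e.target ∧
        ∀ x ∈ e.source, (act X (wCurve q hq (h x))).1 = Submodule.span ℂ {u (e x), v (e x)} := by
    intro V c u v hV hc hu hv hs p hp
    have ho : IsOpen (h ⁻¹' V) := hV.preimage hh.continuous
    set e := (chartAt ℂ p).restr (h ⁻¹' V) with he_def
    have he : e ∈ IsManifold.maximalAtlas 𝓘(ℂ) ω S :=
      restr_mem_maximalAtlas _ (IsManifold.chart_mem_maximalAtlas p) ho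
    have hsrc : e.source = (chartAt ℂ p).source ∩ h ⁻¹' V := by
      rw [he_def, OpenPartialHomeomorph.restr_source, ho.interior_eq]
    have hd : ∀ z ∈ e.target, DifferentiableAt ℂ (fun z => c (h (e.symm z))) z := by
      intro z hz
      have hx := e.map_target hz
      rw [hsrc] at hx
      rw [← mdifferentiableAt_iff_differentiableAt]
      have h1 : MDifferentiableAt 𝓘(ℂ) 𝓘(ℂ) (fun z => h (e.symm z)) z :=
        (hh _).comp z ((contMDiffAt_symm_of_mem_maximalAtlas he hz).mdifferentiableAt (by simp))
      exact (hc _ hx.2).comp z h1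
    have hlin : ∀ w : ℂ → Idx → ℂ, Differentiable ℂ w →
        DifferentiableOn ℂ (fun z => X.1.mulVec (w (c (h (e.symm z))))) e.target := by
      intro w hw z hz
      have h1 : DifferentiableAt ℂ (fun z => w (c (h (e.symm z)))) z :=
        (hw _).comp z (hd z hz)
      exact ((LinearMap.toContinuousLinearMap X.1.mulVecLin).differentiableAt.comp z
        h1).differentiableWithinAt
    refine ⟨e, he, by rw [hsrc]; exact ⟨mem_chart_source ℂ p, hp⟩, _, _, hlin u hu, hlin v hv,
      fun x hx => ?_⟩
    rw [e.left_inv hx]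
    rw [hsrc] at hx
    exact act_eq_span X (hs _ hx.2)
  intro p
  by_cases hp : h p = OnePoint.infty
  · refine key {((0 : ℂ) : OnePoint ℂ)}ᶜ RiemannSphere.chartInfty _ _ isOpen_compl_singleton
      (fun y hy => mdifferentiableAt_chartInfty hy) (differentiable_vqInf q.num.toNat q.den)
      (differentiable_wqInf q.num.toNat q.den) (fun y hy => wCurve_eq_span_inf hq hy) p ?_
    rw [hp]
    exact OnePoint.infty_ne_coe 0
  · exact key {OnePoint.infty}ᶜ RiemannSphere.chartZero _ _ isOpen_compl_singleton
      (fun y hy => mdifferentiableAt_chartZero hy) (differentiable_vq q.num.toNat q.den)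
      (differentiable_wq q.num.toNat q.den) (fun y hy => wCurve_eq_span hq hy) p hp

/-! ### Classes modulo the dihedral group -/

/-- The hypothesis says u = ±v or u = ±1/v. Working with squares makes the choices of square roots
in r(κ) irrelevant. -/
lemma cls_eq_of_sq {u v : ℂˣ} (h : (u : ℂ) ^ 2 = v ^ 2 ∨ (u : ℂ) ^ 2 * v ^ 2 = 1) :
    cls u = cls v := by
  have hinv : Equiv.inv ℂˣ ∈ dihedral := Subgroup.subset_closure (by simp)
  have hneg : Equiv.neg ℂˣ ∈ dihedral := Subgroup.subset_closure (by simp)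
  have hact : ∀ g ∈ dihedral, u = g v → cls u = cls v := by
    intro g hg huv
    refine Quotient.sound ?_
    exact ⟨⟨g, hg⟩, huv.symm⟩
  rcases h with h | h
  · rcases sq_eq_sq_iff_eq_or_eq_neg.1 h with h | h
    · rw [Units.ext h]
    · exact hact _ hneg (Units.ext (by simpa using h))
  · rw [← mul_pow] at h
    rcases sq_eq_sq_iff_eq_or_eq_neg.1 (h.trans (one_pow 2).symm) with h | h
    · exact hact _ hinv (Units.ext (by simpa using eq_inv_of_mul_eq_one_left h))
    · refine hact _ (mul_mem hneg hinv) (Units.ext ?_)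
      have hv : (v : ℂ) ≠ 0 := v.ne_zero
      simp [Equiv.Perm.mul_apply]
      field_simp
      linear_combination h

/-- The function u² + u⁻² is invariant under both generators. As it separates real numbers greater
than 1, a class contains at most one of these. -/
lemma sq_add_inv_sq_of_cls_eq {u v : ℂˣ} (h : cls u = cls v) :
    (u : ℂ) ^ 2 + ((u : ℂ) ^ 2)⁻¹ = (v : ℂ) ^ 2 + ((v : ℂ) ^ 2)⁻¹ := by
  obtain ⟨⟨g, hg⟩, rfl⟩ : u ∈ MulAction.orbit dihedral v := Quotient.exact h
  have : ∀ w : ℂˣ, ((g w : ℂˣ) : ℂ) ^ 2 + (((g w : ℂˣ) : ℂ) ^ 2)⁻¹ = (w : ℂ) ^ 2 + ((w : ℂ) ^ 2)⁻¹ := by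
    refine Subgroup.closure_induction (p := fun g _ => ∀ w : ℂˣ,
      ((g w : ℂˣ) : ℂ) ^ 2 + (((g w : ℂˣ) : ℂ) ^ 2)⁻¹ = (w : ℂ) ^ 2 + ((w : ℂ) ^ 2)⁻¹)
      ?_ ?_ ?_ ?_ hg
    · rintro g (rfl | rfl) w
      · simp [add_comm]
      · simp
    · simp
    · intro a b _ _ ha hb w
      rw [Equiv.Perm.mul_apply, ha, hb]
    · intro a _ ha w
      rw [← ha, show a (a⁻¹ w) = w from a.apply_symm_apply w]
  exact this v

lemma eq_of_sq_add_inv_sq {x y : ℝ} (hx : 1 < x) (hy : 1 < y)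
    (h : x ^ 2 + (x ^ 2)⁻¹ = y ^ 2 + (y ^ 2)⁻¹) : x = y := by
  have hx0 : x ≠ 0 := by positivity
  have hy0 : y ≠ 0 := by positivity
  field_simp at h
  have h1 : (x ^ 2 - y ^ 2) * (x ^ 2 * y ^ 2 - 1) = 0 := by linear_combination h
  rcases mul_eq_zero.1 h1 with h2 | h2
  · exact (sq_eq_sq₀ (by positivity) (by positivity)).1 (sub_eq_zero.1 h2)
  · exfalso
    have h3 : 1 < x * y := by nlinarith
    nlinarith [mul_pos (show 0 < x by linarith) (show 0 < y by linarith)]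

/-! ### Eigenvectors of the constant coefficient matrix -/

/-- The `l`-eigenvector of the coefficient matrix `redMat flatScale 0 (4 T / flatScale) …` of a
constant frame, where `l⁴ - 10 T l² + 9 T² + 1 = 0`. -/
def eigenvec (T l : ℂ) : Idx → ℂ :=
  vec4 (l ^ 3 - 7 * T * l) (flatScale * (l ^ 2 - 3 * T)) (-flatScale ^ 3) (flatScale ^ 2 * l)

/-- The derivative of `eigenvec T l` in `l`: a generalized eigenvector for a double eigenvalue. -/
def eigenvecDeriv (T l : ℂ) : Idx → ℂ :=
  vec4 (3 * l ^ 2 - 7 * T) (2 * flatScale * l) 0 (flatScale ^ 2)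

/-- Three of the rows hold for every l; only the first one needs l to be a root of the
characteristic polynomial. -/
lemma redMat_mulVec_eigenvec {T l : ℂ} (hl : l ^ 4 - 10 * T * l ^ 2 + 9 * T ^ 2 + 1 = 0) :
    (redMat flatScale 0 (4 * T / flatScale) (flatScale ^ 3)⁻¹).mulVec (eigenvec T l) =
      l • eigenvec T l := by
  have hp := flatScale_ne_zero
  unfold eigenvec
  generalize flatScale = p at *
  ext i
  rcases i with i | i <;> fin_cases i <;>
    simp [redMat, vec4, Matrix.mulVec, dotProduct, Fintype.sum_sum_type] <;> field_simp
  · linear_combination -hl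
  · ring
  · ring

/-- Let χ be the characteristic polynomial. Differentiate M w_l = l w_l - χ(l) e₁, valid for every
l, with respect to l: the error term is χ'(l), which vanishes at a double root. -/
lemma redMat_mulVec_eigenvecDeriv {T l : ℂ} (hl : 4 * l ^ 3 - 20 * T * l = 0) :
    (redMat flatScale 0 (4 * T / flatScale) (flatScale ^ 3)⁻¹).mulVec (eigenvecDeriv T l) =
      l • eigenvecDeriv T l + eigenvec T l := by
  have hp := flatScale_ne_zero
  unfold eigenvecDeriv eigenvec
  generalize flatScale = p at *
  ext i
  rcases i with i | i <;> fin_cases i <;>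
    simp [redMat, vec4, Matrix.mulVec, dotProduct, Fintype.sum_sum_type] <;> field_simp
  · linear_combination -hl
  · ring
  · ring

/-- The minor of `(w, w')` on its third and fourth coordinates. -/
def minor (w w' : Idx → ℂ) : ℂ := w i3 * w' i4 - w' i3 * w i4

/-- The frame preserves ω, so pairing B w with the columns B e₁, B e₂ only sees the third and fourth
coordinates of w. -/
lemma symp_frame_col {B : Matrix Idx Idx ℂ} (hB : B ∈ Matrix.symplecticGroup (Fin 2) ℂ)
    {w c : Idx → ℂ} {l : ℂ} (h : B.mulVec w = Complex.exp l • c) :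
    symp c (B.transpose i1) = -(Complex.exp (-l) * w i3) ∧
      symp c (B.transpose i2) = -(Complex.exp (-l) * w i4) := by
  have hc : c = Complex.exp (-l) • B.mulVec w := by
    rw [h, smul_smul, ← Complex.exp_add]; simp
  have hcol : ∀ j, B.transpose j = B.mulVec (Pi.single j 1) := fun j => by
    rw [Matrix.mulVec_single_one]; rfl
  have h2 := symp_mulVec ⟨B, hB⟩ w
  constructor
  · rw [hc, symp_smul_left, hcol, h2]; simp [symp]
  · rw [hc, symp_smul_left, hcol, h2]; simp [symp]

lemma pl_frame_cols {B : Matrix Idx Idx ℂ} (hB : B ∈ Matrix.symplecticGroup (Fin 2) ℂ)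
    {w w' c c' : Idx → ℂ} {l l' : ℂ} (h : B.mulVec w = Complex.exp l • c)
    (h' : B.mulVec w' = Complex.exp l' • c') :
    pl c c' (B.transpose i1) (B.transpose i2) = Complex.exp (-(l + l')) * minor w w' := by
  obtain ⟨h1, h2⟩ := symp_frame_col hB h
  obtain ⟨h3, h4⟩ := symp_frame_col hB h'
  rw [pl, h1, h2, h3, h4, minor, neg_add, Complex.exp_add]
  ring

lemma symp_eq_of_frame {B : Matrix Idx Idx ℂ} (hB : B ∈ Matrix.symplecticGroup (Fin 2) ℂ)
    {w w' c c' : Idx → ℂ} {l l' : ℂ} (h : B.mulVec w = Complex.exp l • c)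
    (h' : B.mulVec w' = Complex.exp l' • c') :
    symp c c' = Complex.exp (-(l + l')) * symp w w' := by
  have h2 := symp_mulVec ⟨B, hB⟩ w w'
  simp only [h, h', symp_smul_left, symp_smul_right] at h2
  rw [← h2, neg_add, Complex.exp_add, Complex.exp_neg, Complex.exp_neg]
  field_simp

lemma minor_eigenvec (T l m : ℂ) :
    minor (eigenvec T l) (eigenvec T m) = flatScale ^ 5 * (l - m) := by
  simp [minor, eigenvec, vec4]; ring

lemma minor_eigenvec_deriv (T l z : ℂ) :
    minor (eigenvec T l) (eigenvecDeriv T l - z • eigenvec T l) = -flatScale ^ 5 := by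
  simp [minor, eigenvec, eigenvecDeriv, vec4]; ring

lemma minor_deriv_eigenvec (T l m z : ℂ) :
    minor (eigenvecDeriv T l - z • eigenvec T l) (eigenvec T m) =
      flatScale ^ 5 * (1 + z * (m - l)) := by
  simp [minor, eigenvec, eigenvecDeriv, vec4]; ring

lemma symp_eigenvec (T l m : ℂ) : symp (eigenvec T l) (eigenvec T m) =
    flatScale ^ 3 * ((l - m) * (10 * T - l ^ 2 - m ^ 2)) := by
  simp [symp, eigenvec, vec4]; ring

lemma mem_symplecticGroup_of_symp {X : Matrix Idx Idx ℂ}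
    (h12 : symp (X.transpose i1) (X.transpose i2) = 0)
    (h13 : symp (X.transpose i1) (X.transpose i3) = 1)
    (h14 : symp (X.transpose i1) (X.transpose i4) = 0)
    (h23 : symp (X.transpose i2) (X.transpose i3) = 0)
    (h24 : symp (X.transpose i2) (X.transpose i4) = 1)
    (h34 : symp (X.transpose i3) (X.transpose i4) = 0) :
    X ∈ Matrix.symplecticGroup (Fin 2) ℂ := by
  rw [SymplecticGroup.mem_iff']
  have key : ∀ i j, (X.transpose * Matrix.J (Fin 2) ℂ * X) i j =
      -symp (X.transpose i) (X.transpose j) := by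
    intro i j
    rw [symp_eq, neg_neg, Matrix.mul_assoc]
    rfl
  have hswap : ∀ x y, symp x y = -symp y x := fun x y => by simp only [symp]; ring
  have hself : ∀ x, symp x x = 0 := fun x => by simp only [symp]; ring
  ext i j
  rw [key]
  rcases i with i | i <;> rcases j with j | j <;> fin_cases i <;> fin_cases j <;>
    simp [Matrix.J]
  · exact hself _
  · exact h12
  · rw [hswap, h12, neg_zero]
  · exact hself _
  · exact h13
  · exact h14
  · exact h23
  · exact h24
  · rw [hswap, h13, neg_neg]
  · rw [hswap, h23, neg_zero]
  · rw [hswap, h14, neg_zero]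
  · rw [hswap, h24, neg_neg]
  · exact hself _
  · exact h34
  · rw [hswap, h34, neg_zero]
  · exact hself _

/-! ### Curves with constant bending -/

section Bending

variable {S : Type*} [TopologicalSpace S] [ChartedSpace ℂ S] {f : S → Q3}
  {e : OpenPartialHomeomorph S ℂ} {A : ℂ → Matrix Idx Idx ℂ} {T : ℂ}

/-- A symplectic frame over a disk whose coefficient matrix is constant, in the normal form of a
curve with constant bending `16 T²`. -/
structure IsConstantFrame (f : S → Q3) (e : OpenPartialHomeomorph S ℂ)
    (A : ℂ → Matrix Idx Idx ℂ) (T : ℂ) : Prop extends IsSymplecticFrame f e A where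
  nonempty : e.source.Nonempty
  ball : ∃ z₀ R, e.target = ball z₀ R
  mc_eq : ∀ z ∈ e.target, mc A z = redMat flatScale 0 (4 * T / flatScale) (flatScale ^ 3)⁻¹

lemma IsConstantFrame.exists_const (hA : IsConstantFrame f e A T) {l : ℂ}
    (hl : l ^ 4 - 10 * T * l ^ 2 + 9 * T ^ 2 + 1 = 0) :
    ∃ c, ∀ z ∈ e.target, (A z).mulVec (eigenvec T l) = Complex.exp (l * z) • c := by
  obtain ⟨z₀, R, hb⟩ := hA.ball
  obtain ⟨c, hc⟩ := exists_const_vector (z₀ := z₀) (R := R) (v := 0) (v' := eigenvec T l)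
    (l := l) (fun z hz => hA.mc_eq z (hb ▸ hz) ▸ hA.hasMatDeriv (hb ▸ hz)) (by simp)
    (by rw [redMat_mulVec_eigenvec hl, add_zero])
  exact ⟨c, fun z hz => by simpa using hc z (hb ▸ hz)⟩

lemma IsConstantFrame.exists_const_deriv (hA : IsConstantFrame f e A T) {l : ℂ}
    (hl : l ^ 4 - 10 * T * l ^ 2 + 9 * T ^ 2 + 1 = 0) (hl' : 4 * l ^ 3 - 20 * T * l = 0) :
    ∃ c, ∀ z ∈ e.target,
      (A z).mulVec (eigenvecDeriv T l - z • eigenvec T l) = Complex.exp (l * z) • c := by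
  obtain ⟨z₀, R, hb⟩ := hA.ball
  obtain ⟨c, hc⟩ := exists_const_vector (z₀ := z₀) (R := R)
    (fun z hz => hA.mc_eq z (hb ▸ hz) ▸ hA.hasMatDeriv (hb ▸ hz)) (redMat_mulVec_eigenvec hl)
    (redMat_mulVec_eigenvecDeriv hl')
  exact ⟨c, fun z hz => hc z (hb ▸ hz)⟩

/-- The bridge between the global and the local picture: the left side is meromorphic on S, the
right side is explicit on the disk. The vectors wᵢ may depend on z, as those from a Jordan chain do.
-/
lemma IsSymplecticFrame.plRatio_eq (hA : IsSymplecticFrame f e A) {z : ℂ} (hz : z ∈ e.target)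
    {w₁ w₂ w₃ w₄ c₁ c₂ c₃ c₄ : Idx → ℂ} {l₁ l₂ l₃ l₄ : ℂ}
    (h₁ : (A z).mulVec w₁ = Complex.exp (l₁ * z) • c₁)
    (h₂ : (A z).mulVec w₂ = Complex.exp (l₂ * z) • c₂)
    (h₃ : (A z).mulVec w₃ = Complex.exp (l₃ * z) • c₃)
    (h₄ : (A z).mulVec w₄ = Complex.exp (l₄ * z) • c₄) :
    plRatio c₁ c₂ c₃ c₄ (f (e.symm z)) =
      minor w₁ w₂ / minor w₃ w₄ * Complex.exp ((l₃ + l₄ - l₁ - l₂) * z) := by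
  have hs := hA.span _ (e.map_target hz)
  rw [e.right_inv hz] at hs
  have hB := hA.mem z hz
  rw [IsotropicCurves.plRatio_eq hs, pl_frame_cols hB h₁ h₂, pl_frame_cols hB h₃ h₄,
    show (l₃ + l₄ - l₁ - l₂) * z = -(l₁ * z + l₂ * z) + -(-(l₃ * z + l₄ * z)) by ring,
    Complex.exp_add, Complex.exp_neg (-(l₃ * z + l₄ * z))]
  rw [mul_div_mul_comm]
  ring

/-- Let c, c' come from the Jordan chain at the double root l and d from the other root m. Then
pl(c, c')/pl(c, d) is a multiple of e^{(m-l)z} and pl(c', d)/pl(c, d) is -z plus a constant, which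
cannot both be meromorphic on S. -/
lemma IsConstantFrame.false_of_double_root [T2Space S] [CompactSpace S] [ConnectedSpace S]
    [IsManifold 𝓘(ℂ) ω S] (hA : IsConstantFrame f e A T) (hf : IsHolomorphic f) {l m : ℂ}
    (hl : l ^ 4 - 10 * T * l ^ 2 + 9 * T ^ 2 + 1 = 0) (hl' : 4 * l ^ 3 - 20 * T * l = 0)
    (hm : m ^ 4 - 10 * T * m ^ 2 + 9 * T ^ 2 + 1 = 0) (hlm : m - l ≠ 0) : False := by
  obtain ⟨c, hc⟩ := hA.exists_const hl
  obtain ⟨c', hc'⟩ := hA.exists_const_deriv hl hl'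
  obtain ⟨d, hd⟩ := hA.exists_const hm
  have hp := flatScale_ne_zero
  have hlm' : l - m ≠ 0 := fun h => hlm (by linear_combination -h)
  refine IsMero.not_exp_and_linear (hf.isMero_plRatio c c' c d) (hf.isMero_plRatio c' d c d)
    hA.chart hA.nonempty (C := -(l - m)⁻¹) (m := m - l) (c := (l - m)⁻¹)
    (neg_ne_zero.2 (inv_ne_zero hlm')) hlm (fun z hz => ?_) (fun z hz => ?_)
  · rw [hA.plRatio_eq hz (hc z hz) (hc' z hz) (hc z hz) (hd z hz), minor_eigenvec,
      minor_eigenvec_deriv, show l + m - l - l = m - l by ring]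
    congr 1
    field_simp
  · rw [hA.plRatio_eq hz (hc' z hz) (hd z hz) (hc z hz) (hd z hz), minor_eigenvec,
      minor_deriv_eigenvec, show l + m - l - m = 0 by ring, zero_mul, Complex.exp_zero]
    field_simp
    ring

/-- The roots satisfy l² = 5T ± √(16T² - 1). For 16T² = 1 both square roots of 5T are double roots;
for 9T² + 1 = 0 the double root is 0, and another root is a square root of 10T. -/
lemma IsConstantFrame.isRegularValue [T2Space S] [CompactSpace S] [ConnectedSpace S]
    [IsManifold 𝓘(ℂ) ω S] (hA : IsConstantFrame f e A T) (hf : IsHolomorphic f) : IsRegularValue (16 * T ^ 2) := by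
  constructor
  · intro h
    obtain ⟨α, hα⟩ : ∃ α : ℂ, α ^ 2 = 5 * T := ⟨csqrt (5 * T), csqrt_sq _⟩
    have hα0 : α ≠ 0 := by
      rintro rfl
      have : T = 0 := by linear_combination (-1 / 5) * hα
      rw [this] at h; norm_num at h
    refine hA.false_of_double_root hf (l := α) (m := -α) ?_ ?_ ?_ ?_
    · linear_combination (α ^ 2 - 5 * T) * hα - h
    · linear_combination 4 * α * hα
    · linear_combination (α ^ 2 - 5 * T) * hα - h
    · intro h0; exact hα0 (by linear_combination (-1 / 2) * h0)
  · intro h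
    obtain ⟨α, hα⟩ : ∃ α : ℂ, α ^ 2 = 10 * T := ⟨csqrt (10 * T), csqrt_sq _⟩
    refine hA.false_of_double_root hf (l := 0) (m := α) ?_ ?_ ?_ ?_
    · linear_combination (9 / 16) * h
    · ring
    · linear_combination α ^ 2 * hα + (9 / 16) * h
    · intro h0
      have h1 : α = 0 := by simpa using h0
      have : T = 0 := by rw [h1] at hα; linear_combination (-1 / 10) * hα
      rw [this] at h; norm_num at h

end Bending

/-! ### Roots of the characteristic quartic, rationality and domination -/

lemma exists_quartic_roots (T : ℂ) :
    ∃ α β : ℂ, α ^ 2 + β ^ 2 = 10 * T ∧ α ^ 2 * β ^ 2 = 9 * T ^ 2 + 1 := by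
  have hd := csqrt_sq (16 * T ^ 2 - 1)
  refine ⟨csqrt (5 * T + csqrt (16 * T ^ 2 - 1)), csqrt (5 * T - csqrt (16 * T ^ 2 - 1)), ?_, ?_⟩
  · rw [csqrt_sq, csqrt_sq]; ring
  · rw [csqrt_sq, csqrt_sq]; linear_combination -hd

lemma quartic_root_left {α β T : ℂ} (hs : α ^ 2 + β ^ 2 = 10 * T)
    (hp : α ^ 2 * β ^ 2 = 9 * T ^ 2 + 1) : α ^ 4 - 10 * T * α ^ 2 + 9 * T ^ 2 + 1 = 0 := by
  linear_combination α ^ 2 * hs - hp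

lemma quartic_root_right {α β T : ℂ} (hs : α ^ 2 + β ^ 2 = 10 * T)
    (hp : α ^ 2 * β ^ 2 = 9 * T ^ 2 + 1) : β ^ 4 - 10 * T * β ^ 2 + 9 * T ^ 2 + 1 = 0 := by
  linear_combination β ^ 2 * hs - hp

lemma quartic_root_neg {l T : ℂ} (h : l ^ 4 - 10 * T * l ^ 2 + 9 * T ^ 2 + 1 = 0) :
    (-l) ^ 4 - 10 * T * (-l) ^ 2 + 9 * T ^ 2 + 1 = 0 := by
  linear_combination h

lemma quartic_roots_sq_ne {α β T : ℂ} (hs : α ^ 2 + β ^ 2 = 10 * T)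
    (hp : α ^ 2 * β ^ 2 = 9 * T ^ 2 + 1) (hT : IsRegularValue (16 * T ^ 2)) :
    α ^ 2 ≠ β ^ 2 := by
  intro h
  exact hT.1 (by linear_combination (-(α ^ 2 + β ^ 2 + 10 * T) / 4) * hs + hp +
    ((α ^ 2 - β ^ 2) / 4) * h)

lemma quartic_roots_ne_zero {α β T : ℂ} (hp : α ^ 2 * β ^ 2 = 9 * T ^ 2 + 1)
    (hT : IsRegularValue (16 * T ^ 2)) : α ≠ 0 ∧ β ≠ 0 := by
  constructor
  · rintro rfl
    exact hT.2 (by linear_combination (-16 / 9) * hp)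
  · rintro rfl
    exact hT.2 (by linear_combination (-16 / 9) * hp)

/-- Since c² = 16T², one has 5c = ±2(α² + β²) and 4√(c² - 1) = ±2(α² - β²). The quotient under the
root is therefore α²/β² or its inverse, according to the signs. -/
lemma rNum_sq {α β T : ℂ} (hs : α ^ 2 + β ^ 2 = 10 * T)
    (hp : α ^ 2 * β ^ 2 = 9 * T ^ 2 + 1) (hα : α ≠ 0) (hβ : β ≠ 0) :
    rNum (16 * T ^ 2) ^ 2 = (α / β) ^ 2 ∨ rNum (16 * T ^ 2) ^ 2 = (β / α) ^ 2 := by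
  rw [rNum]
  simp only [csqrt_sq]
  have hc := csqrt_sq (16 * T ^ 2)
  have hd := csqrt_sq (16 * T ^ 2 - 1)
  generalize csqrt (16 * T ^ 2) = c at *
  generalize csqrt (16 * T ^ 2 - 1) = d at *
  have h1 : (5 * c) ^ 2 = (2 * (α ^ 2 + β ^ 2)) ^ 2 := by
    linear_combination 25 * hc - 4 * (α ^ 2 + β ^ 2 + 10 * T) * hs
  have h2 : (4 * d) ^ 2 = (2 * (α ^ 2 - β ^ 2)) ^ 2 := by
    linear_combination 16 * hd - 4 * (α ^ 2 + β ^ 2 + 10 * T) * hs + 16 * hp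
  have hα2 : α ^ 2 ≠ 0 := pow_ne_zero _ hα
  have hβ2 : β ^ 2 ≠ 0 := pow_ne_zero _ hβ
  rcases sq_eq_sq_iff_eq_or_eq_neg.1 h1 with h1 | h1 <;>
    rcases sq_eq_sq_iff_eq_or_eq_neg.1 h2 with h2 | h2 <;> rw [h1, h2]
  · right
    rw [show 2 * (α ^ 2 + β ^ 2) - 2 * (α ^ 2 - β ^ 2) = 4 * β ^ 2 by ring,
      show 2 * (α ^ 2 + β ^ 2) + 2 * (α ^ 2 - β ^ 2) = 4 * α ^ 2 by ring, div_pow,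
      mul_div_mul_left _ _ (by norm_num)]
  · left
    rw [show 2 * (α ^ 2 + β ^ 2) - -(2 * (α ^ 2 - β ^ 2)) = 4 * α ^ 2 by ring,
      show 2 * (α ^ 2 + β ^ 2) + -(2 * (α ^ 2 - β ^ 2)) = 4 * β ^ 2 by ring, div_pow,
      mul_div_mul_left _ _ (by norm_num)]
  · left
    rw [show -(2 * (α ^ 2 + β ^ 2)) - 2 * (α ^ 2 - β ^ 2) = -4 * α ^ 2 by ring,
      show -(2 * (α ^ 2 + β ^ 2)) + 2 * (α ^ 2 - β ^ 2) = -4 * β ^ 2 by ring, div_pow,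
      mul_div_mul_left _ _ (by norm_num)]
  · right
    rw [show -(2 * (α ^ 2 + β ^ 2)) - -(2 * (α ^ 2 - β ^ 2)) = -4 * β ^ 2 by ring,
      show -(2 * (α ^ 2 + β ^ 2)) + -(2 * (α ^ 2 - β ^ 2)) = -4 * α ^ 2 by ring, div_pow,
      mul_div_mul_left _ _ (by norm_num)]

/-- Coprimality of the exponents of e^{2αz} and e^{(α+β)z} as powers of e^{σz} is what allows e^{σz}
to be recovered from these two functions. -/
lemma coprime_exponents {m n : ℕ} (h : m.Coprime n) :
    ((1 + (m + n) % 2) * m).Coprime ((m + n) * (1 + (m + n) % 2) / 2) := by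
  have h1 : m.Coprime (m + n) := by simpa using h
  rcases Nat.mod_two_eq_zero_or_one (m + n) with h2 | h2
  · rw [h2, add_zero, one_mul, mul_one]
    exact h1.coprime_dvd_right (Nat.div_dvd_of_dvd (Nat.dvd_of_mod_eq_zero h2))
  · rw [h2, one_add_one_eq_two, Nat.mul_div_cancel _ two_pos]
    exact (Nat.coprime_two_left.2 (Nat.odd_iff.2 h2)).mul_left h1

lemma symp_mulVec_vec4 (x : Idx → ℂ) (X : Matrix Idx Idx ℂ) (a b c d : ℂ) :
    symp x (X.mulVec (vec4 a b c d)) = a * symp x (X.transpose i1) + b * symp x (X.transpose i2) +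
      c * symp x (X.transpose i3) + d * symp x (X.transpose i4) := by
  simp [symp, vec4, Matrix.mulVec, dotProduct, Fintype.sum_sum_type]
  ring

section Bending

variable {S : Type*} [TopologicalSpace S] [ChartedSpace ℂ S] {f : S → Q3}
  {e : OpenPartialHomeomorph S ℂ} {A : ℂ → Matrix Idx Idx ℂ} {T : ℂ}

lemma IsConstantFrame.exists_isMero_exp [IsManifold 𝓘(ℂ) ω S] (hA : IsConstantFrame f e A T)
    (hf : IsHolomorphic f) {l₁ l₂ l₃ l₄ : ℂ}
    (h₁ : l₁ ^ 4 - 10 * T * l₁ ^ 2 + 9 * T ^ 2 + 1 = 0)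
    (h₂ : l₂ ^ 4 - 10 * T * l₂ ^ 2 + 9 * T ^ 2 + 1 = 0)
    (h₃ : l₃ ^ 4 - 10 * T * l₃ ^ 2 + 9 * T ^ 2 + 1 = 0)
    (h₄ : l₄ ^ 4 - 10 * T * l₄ ^ 2 + 9 * T ^ 2 + 1 = 0) (h₁₂ : l₁ ≠ l₂) (h₃₄ : l₃ ≠ l₄) :
    ∃ F : S → ℂ, IsMero F ∧
      ∀ z ∈ e.target, F (e.symm z) = Complex.exp ((l₃ + l₄ - l₁ - l₂) * z) := by
  obtain ⟨c₁, hc₁⟩ := hA.exists_const h₁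
  obtain ⟨c₂, hc₂⟩ := hA.exists_const h₂
  obtain ⟨c₃, hc₃⟩ := hA.exists_const h₃
  obtain ⟨c₄, hc₄⟩ := hA.exists_const h₄
  have hp := flatScale_ne_zero
  have h12 := sub_ne_zero.2 h₁₂
  have h34 := sub_ne_zero.2 h₃₄
  refine ⟨_, (IsMero.const ((l₃ - l₄) / (l₁ - l₂))).mul (hf.isMero_plRatio c₁ c₂ c₃ c₄),
    fun z hz => ?_⟩
  rw [hA.plRatio_eq hz (hc₁ z hz) (hc₂ z hz) (hc₃ z hz) (hc₄ z hz), minor_eigenvec,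
    minor_eigenvec]
  field_simp

lemma IsConstantFrame.exists_rat [T2Space S] [CompactSpace S] [ConnectedSpace S]
    [IsManifold 𝓘(ℂ) ω S] (hA : IsConstantFrame f e A T) (hf : IsHolomorphic f)
    (hT : IsRegularValue (16 * T ^ 2)) :
    ∃ (q : ℚ) (α β : ℂ), 1 < q ∧ α = q * β ∧ α ^ 2 + β ^ 2 = 10 * T ∧
      α ^ 2 * β ^ 2 = 9 * T ^ 2 + 1 := by
  obtain ⟨α, β, hs, hp⟩ := exists_quartic_roots T
  have hα := quartic_root_left hs hp
  have hβ := quartic_root_right hs hp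
  have hne := quartic_roots_sq_ne hs hp hT
  obtain ⟨hα0, hβ0⟩ := quartic_roots_ne_zero hp hT
  have h1 : α ≠ β := fun h => hne (by rw [h])
  have h2 : α ≠ -β := fun h => hne (by rw [h, neg_sq])
  obtain ⟨F₁, hF₁, hF₁e⟩ := hA.exists_isMero_exp hf (quartic_root_neg hα) hβ hα hβ
    (fun h => h2 (by rw [← h, neg_neg])) h1
  obtain ⟨F₂, hF₂, hF₂e⟩ := hA.exists_isMero_exp hf hα (quartic_root_neg hβ) hα hβ h2 h1
  obtain ⟨ρ, hρ⟩ := IsMero.exists_rat_of_exp hF₁ hF₂ hA.chart hA.nonempty (C₁ := 1) (C₂ := 1)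
    one_ne_zero one_ne_zero (a := 2 * α) (b := 2 * β) (mul_ne_zero two_ne_zero hβ0)
    (fun z hz => by rw [hF₁e z hz, one_mul]; congr 1; ring)
    (fun z hz => by rw [hF₂e z hz, one_mul]; congr 1; ring)
  have hαρ : α = ρ * β := by linear_combination (1 / 2) * hρ
  have hρ0 : ρ ≠ 0 := by rintro rfl; exact hα0 (by simpa using hαρ)
  have hsymm : β ^ 2 + α ^ 2 = 10 * T ∧ β ^ 2 * α ^ 2 = 9 * T ^ 2 + 1 := by
    rw [add_comm, mul_comm (β ^ 2)]; exact ⟨hs, hp⟩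
  have hcast : (ρ : ℂ) ≠ 0 := by exact_mod_cast hρ0
  -- Exchanging α and β inverts the ratio, and changing one sign negates it. As the ratio is neither
  -- 0 nor ±1, it can be made greater than 1.
  rcases lt_or_gt_of_ne hρ0 with h0 | h0
  · rcases lt_trichotomy ρ (-1) with h | h | h
    · exact ⟨-ρ, α, -β, by linarith, by rw [hαρ]; push_cast; ring, by rw [neg_sq]; exact hs,
        by rw [neg_sq]; exact hp⟩
    · exact absurd (by rw [hαρ, h]; push_cast; ring) h2
    · refine ⟨-ρ⁻¹, β, -α, ?_, by rw [hαρ]; push_cast; field_simp, by rw [neg_sq]; exact hsymm.1,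
        by rw [neg_sq]; exact hsymm.2⟩
      rw [← inv_neg]
      exact (one_lt_inv₀ (by linarith)).2 (by linarith)
  · rcases lt_trichotomy ρ 1 with h | h | h
    · exact ⟨ρ⁻¹, β, α, (one_lt_inv₀ h0).2 h, by rw [hαρ]; push_cast; field_simp, hsymm⟩
    · exact absurd (by rw [hαρ, h]; push_cast; ring) h1
    · exact ⟨ρ, α, β, h, hαρ, hs, hp⟩

/-- A symplectic matrix whose columns are multiples of the constant vectors of a constant frame. -/
lemma IsConstantFrame.exists_symplectic (hA : IsConstantFrame f e A T) {α β μ : ℂ}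
    (hs : α ^ 2 + β ^ 2 = 10 * T) (hp : α ^ 2 * β ^ 2 = 9 * T ^ 2 + 1)
    (hne : α ^ 2 ≠ β ^ 2) (hα0 : α ≠ 0) (hμ : μ ^ 2 * β = -α) :
    ∃ (X : Sp2) (k : ℂ), ∀ z ∈ e.target,
      (symp (X.1.transpose i1) ((A z).transpose i1) = -flatScale ^ 3 * k * Complex.exp (α * z) ∧
        symp (X.1.transpose i2) ((A z).transpose i1) =
          -flatScale ^ 3 * (μ * k) * Complex.exp (β * z) ∧
        symp (X.1.transpose i3) ((A z).transpose i1) =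
          flatScale ^ 3 * k * Complex.exp (-α * z) ∧
        symp (X.1.transpose i4) ((A z).transpose i1) =
          flatScale ^ 3 * (μ * k) * Complex.exp (-β * z)) ∧
      (symp (X.1.transpose i1) ((A z).transpose i2) =
          -flatScale ^ 2 * k * α * Complex.exp (α * z) ∧
        symp (X.1.transpose i2) ((A z).transpose i2) =
          -flatScale ^ 2 * (μ * k) * β * Complex.exp (β * z) ∧
        symp (X.1.transpose i3) ((A z).transpose i2) =
          -flatScale ^ 2 * k * α * Complex.exp (-α * z) ∧
        symp (X.1.transpose i4) ((A z).transpose i2) =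
          -flatScale ^ 2 * (μ * k) * β * Complex.exp (-β * z)) := by
  have hα := quartic_root_left hs hp
  have hβ := quartic_root_right hs hp
  obtain ⟨c₁, hc₁⟩ := hA.exists_const (quartic_root_neg hα)
  obtain ⟨c₂, hc₂⟩ := hA.exists_const (quartic_root_neg hβ)
  obtain ⟨c₃, hc₃⟩ := hA.exists_const hα
  obtain ⟨c₄, hc₄⟩ := hA.exists_const hβ
  have hp0 := flatScale_ne_zero
  have hne' := sub_ne_zero.2 hne
  -- This k normalizes the pairing of the first and third columns to 1; the condition μ²β = -α then
  -- does the same for the second and fourth.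
  obtain ⟨k, hk⟩ : ∃ k : ℂ, k ^ 2 * (-2 * α * flatScale ^ 3 * (α ^ 2 - β ^ 2)) = 1 :=
    ⟨csqrt (-2 * α * flatScale ^ 3 * (α ^ 2 - β ^ 2))⁻¹, by rw [csqrt_sq]; field_simp⟩
  obtain ⟨x, hx⟩ := hA.nonempty
  have hz₀ := e.map_source hx
  have hB := hA.mem _ hz₀
  have hsymp : ∀ {l l' : ℂ} {c c' : Idx → ℂ},
      (A (e x)).mulVec (eigenvec T l) = Complex.exp (l * e x) • c →
      (A (e x)).mulVec (eigenvec T l') = Complex.exp (l' * e x) • c' →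
      symp c c' = Complex.exp (-(l * e x + l' * e x)) *
        (flatScale ^ 3 * ((l - l') * (10 * T - l ^ 2 - l' ^ 2))) := fun h h' => by
    rw [symp_eq_of_frame hB h h', symp_eigenvec]
  have h12 := hsymp (hc₁ _ hz₀) (hc₂ _ hz₀)
  have h13 := hsymp (hc₁ _ hz₀) (hc₃ _ hz₀)
  have h14 := hsymp (hc₁ _ hz₀) (hc₄ _ hz₀)
  have h23 := hsymp (hc₂ _ hz₀) (hc₃ _ hz₀)
  have h24 := hsymp (hc₂ _ hz₀) (hc₄ _ hz₀)
  have h34 := hsymp (hc₃ _ hz₀) (hc₄ _ hz₀)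
  -- This factor makes the eigenvectors for ±α orthogonal to those for ±β.
  have h0 : 10 * T - α ^ 2 - β ^ 2 = 0 := by linear_combination -hs
  have h0' : 10 * T - β ^ 2 - α ^ 2 = 0 := by linear_combination -hs
  simp only [neg_sq, h0, h0', mul_zero] at h12 h14 h23 h34
  rw [show -(-α * e x + α * e x) = 0 by ring, Complex.exp_zero, one_mul, neg_sq] at h13
  rw [show -(-β * e x + β * e x) = 0 by ring, Complex.exp_zero, one_mul, neg_sq] at h24
  let X : Matrix Idx Idx ℂ := Matrix.transpose
    (Sum.elim ![-k • c₁, -(μ * k) • c₂] ![k • c₃, (μ * k) • c₄])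
  have hX : X ∈ Matrix.symplecticGroup (Fin 2) ℂ := by
    refine mem_symplecticGroup_of_symp ?_ ?_ ?_ ?_ ?_ ?_
    · show symp (-k • c₁) (-(μ * k) • c₂) = 0
      rw [symp_smul_left, symp_smul_right, h12]; ring
    · show symp (-k • c₁) (k • c₃) = 1
      rw [symp_smul_left, symp_smul_right, h13]
      linear_combination hk - 2 * α * k ^ 2 * flatScale ^ 3 * hs
    · show symp (-k • c₁) ((μ * k) • c₄) = 0
      rw [symp_smul_left, symp_smul_right, h14]; ring
    · show symp (-(μ * k) • c₂) (k • c₃) = 0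
      rw [symp_smul_left, symp_smul_right, h23]; ring
    · show symp (-(μ * k) • c₂) ((μ * k) • c₄) = 1
      rw [symp_smul_left, symp_smul_right, h24]
      linear_combination hk - 2 * β * μ ^ 2 * k ^ 2 * flatScale ^ 3 * hs +
        2 * k ^ 2 * flatScale ^ 3 * (α ^ 2 - β ^ 2) * hμ
    · show symp (k • c₃) ((μ * k) • c₄) = 0
      rw [symp_smul_left, symp_smul_right, h34]; ring
  refine ⟨⟨X, hX⟩, k, fun z hz => ?_⟩
  have hBz := hA.mem z hz
  obtain ⟨a1, b1⟩ := symp_frame_col hBz (hc₁ z hz)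
  obtain ⟨a2, b2⟩ := symp_frame_col hBz (hc₂ z hz)
  obtain ⟨a3, b3⟩ := symp_frame_col hBz (hc₃ z hz)
  obtain ⟨a4, b4⟩ := symp_frame_col hBz (hc₄ z hz)
  simp only [eigenvec, vec4, Sum.elim_inr, Matrix.cons_val_zero, Matrix.cons_val_one,
    neg_mul, neg_neg] at a1 a2 a3 a4 b1 b2 b3 b4
  have e1 : X.transpose i1 = -k • c₁ := rfl
  have e2 : X.transpose i2 = -(μ * k) • c₂ := rfl
  have e3 : X.transpose i3 = k • c₃ := rfl
  have e4 : X.transpose i4 = (μ * k) • c₄ := rfl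
  simp only [e1, e2, e3, e4, symp_smul_left, a1, a2, a3, a4, b1, b2, b3, b4, neg_mul]
  refine ⟨⟨?_, ?_, ?_, ?_⟩, ?_, ?_, ?_, ?_⟩ <;> ring

lemma IsConstantFrame.exists_act_wCurve (hA : IsConstantFrame f e A T) {q : ℚ} (hq : 1 < q)
    {α β σ : ℂ} (hs : α ^ 2 + β ^ 2 = 10 * T) (hp : α ^ 2 * β ^ 2 = 9 * T ^ 2 + 1)
    (hne : α ^ 2 ≠ β ^ 2) (hα0 : α ≠ 0)
    (hα : 2 * α = ((1 + (q.num.toNat + q.den) % 2) * q.num.toNat : ℕ) * σ)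
    (hβ : 2 * β = (q.den * (1 + (q.num.toNat + q.den) % 2) : ℕ) * σ) :
    ∃ X : Sp2, ∀ z ∈ e.target,
      f (e.symm z) = act X (wCurve q hq (Complex.exp (σ * z) : ℂ)) := by
  generalize hm : q.num.toNat = m at *
  generalize hn' : q.den = n at *
  have hn : (n : ℂ) ≠ 0 := by rw [← hn']; exact_mod_cast q.den_ne_zero
  have hαβ : n * α = m * β := by
    push_cast at hα hβ
    linear_combination (n / 2 : ℂ) * hα - (m / 2 : ℂ) * hβ
  have hK := two_mul_half_exponent m n
  have hsum : α + β = ((m + n) * (1 + (m + n) % 2) / 2 : ℕ) * σ := by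
    have h2 := congrArg (Nat.cast (R := ℂ)) hK
    push_cast at h2 hα hβ ⊢
    linear_combination (1 / 2) * hα + (1 / 2) * hβ - (σ / 2) * h2
  have hsq := sqrt_mul_sq m n
  have hI := Complex.I_sq
  -- Here μ² = -m/n = -α/β; this is the source of the coefficients i√(mn) in f_q.
  obtain ⟨X, k, hX⟩ := hA.exists_symplectic (μ := Complex.I * (Real.sqrt (m * n) : ℂ) / n) hs hp hne
    hα0 (by
      rw [div_pow, mul_pow, hI, hsq]
      field_simp
      linear_combination hαβ)
  refine ⟨X, fun z hz => ?_⟩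
  have hspan := hA.span _ (e.map_target hz)
  rw [e.right_inv hz] at hspan
  refine ((eq_iff_symp (act_eq_span X (wCurve_eq_span hq (OnePoint.coe_ne_infty _))) hspan).2
    fun i => ?_).symm
  rw [RiemannSphere.chartZero_coe, hm, hn', vq, wq]
  obtain ⟨⟨a1, a2, a3, a4⟩, b1, b2, b3, b4⟩ := hX z hz
  have hexp : ∀ K : ℕ, ∀ a : ℂ, a = K * σ → Complex.exp (σ * z) ^ K = Complex.exp (a * z) := by
    rintro K a rfl
    rw [← Complex.exp_nat_mul]; congr 1; ring
  rw [hexp _ _ hα, hexp _ _ hβ, hexp _ _ hsum]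
  have hsw : ∀ x y, symp x y = -symp y x := fun x y => by simp only [symp]; ring
  have s1 : Complex.exp (2 * α * z) * Complex.exp (-α * z) = Complex.exp (α * z) := by
    rw [← Complex.exp_add]; congr 1; ring
  have s2 : Complex.exp (2 * β * z) * Complex.exp (-β * z) = Complex.exp (β * z) := by
    rw [← Complex.exp_add]; congr 1; ring
  have s3 : Complex.exp ((α + β) * z) * Complex.exp (-α * z) = Complex.exp (β * z) := by
    rw [← Complex.exp_add]; congr 1; ring
  have s4 : Complex.exp ((α + β) * z) * Complex.exp (-β * z) = Complex.exp (α * z) := by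
    rw [← Complex.exp_add]; congr 1; ring
  generalize Complex.exp (2 * α * z) = u1 at *
  generalize Complex.exp (2 * β * z) = u2 at *
  generalize Complex.exp ((α + β) * z) = u3 at *
  generalize Complex.exp (-α * z) = u4 at *
  generalize Complex.exp (-β * z) = u5 at *
  generalize Complex.exp (α * z) = u6 at *
  generalize Complex.exp (β * z) = u7 at *
  generalize ((Real.sqrt (m * n) : ℝ) : ℂ) = s at *
  have hni := mul_inv_cancel₀ hn
  rw [div_eq_mul_inv] at a2 a4 b2 b4
  fin_cases i <;>
    simp only [Fin.zero_eta, Fin.mk_one, Fin.reduceFinMk, Matrix.cons_val] <;>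
    rw [hsw, symp_mulVec_vec4, hsw _ (X.1.transpose i1), hsw _ (X.1.transpose i2),
      hsw _ (X.1.transpose i3), hsw _ (X.1.transpose i4)]
  · rw [a1, a2, a3, a4]
    linear_combination (-(m + n) * flatScale ^ 3 * k) * s1 -
      2 * Complex.I ^ 2 * s ^ 2 * (n : ℂ)⁻¹ * flatScale ^ 3 * k * s4 -
      2 * flatScale ^ 3 * k * u6 * (n : ℂ)⁻¹ * (s ^ 2 * hI - hsq) +
      2 * m * flatScale ^ 3 * k * u6 * hni
  · rw [b1, b2, b3, b4]
    linear_combination ((m + n) * α * flatScale ^ 2 * k) * s1 +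
      2 * Complex.I ^ 2 * s ^ 2 * (n : ℂ)⁻¹ * β * flatScale ^ 2 * k * s4 +
      2 * β * flatScale ^ 2 * k * u6 * (n : ℂ)⁻¹ * (s ^ 2 * hI - hsq) -
      2 * m * β * flatScale ^ 2 * k * u6 * hni + 2 * flatScale ^ 2 * k * u6 * hαβ
  · rw [a1, a2, a3, a4]
    linear_combination (-2 * Complex.I * s * flatScale ^ 3 * k) * s3 +
      (m + n) * flatScale ^ 3 * (Complex.I * s * (n : ℂ)⁻¹) * k * s2 +
      2 * Complex.I * s * flatScale ^ 3 * k * u7 * hni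
  · rw [b1, b2, b3, b4]
    linear_combination (2 * Complex.I * s * flatScale ^ 2 * k * α) * s3 -
      (m + n) * flatScale ^ 2 * (Complex.I * s * (n : ℂ)⁻¹) * k * β * s2 +
      2 * Complex.I * s * flatScale ^ 2 * k * u7 * ((n : ℂ)⁻¹ * hαβ - α * hni)

lemma IsConstantFrame.isDominatedBy [T2Space S] [ConnectedSpace S] [IsManifold 𝓘(ℂ) ω S]
    (hA : IsConstantFrame f e A T) (hf : IsHolomorphic f) {q : ℚ} (hq : 1 < q) {α β : ℂ}
    (hs : α ^ 2 + β ^ 2 = 10 * T) (hp : α ^ 2 * β ^ 2 = 9 * T ^ 2 + 1)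
    (hne : α ^ 2 ≠ β ^ 2) (hα0 : α ≠ 0) (hαβ : α = q * β) :
    IsDominatedBy f (wCurve q hq) := by
  have hα := quartic_root_left hs hp
  have hβ := quartic_root_right hs hp
  have h1 : α ≠ β := fun h => hne (by rw [h])
  have h2 : α ≠ -β := fun h => hne (by rw [h, neg_sq])
  have h3 : α ≠ -α := fun h => hα0 (by linear_combination (1 / 2) * h)
  have hn : (q.den : ℂ) ≠ 0 := by exact_mod_cast q.den_ne_zero
  have hnum : 0 < q.num := Rat.num_pos.2 (by linarith)
  have hcop : q.num.toNat.Coprime q.den := by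
    have := q.reduced
    rwa [show q.num.natAbs = q.num.toNat by omega] at this
  have hq' : (q : ℂ) = q.num.toNat / q.den := by
    have h4 : ((q.num.toNat : ℤ) : ℚ) = q.num := by rw [Int.toNat_of_nonneg hnum.le]
    have h5 : q = (q.num.toNat : ℚ) / q.den := by
      rw [← Int.cast_natCast, h4, Rat.num_div_den]
    have h6 := congrArg (Rat.cast (K := ℂ)) h5
    rwa [Rat.cast_div, Rat.cast_natCast, Rat.cast_natCast] at h6
  have hε : ((1 + (q.num.toNat + q.den) % 2 : ℕ) : ℂ) ≠ 0 := by
    exact_mod_cast (by omega : 1 + (q.num.toNat + q.den) % 2 ≠ 0)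
  obtain ⟨σ, hσ⟩ : ∃ σ : ℂ, 2 * β = (q.den * (1 + (q.num.toNat + q.den) % 2) : ℕ) * σ :=
    ⟨2 * β / (q.den * (1 + (q.num.toNat + q.den) % 2) : ℕ), by
      rw [mul_div_cancel₀]
      rw [Nat.cast_mul]
      exact mul_ne_zero hn hε⟩
  have hσ' : 2 * α = ((1 + (q.num.toNat + q.den) % 2) * q.num.toNat : ℕ) * σ := by
    rw [Nat.cast_mul] at hσ ⊢
    rw [hαβ, hq']
    field_simp
    linear_combination (q.num.toNat : ℂ) * hσ
  have hcopM := coprime_exponents hcop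
  have hK := two_mul_half_exponent q.num.toNat q.den
  obtain ⟨X, hX⟩ := hA.exists_act_wCurve hq hs hp hne hα0 hσ' hσ
  generalize q.num.toNat = m at *
  generalize q.den = n at *
  -- F₁ continues e^{2αz} and F₂ continues e^{(α+β)z}. In terms of e^{σz} they are the powers (1+ε)m
  -- and (m+n)(1+ε)/2.
  obtain ⟨F₁, hF₁, hF₁e⟩ := hA.exists_isMero_exp hf (quartic_root_neg hα) hβ hα hβ
    (fun h => h2 (by rw [← h, neg_neg])) h1
  obtain ⟨F₂, hF₂, hF₂e⟩ := hA.exists_isMero_exp hf hα (quartic_root_neg hα) hα hβ h3 h1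
  -- The Bézout coefficients may be negative, whence the integer powers of F₁ and F₂.
  have hbez := Nat.gcd_eq_gcd_ab ((1 + (m + n) % 2) * m) ((m + n) * (1 + (m + n) % 2) / 2)
  rw [Nat.Coprime] at hcopM
  rw [hcopM] at hbez
  generalize Nat.gcdA ((1 + (m + n) % 2) * m) ((m + n) * (1 + (m + n) % 2) / 2) = j at hbez
  generalize Nat.gcdB ((1 + (m + n) % 2) * m) ((m + n) * (1 + (m + n) % 2) / 2) = k at hbez
  have hexp : ∀ z ∈ e.target, F₁ (e.symm z) ^ j * F₂ (e.symm z) ^ k = Complex.exp (σ * z) := by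
    intro z hz
    rw [hF₁e z hz, hF₂e z hz, ← Complex.exp_int_mul, ← Complex.exp_int_mul, ← Complex.exp_add]
    congr 1
    have h4 := congrArg (Nat.cast (R := ℂ)) hK
    have h5 := congrArg (Int.cast (R := ℂ)) hbez
    rw [Nat.cast_mul 2, Nat.cast_add, mul_comm (1 + (m + n) % 2) n] at h4
    simp only [Int.cast_add, Int.cast_mul, Int.cast_natCast, Nat.cast_one, Int.cast_one] at h5
    generalize (((m + n) * (1 + (m + n) % 2) / 2 : ℕ) : ℂ) = K at *
    generalize (((1 + (m + n) % 2) * m : ℕ) : ℂ) = M at *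
    generalize ((n * (1 + (m + n) % 2) : ℕ) : ℂ) = N at *
    push_cast at h4
    linear_combination j * z * hσ' + k * z / 2 * (hσ' + hσ) - k * z * σ / 2 * h4 - σ * z * h5
  obtain ⟨h, hh, hhe⟩ := ((hF₁.zpow j).mul (hF₂.zpow k)).exists_extension
  -- Both sides are holomorphic on S and agree near a point of the disk, except possibly at that
  -- point.
  refine ⟨h, hh, X, fun p => congrFun (hf.eq_of_eventually_eq
    (isHolomorphic_act_wCurve hq X hh) ?_) p⟩
  obtain ⟨p, hp⟩ := hA.nonempty
  refine ⟨p, ?_⟩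
  filter_upwards [hhe p, nhdsWithin_le_nhds (e.open_source.mem_nhds hp)] with x hx hxs
  have h6 := hX _ (e.map_source hxs)
  have h7 := hexp _ (e.map_source hxs)
  rw [e.left_inv hxs] at h6 h7
  rw [hx, h6, h7]

lemma IsConstantFrame.r_eq_cls {q : ℚ} (hq : 1 < q) {α β : ℂ} (hs : α ^ 2 + β ^ 2 = 10 * T)
    (hp : α ^ 2 * β ^ 2 = 9 * T ^ 2 + 1) (hβ0 : β ≠ 0) (hαβ : α = q * β)
    (hT : IsRegularValue (16 * T ^ 2)) {u : ℂˣ} (hu : (u : ℂ) = q) : r _ hT = cls u := by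
  have hq0 : (q : ℂ) ≠ 0 := by exact_mod_cast (by linarith : q ≠ 0)
  have hα0 : α ≠ 0 := by rw [hαβ]; exact mul_ne_zero hq0 hβ0
  refine cls_eq_of_sq ?_
  rw [Units.val_mk0, hu]
  rcases rNum_sq hs hp hα0 hβ0 with h | h
  · left
    rw [h, hαβ, mul_div_cancel_right₀ _ hβ0]
  · right
    rw [h, hαβ]
    field_simp

end Bending

lemma memClass_cls_iff {q : ℚ} (hq : 1 < q) {u : ℂˣ} (hu : (u : ℂ) = q) (x : ℝ) :
    (1 < x ∧ MemClass (x : ℂ) (cls u)) ↔ x = (q : ℝ) := by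
  have hq' : (1 : ℝ) < q := by exact_mod_cast hq
  constructor
  · rintro ⟨hx, v, hv, hvu⟩
    have h := sq_add_inv_sq_of_cls_eq hvu
    rw [hv, hu] at h
    refine eq_of_sq_add_inv_sq hx hq' ?_
    exact_mod_cast h
  · rintro rfl
    exact ⟨hq', u, by rw [hu]; push_cast; rfl, rfl⟩

end IsotropicCurves
end

theorem theoremE {S : Type*} [TopologicalSpace S] [T2Space S] [CompactSpace S] [ConnectedSpace S]
    [ChartedSpace ℂ S] [IsManifold 𝓘(ℂ) ω S]
    (f : S → IsotropicCurves.Q3) (hf : IsotropicCurves.IsIsotropicCurve f)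
    (κ : ℂ) (hκ : IsotropicCurves.HasConstantBending f κ) :
    IsotropicCurves.IsGeneralType f ∧
      ∃ hreg : IsotropicCurves.IsRegularValue κ,
        IsotropicCurves.r κ hreg ∈ IsotropicCurves.ratClasses ∧
        ∃ (q : ℚ) (hq : 1 < q),
          (∀ x : ℝ, (1 < x ∧ IsotropicCurves.MemClass (x : ℂ) (IsotropicCurves.r κ hreg)) ↔
            x = (q : ℝ)) ∧
          IsotropicCurves.IsDominatedBy f (IsotropicCurves.wCurve q hq) := by
  obtain ⟨e, A, hA, hne, hball, T, rfl, hmc⟩ := hκ.exists_constant_frame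
  have hA' : IsotropicCurves.IsConstantFrame f e A T := ⟨hA, hne, hball, hmc⟩
  have hT := hA'.isRegularValue hf.holo
  obtain ⟨q, α, β, hq, hαβ, hs, hp⟩ := hA'.exists_rat hf.holo hT
  obtain ⟨hα0, hβ0⟩ := IsotropicCurves.quartic_roots_ne_zero hp hT
  have hq0 : q ≠ 0 := by linarith
  have hu : ((Units.map (algebraMap ℚ ℂ).toMonoidHom (Units.mk0 q hq0) : ℂˣ) : ℂ) = q := by simp
  have hr := IsotropicCurves.IsConstantFrame.r_eq_cls hq hs hp hβ0 hαβ hT hu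
  refine ⟨hκ.1, hT, ⟨Units.mk0 q hq0, hr⟩, q, hq, fun x => ?_,
    hA'.isDominatedBy hf.holo hq hs hp (IsotropicCurves.quartic_roots_sq_ne hs hp hT) hα0 hαβ⟩
  rw [hr]
  exact IsotropicCurves.memClass_cls_iff hq hu x
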